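/- Let $\mathbb S$ be a standard Borel space, $G_0$ a nonatomic probability measure on $\mathbb S$, $\theta>0$, and let $\rho\ge 0$ be a measurable function on $(0,\infty)$ with $\int_0^\infty\rho(s)\,ds=\infty$ and $\psi(u)=\int_0^\infty(1-e^{-us})\rho(s)\,ds<\infty$ for all $u>0$. Let $\tilde\mu=\sum_{k\ge1}J_k\delta_{W_k}\sim\mathrm{CRM}(\theta,\rho,G_0)$, i.e. the points $(J_k,W_k)$ form a Poisson random measure on $(0,\infty)\times\mathbb S$ with intensity $\theta\rho(s)\,ds\,G_0(dx)$. Let $n\ge1$, $\lambda>0$ and, given $\tilde\mu$, let $X_1,\dots,X_{n+1}$ be i.i.d. generalized Indian buffet processes with Poisson levels: $X_i=\sum_k A_{i,k}\delta_{W_k}$ where, given all the $(J_k,W_k)$, the $A_{i,k}$ are independent and $A_{i,k}\sim\mathrm{Poisson}(\lambda J_k)$. Let $h:\mathbb S\to\{1,\dots,J\}$ be a random hash function, drawn independently of the $J_k,W_k,A_{i,k}$ from a measurable family, and uniform in the sense that almost surely the buckets $D_j=h^{-1}(\{j\})$ satisfy $G_0(D_j)=1/J$ for every $j$. Put $C_j=\sum_{i=1}^nX_i(D_j)$,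 $B_j=X_{n+1}(D_j)$ and, for $y\in\mathbb S$, $f_y=\sum_{i=1}^nX_i(\{y\})$. For $j\in\{1,\dots,J\}$ and integers $0\le l\le c$, $0\le a\le b$ with $l+a\ge1$, let $$\Pi_j(l,a\mid c,b)=\sum_{k\ge1}\Pr\big[h(W_k)=j,\ f_{W_k}=l,\ X_{n+1}(\{W_k\})=a\ \big|\ C_j=c,\ B_j=b\big].$$ Since the $W_k$ are almost surely distinct, this is the conditional expected number, given $C_j=c$ and $B_j=b$, of traits $Y$ in bucket $j$ that have frequency level $f_Y=l$ in the first $n$ samples and level $X_{n+1}(\{Y\})=a$ in the new one; for $a\ge1$ these are traits displayed by $X_{n+1}$. Let $\phi^{(m)}(u)=(-1)^m\frac{d^m}{du^m}e^{-\frac{\theta}{J}\psi(u)}$ and $\kappa(u,m)=\int_0^\infty e^{-us}s^m\rho(s)\,ds$. Then $$\Pi_j(l,a\mid c,b)=\frac{\theta}{J}\binom cl\binom ba\,\frac{\phi^{(c-l+b-a)}((n+1)\lambda)}{\phi^{(c+b)}((n+1)\lambda)}\,\kappa\big((n+1)\lambda,\,l+a\big).$$ In particular: (i) (Gamma CRM)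 if $\rho(s)=s^{-1}e^{-s}$, then $$\Pi_j(l,a\mid c,b)=\frac{\theta}{J}\binom cl\binom ba\,(l+a-1)!\,\frac{\Gamma(\theta/J+c+b-l-a)}{\Gamma(\theta/J+c+b)};$$ (ii) (generalized Gamma CRM) if $\rho(s)=\frac{\alpha}{\Gamma(1-\alpha)}s^{-\alpha-1}e^{-\tau s}$ with $0<\alpha<1$ and $\tau>0$, then $$\Pi_j(l,a\mid c,b)=\frac{\theta}{J}\binom cl\binom ba\,\frac{\alpha\,(1-\alpha)_{(l+a-1)}}{(\tau+(n+1)\lambda)^{-\alpha+l+a}}\cdot\frac{\displaystyle\sum_{i=0}^{c-l+b-a}\Big(\frac{\theta}{J}\Big)^i\frac{\mathscr C(c-l+b-a,i;\alpha)}{(\tau+(n+1)\lambda)^{c-l+b-a-\alpha i}}}{\displaystyle\sum_{i=0}^{c+b}\Big(\frac{\theta}{J}\Big)^i\frac{\mathscr C(c+b,i;\alpha)}{(\tau+(n+1)\lambda)^{c+b-\alpha i}}},$$ where $(x)_{(m)}=\prod_{i=0}^{m-1}(x+i)$ and $\mathscr C(m,k;\alpha)=\frac1{k!}\sum_{i=0}^k(-1)^i\binom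 ki(-i\alpha)_{(m)}$. -/

import Mathlib

open MeasureTheory ProbabilityTheory Set
open scoped ENNReal NNReal

noncomputable section

namespace TraitSketch

/-- `N` is a Poisson random measure with intensity `ν`: counts of measurable sets are random
variables, Poisson with mean `ν B` (almost surely infinite when `ν B = ∞`), and the counts of
disjoint sets are independent. -/
structure IsPoissonRandomMeasure {Ω E : Type*} [MeasurableSpace Ω] [MeasurableSpace E]
    (P : Measure Ω) (N : Ω → Measure E) (ν : Measure E) : Prop where
  measurable : ∀ B : Set E, MeasurableSet B → Measurable fun ω => N ω B
  poisson : ∀ B : Set E, MeasurableSet B → ν B ≠ ∞ →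
    ∀ m : ℕ, P {ω | N ω B = (m : ℝ≥0∞)} = poissonMeasure (ν B).toNNReal {m}
  infinite : ∀ B : Set E, MeasurableSet B → ν B = ∞ → ∀ᵐ ω ∂P, N ω B = ∞
  indep : ∀ (m : ℕ) (B : Fin m → Set E), (∀ i, MeasurableSet (B i)) →
    Pairwise (fun i i' => Disjoint (B i) (B i')) → iIndepFun (fun i ω => N ω (B i)) P

/-- The jump density `ρ` on `(0, ∞)` of a homogeneous completely random measure: infinite total
mass and `∫ (1 - e^{-us}) ρ(s) ds < ∞` for all `u > 0`. -/
structure IsJumpDensity (ρ : ℝ → ℝ) : Prop where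
  measurable : Measurable ρ
  nonneg : ∀ s, 0 < s → 0 ≤ ρ s
  infinite : ∫⁻ s in Ioi (0 : ℝ), ENNReal.ofReal (ρ s) = ∞
  integrable : ∀ u : ℝ, 0 < u →
    IntegrableOn (fun s => (1 - Real.exp (-(u * s))) * ρ s) (Ioi 0)

/-- The Lévy intensity `θ ρ(s) ds G₀(dx)`, supported by `(0, ∞) × S`. -/
def levyIntensity {S : Type*} [MeasurableSpace S] (θ : ℝ) (ρ : ℝ → ℝ) (G₀ : Measure S) :
    Measure (ℝ × S) :=
  ((volume.restrict (Ioi (0 : ℝ))).withDensity fun s => ENNReal.ofReal (θ * ρ s)).prod G₀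

/-- `∑ₖ jump k • δ_{loc k}` is a completely random measure `CRM(θ, ρ, G₀)`: the points
`(jump k, loc k)` are the points of a Poisson random measure with intensity
`θ ρ(s) ds G₀(dx)`. -/
structure IsCRM {Ω S : Type*} [MeasurableSpace Ω] [MeasurableSpace S] (P : Measure Ω)
    (θ : ℝ) (ρ : ℝ → ℝ) (G₀ : Measure S) (jump : ℕ → Ω → ℝ) (loc : ℕ → Ω → S) : Prop where
  measurable_jump : ∀ k, Measurable (jump k)
  measurable_loc : ∀ k, Measurable (loc k)
  jump_pos : ∀ k ω, 0 < jump k ω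
  poisson : IsPoissonRandomMeasure P
    (fun ω => Measure.sum fun k => Measure.dirac (jump k ω, loc k ω)) (levyIntensity θ ρ G₀)

/-- Given the completely random measure with jumps `jump k` at `loc k`, the samples
`X i = ∑ₖ lev i k • δ_{loc k}` are i.i.d. generalized Indian buffet processes with level
distribution `GA`: conditionally on all jumps and locations, the levels `lev i k` are independent
and `lev i k` has law `GA (jump k)`. -/
structure IsIBPSample {Ω S : Type*} [MeasurableSpace Ω] [MeasurableSpace S] (P : Measure Ω)
    (GA : ℝ → Measure ℕ) {N : ℕ} (jump : ℕ → Ω → ℝ) (loc : ℕ → Ω → S)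
    (lev : Fin N → ℕ → Ω → ℕ) : Prop where
  measurable_lev : ∀ i k, Measurable (lev i k)
  cond_law : ∀ (F : Finset (Fin N × ℕ)) (a : Fin N × ℕ → ℕ) (E : Set (ℕ → ℝ × S)),
    MeasurableSet E →
    P {ω | (fun k => (jump k ω, loc k ω)) ∈ E ∧ ∀ p ∈ F, lev p.1 p.2 ω = a p} =
      ∫⁻ ω in {ω | (fun k => (jump k ω, loc k ω)) ∈ E}, ∏ p ∈ F, GA (jump p.2 ω) {a p} ∂P

/-- The hash function `H (seed ω)` is drawn at random from the family `H`, independently of the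
completely random measure and of the samples, and it is uniform: almost surely, all the buckets
`D_j = h⁻¹{j}` have the same `G₀`-measure `1 / J`. -/
structure IsUniformHash {Ω Θ S : Type*} [MeasurableSpace Ω] [MeasurableSpace Θ]
    [MeasurableSpace S] (P : Measure Ω) (G₀ : Measure S) {N J : ℕ} (jump : ℕ → Ω → ℝ)
    (loc : ℕ → Ω → S) (lev : Fin N → ℕ → Ω → ℕ) (H : Θ → S → Fin J) (seed : Ω → Θ) :
    Prop where
  measurable_hash : Measurable fun p : Θ × S => H p.1 p.2
  measurable_seed : Measurable seed
  indep : IndepFun seed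
    (fun ω => (fun k => (jump k ω, loc k ω), fun i k => lev i k ω) :
      Ω → (ℕ → ℝ × S) × (Fin N → ℕ → ℕ)) P
  uniform : ∀ᵐ ω ∂P, ∀ j : Fin J, G₀ (H (seed ω) ⁻¹' {j}) = (J : ℝ≥0∞)⁻¹

/-- The sample `X = ∑ₖ a k • δ_{w k}` as a measure on the space of traits. -/
def sample {S : Type*} [MeasurableSpace S] (a : ℕ → ℕ) (w : ℕ → S) : Measure S :=
  Measure.sum fun k => (a k : ℝ≥0∞) • Measure.dirac (w k)

/-- The `i`-th sample `X_i`. -/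
def X {Ω S : Type*} [MeasurableSpace S] {N : ℕ} (loc : ℕ → Ω → S) (lev : Fin N → ℕ → Ω → ℕ)
    (i : Fin N) (ω : Ω) : Measure S :=
  sample (fun k => lev i k ω) (fun k => loc k ω)

/-- `∑_{i ≤ n} X_i(D)`, the total level in the first `n` of the `n + 1` samples of the traits
in `D`. -/
def totalLevel {Ω S : Type*} [MeasurableSpace S] {n : ℕ} (loc : ℕ → Ω → S)
    (lev : Fin (n + 1) → ℕ → Ω → ℕ) (D : Set S) (ω : Ω) : ℝ≥0∞ :=
  ∑ i : Fin n, X loc lev i.castSucc ω D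

/-- The bucket `D_j = h⁻¹{j}` of the random hash function. -/
def bucket {Ω Θ S : Type*} {J : ℕ} (H : Θ → S → Fin J) (seed : Ω → Θ) (j : Fin J) (ω : Ω) :
    Set S :=
  H (seed ω) ⁻¹' {j}

/-- The `j`-th counter `C_j` of the sketch of the first `n` samples. -/
def C {Ω Θ S : Type*} [MeasurableSpace S] {n J : ℕ} (loc : ℕ → Ω → S)
    (lev : Fin (n + 1) → ℕ → Ω → ℕ) (H : Θ → S → Fin J) (seed : Ω → Θ) (j : Fin J) (ω : Ω) :
    ℝ≥0∞ :=
  totalLevel loc lev (bucket H seed j ω) ω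

/-- The increment `B_j = X_{n+1}(D_j)` of the `j`-th bucket by the new sample. -/
def B {Ω Θ S : Type*} [MeasurableSpace S] {n J : ℕ} (loc : ℕ → Ω → S)
    (lev : Fin (n + 1) → ℕ → Ω → ℕ) (H : Θ → S → Fin J) (seed : Ω → Θ) (j : Fin J) (ω : Ω) :
    ℝ≥0∞ :=
  X loc lev (Fin.last n) ω (bucket H seed j ω)

/-- The empirical frequency level `f_y = ∑_{i ≤ n} X_i({y})` of the trait `y`. -/
def freq {Ω S : Type*} [MeasurableSpace S] {n : ℕ} (loc : ℕ → Ω → S)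
    (lev : Fin (n + 1) → ℕ → Ω → ℕ) (y : S) (ω : Ω) : ℝ≥0∞ :=
  totalLevel loc lev {y} ω

/-- The posterior weight, given `C_j = c` and `B_j = b`, of the traits of bucket `j` with
frequency level `l` in the first `n` samples and level `a` in the new one: the sum over the
traits `Y = loc k` of the conditional probabilities of
`h(Y) = j`, `f_Y = l` and `X_{n+1}({Y}) = a`. As the locations are almost surely distinct, it is
the conditional expected number of such traits. -/
def posterior {Ω Θ S : Type*} [MeasurableSpace Ω] [MeasurableSpace S] (P : Measure Ω) {n J : ℕ}
    (loc : ℕ → Ω → S) (lev : Fin (n + 1) → ℕ → Ω → ℕ) (H : Θ → S → Fin J) (seed : Ω → Θ)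
    (j : Fin J) (c b l a : ℕ) : ℝ≥0∞ :=
  ∑' k : ℕ,
    P[{ω | H (seed ω) (loc k ω) = j ∧ freq loc lev (loc k ω) ω = (l : ℝ≥0∞) ∧
          X loc lev (Fin.last n) ω {loc k ω} = (a : ℝ≥0∞)} |
      {ω | C loc lev H seed j ω = (c : ℝ≥0∞) ∧ B loc lev H seed j ω = (b : ℝ≥0∞)}]

/-- `ψ(u) = ∫ (1 - e^{-us}) ρ(s) ds`. -/
def psi (ρ : ℝ → ℝ) (u : ℝ) : ℝ :=
  ∫ s in Ioi (0 : ℝ), (1 - Real.exp (-(u * s))) * ρ s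

/-- `φ^{(m)}(u) = (-1)^m (d/du)^m e^{-t ψ(u)}`, used with `t = θ / J`. -/
def phi (t : ℝ) (ρ : ℝ → ℝ) (m : ℕ) (u : ℝ) : ℝ :=
  (-1) ^ m * iteratedDeriv m (fun v => Real.exp (-(t * psi ρ v))) u

/-- `κ(u, m) = ∫ e^{-us} s^m ρ(s) ds`. -/
def kappa (ρ : ℝ → ℝ) (u : ℝ) (m : ℕ) : ℝ :=
  ∫ s in Ioi (0 : ℝ), Real.exp (-(u * s)) * s ^ m * ρ s

/-- The rising factorial `x (x + 1) ⋯ (x + m - 1)`. -/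
def rising (x : ℝ) (m : ℕ) : ℝ :=
  ∏ i ∈ Finset.range m, (x + i)

/-- The generalized factorial coefficient
`𝒞(m, k; α) = (1 / k!) ∑_{i ≤ k} (-1)^i (k choose i) (-iα)_{(m)}`. -/
def genFactCoeff (m k : ℕ) (α : ℝ) : ℝ :=
  (1 / (k.factorial : ℝ)) *
    ∑ i ∈ Finset.range (k + 1), (-1) ^ i * (k.choose i : ℝ) * rising (-(i * α)) m

end TraitSketch

end

open Filter Topology

noncomputable section

namespace TraitSketch

/-! Freeze the hash seed, which is independent of everything else. The bucket becomes a fixed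
measurable set `D` with `G₀ D = 1 / J`. Let `T` be the sum of the jumps located in `D`. Given the
atoms, the two counts of `D` are independent Poisson variables with means `n r T` and `r T`. So the
probability that they equal `c` and `b` is an explicit factor times `E[T^(c+b) e^{-(n+1) r T}]`. The
Laplace transform of `T` is `v ↦ exp(-(θ/J) ψ(v))`, and differentiating it `c + b` times identifies
this moment with `phi`.

For the numerator, single out the atom `k`, with jump `s`, and let `R` be the mass of the other
atoms in `D`. If this atom has levels `l` and `a`, the others must supply `c - l` and `b - a`. The
joint probability is thus an explicit factor times the expectation of `s^(l+a) e^{-us} R^q e^{-uR}`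
on the event that the atom lies in `D`, with `u = (n+1) r` and `q = (c-l) + (b-a)`. Summed over `k`,
the Mecke formula decouples the atom from the rest: the atom contributes `(θ/J) κ(u, l+a)`, the rest
contributes `phi` of order `q`. In the quotient the powers of `n r` and `r` cancel and the
factorials become binomial coefficients.

The definition of a Poisson random measure only gives the law and independence of counts. The
Laplace functional is built from it by simple functions, and differentiating it in the direction of
an indicator yields the Mecke formula (`lintegral_nexp_mul_lintegral`). Second moments then show
that the locations are almost surely distinct (`ae_injective_loc`), so that the mass at `loc k`
consists of the levels of the trait `k` alone.

In both special cases `κ(·, 1)` is a gamma integral. Integrating it gives `ψ`, and an induction on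
the order of the derivative gives `phi` in closed form. -/

/-- `e^{-x}` for an extended nonnegative real `x`. -/
def nexp (x : ℝ≥0∞) : ℝ≥0∞ := (EReal.exp (x : EReal))⁻¹

/-! ### The exponential on `[0, ∞]` and its difference quotients at `0`. -/

lemma exp_coe_ne_zero (x : ℝ≥0∞) : EReal.exp (x : EReal) ≠ 0 := by
  simp

@[simp] lemma nexp_zero : nexp 0 = 1 := by simp [nexp]

@[simp] lemma nexp_top : nexp ∞ = 0 := by simp [nexp]

lemma nexp_add (x y : ℝ≥0∞) : nexp (x + y) = nexp x * nexp y := by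
  rw [nexp, EReal.coe_ennreal_add, EReal.exp_add, ENNReal.mul_inv, nexp, nexp]
  · exact Or.inl (exp_coe_ne_zero x)
  · exact Or.inr (exp_coe_ne_zero y)

lemma nexp_sum {ι : Type*} (s : Finset ι) (f : ι → ℝ≥0∞) :
    nexp (∑ i ∈ s, f i) = ∏ i ∈ s, nexp (f i) := by
  classical
  induction s using Finset.induction_on with
  | empty => simp
  | insert i s hi ih => rw [Finset.sum_insert hi, Finset.prod_insert hi, nexp_add, ih]

lemma nexp_natCast_mul (m : ℕ) (x : ℝ≥0∞) : nexp (m * x) = nexp x ^ m := by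
  have := nexp_sum (Finset.range m) (fun _ => x)
  simpa using this

lemma continuous_nexp : Continuous nexp :=
  (ENNReal.continuous_exp.comp continuous_coe_ennreal_ereal).inv

@[fun_prop]
lemma measurable_nexp : Measurable nexp := continuous_nexp.measurable

lemma nexp_antitone : Antitone nexp := fun x y h =>
  ENNReal.inv_le_inv.2 (EReal.exp_monotone (by exact_mod_cast h))

lemma nexp_le_one (x : ℝ≥0∞) : nexp x ≤ 1 := by
  simpa using nexp_antitone (zero_le (a := x))

lemma nexp_ne_top (x : ℝ≥0∞) : nexp x ≠ ∞ := ((nexp_le_one x).trans_lt ENNReal.one_lt_top).ne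

lemma nexp_ofReal {x : ℝ} (hx : 0 ≤ x) : nexp (ENNReal.ofReal x) = ENNReal.ofReal (Real.exp (-x)) := by
  rw [nexp, EReal.coe_ennreal_ofReal, max_eq_left hx, EReal.exp_coe, Real.exp_neg,
    ENNReal.ofReal_inv_of_pos (Real.exp_pos x)]

lemma nexp_eq_ofReal {x : ℝ≥0∞} (hx : x ≠ ∞) : nexp x = ENNReal.ofReal (Real.exp (-x.toReal)) := by
  rw [← nexp_ofReal ENNReal.toReal_nonneg, ENNReal.ofReal_toReal hx]

lemma nexp_ne_zero {x : ℝ≥0∞} (hx : x ≠ ∞) : nexp x ≠ 0 := by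
  rw [nexp_eq_ofReal hx]
  simp [Real.exp_pos]

/-- Isolates the change of the Laplace exponent when `f` is perturbed by a multiple of an indicator.
-/
lemma one_sub_nexp_add (x y : ℝ≥0∞) :
    1 - nexp (x + y) = (1 - nexp x) + (1 - nexp y) * nexp x := by
  rw [nexp_add, ENNReal.sub_mul (fun _ _ => nexp_ne_top x), one_mul, mul_comm (nexp y)]
  refine (tsub_add_tsub_cancel (nexp_le_one x) ?_).symm
  exact mul_le_of_le_one_right zero_le (nexp_le_one y)

/-- The sequence `1, 1/2, 1/3, …`. -/
def invSucc (m : ℕ) : ℝ≥0∞ := ENNReal.ofReal (1 / ((m : ℝ) + 1))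

lemma invSucc_ne_top (m : ℕ) : invSucc m ≠ ∞ := ENNReal.ofReal_ne_top

lemma invSucc_ne_zero (m : ℕ) : invSucc m ≠ 0 := by
  have : (0 : ℝ) < 1 / ((m : ℝ) + 1) := by positivity
  simpa [invSucc] using this

lemma invSucc_le_one (m : ℕ) : invSucc m ≤ 1 := by
  rw [invSucc, ENNReal.ofReal_le_one, div_le_one (by positivity)]
  linarith [(Nat.cast_nonneg m : (0 : ℝ) ≤ m)]

lemma tendsto_invSucc : Tendsto invSucc atTop (𝓝 0) := by
  have := (ENNReal.continuous_ofReal.tendsto 0).comp (tendsto_one_div_add_atTop_nhds_zero_nat (𝕜 := ℝ))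
  rw [ENNReal.ofReal_zero] at this
  exact this

lemma tendsto_nexp_invSucc_mul {x : ℝ≥0∞} (hx : x ≠ ∞) :
    Tendsto (fun m => nexp (invSucc m * x)) atTop (𝓝 1) := by
  have h : Tendsto (fun m => invSucc m * x) atTop (𝓝 0) := by
    simpa using ENNReal.Tendsto.mul_const tendsto_invSucc (Or.inr hx)
  simpa [Function.comp_def] using (continuous_nexp.tendsto 0).comp h

/-- Gives the bound `x`, uniform in `ε`, for the quotients `(1 - e^{-εx}) / ε`, hence the domination
in the limits below. -/
lemma one_sub_nexp_le (x : ℝ≥0∞) : 1 - nexp x ≤ x := by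
  rcases eq_or_ne x ∞ with rfl | hx
  · simp
  · rw [nexp_eq_ofReal hx, ← ENNReal.ofReal_one, ← ENNReal.ofReal_sub _ (Real.exp_pos _).le]
    refine (ENNReal.ofReal_le_ofReal ?_).trans (ENNReal.ofReal_toReal hx).le
    linarith [Real.add_one_le_exp (-x.toReal)]

lemma one_sub_nexp_eq {x : ℝ≥0∞} (hx : x ≠ ∞) :
    1 - nexp x = ENNReal.ofReal (1 - Real.exp (-x.toReal)) := by
  rw [nexp_eq_ofReal hx, ← ENNReal.ofReal_one, ← ENNReal.ofReal_sub _ (Real.exp_pos _).le]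

/-- The derivative at `0` of `v ↦ 1 - e^{-g(v) x}`, along `v = 1, 1/2, 1/3, …`, when `g(v) ∼ v`. -/
lemma tendsto_one_sub_nexp_mul_div {x : ℝ≥0∞} (hx : x ≠ ∞) (g : ℕ → ℝ≥0∞) (hg : ∀ m, g m ≠ ∞)
    (hg0 : Tendsto g atTop (𝓝 0))
    (hg1 : Tendsto (fun m => g m / invSucc m) atTop (𝓝 1)) :
    Tendsto (fun m => (1 - nexp (g m * x)) / invSucc m) atTop (𝓝 x) := by
  have hd : HasDerivAt (fun y : ℝ => 1 - Real.exp (-(y * x.toReal))) x.toReal 0 := by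
    have h1 : HasDerivAt (fun y : ℝ => -(y * x.toReal)) (-(1 * x.toReal)) 0 :=
      ((hasDerivAt_id (0 : ℝ)).mul_const x.toReal).neg
    simpa using (h1.exp).const_sub 1
  -- The quotient is the slope of `y ↦ 1 - e^{-yx}` between `0` and `g m`, times `g m / invSucc m`.
  -- `dslope` takes the derivative as its value at `0`, so it is continuous there and may be
  -- evaluated even when `g m = 0`.
  have hl : ∀ m, (1 - nexp (g m * x)) / invSucc m =
      ENNReal.ofReal ((dslope (fun y : ℝ => 1 - Real.exp (-(y * x.toReal))) 0 (g m).toReal))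
        * (g m / invSucc m) := by
    intro m
    rcases eq_or_ne (g m) 0 with h0 | h0
    · simp [h0]
    · have hpos : 0 < (g m).toReal := ENNReal.toReal_pos h0 (hg m)
      rw [dslope_of_ne _ hpos.ne', slope_def_field, one_sub_nexp_eq (ENNReal.mul_ne_top (hg m) hx)]
      simp only [sub_zero, zero_mul, neg_zero, Real.exp_zero, sub_self, ENNReal.toReal_mul]
      rw [ENNReal.ofReal_div_of_pos hpos, ENNReal.ofReal_toReal (hg m), ← mul_div_assoc,
        ENNReal.div_mul_cancel h0 (hg m)]
  simp_rw [hl]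
  have hc : ContinuousAt (dslope (fun y : ℝ => 1 - Real.exp (-(y * x.toReal))) 0) 0 :=
    continuousAt_dslope_same.2 hd.differentiableAt
  have h2 : Tendsto (fun m => (g m).toReal) atTop (𝓝 0) := by
    simpa [Function.comp_def] using (ENNReal.tendsto_toReal ENNReal.zero_ne_top).comp hg0
  have h3 := ENNReal.tendsto_ofReal (hc.tendsto.comp h2)
  rw [dslope_same, hd.deriv, ENNReal.ofReal_toReal hx] at h3
  have h4 := ENNReal.Tendsto.mul h3 (Or.inr ENNReal.one_ne_top) hg1 (Or.inr hx)
  simpa using h4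

lemma tendsto_one_sub_nexp_div {x : ℝ≥0∞} (hx : x ≠ ∞) :
    Tendsto (fun m => (1 - nexp (invSucc m * x)) / invSucc m) atTop (𝓝 x) := by
  refine tendsto_one_sub_nexp_mul_div hx _ invSucc_ne_top tendsto_invSucc ?_
  simp_rw [ENNReal.div_self (invSucc_ne_zero _) (invSucc_ne_top _)]
  exact tendsto_const_nhds

lemma tendsto_one_sub_nexp_one_sub_div {x : ℝ≥0∞} (hx : x ≠ ∞) :
    Tendsto (fun m => (1 - nexp ((1 - nexp (invSucc m)) * x)) / invSucc m) atTop (𝓝 x) := by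
  refine tendsto_one_sub_nexp_mul_div hx _
    (fun m => (tsub_le_self.trans_lt ENNReal.one_lt_top).ne) ?_ ?_
  · refine tendsto_of_tendsto_of_tendsto_of_le_of_le tendsto_const_nhds tendsto_invSucc
      (fun _ => zero_le) (fun m => one_sub_nexp_le _)
  · simpa using tendsto_one_sub_nexp_div ENNReal.one_ne_top

/-! ### Laplace functional, Mecke formula and second moments of a Poisson random measure. -/

section PoissonRandomMeasure

variable {Ω E : Type*} [MeasurableSpace Ω] [MeasurableSpace E] {P : Measure Ω}
  [IsProbabilityMeasure P] {N : Ω → Measure E} {ν : Measure E}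

/-- The exponential series. At `y = 1` it gives total mass one, at `y = e^{-x}` the Laplace
transform of a count. -/
lemma tsum_pow_mul_poissonMeasure (q : ℝ≥0) {y : ℝ≥0∞} (hy : y ≤ 1) :
    ∑' m : ℕ, y ^ m * poissonMeasure q {m} = nexp ((1 - y) * q) := by
  lift y to ℝ≥0 using (hy.trans_lt ENNReal.one_lt_top).ne
  have hy' : (y : ℝ) ≤ 1 := by exact_mod_cast hy
  have hs : HasSum (fun m : ℕ => Real.exp (-q) * (((q * y : ℝ)) ^ m / (m.factorial : ℝ)))
      (Real.exp (-q) * Real.exp (q * y)) := by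
    have := (NormedSpace.expSeries_div_hasSum_exp (q * y : ℝ)).mul_left (Real.exp (-q))
    rwa [← Real.exp_eq_exp_ℝ] at this
  have ht : ∀ m : ℕ, (y : ℝ≥0∞) ^ m * poissonMeasure q {m} =
      ENNReal.ofReal (Real.exp (-q) * (((q * y : ℝ)) ^ m / (m.factorial : ℝ))) := by
    intro m
    rw [poissonMeasure_singleton, ← ENNReal.ofReal_coe_nnreal, ← ENNReal.ofReal_pow y.coe_nonneg,
      ← ENNReal.ofReal_mul (by positivity)]
    congr 1
    rw [mul_pow]; ring
  simp_rw [ht]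
  rw [← ENNReal.ofReal_tsum_of_nonneg (fun m => by positivity) hs.summable, hs.tsum_eq]
  have : (1 - (y : ℝ≥0∞)) * q = ENNReal.ofReal ((1 - y) * q) := by
    rw [ENNReal.ofReal_mul (by linarith), ENNReal.ofReal_sub _ y.coe_nonneg]
    simp
  rw [this, nexp_ofReal (mul_nonneg (by linarith) q.coe_nonneg), ← Real.exp_add]
  congr 2; ring

namespace IsPoissonRandomMeasure

/-- The prescribed probabilities of the values `m` already sum to one, so no mass is left for `∞` or
for non-integers. -/
lemma ae_exists_eq_natCast (h : IsPoissonRandomMeasure P N ν) {B : Set E} (hB : MeasurableSet B)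
    (hν : ν B ≠ ∞) : ∀ᵐ ω ∂P, ω ∈ ⋃ m : ℕ, {ω | N ω B = (m : ℝ≥0∞)} := by
  have hm : ∀ m : ℕ, MeasurableSet {ω | N ω B = (m : ℝ≥0∞)} := fun m =>
    h.measurable B hB (measurableSet_singleton _)
  have hd : Pairwise (Function.onFun Disjoint fun m : ℕ => {ω | N ω B = (m : ℝ≥0∞)}) := by
    intro i j hij
    refine Set.disjoint_left.2 fun ω (h1 : _ = _) (h2 : _ = _) => hij ?_
    exact_mod_cast h1.symm.trans h2
  have h1 : P (⋃ m : ℕ, {ω | N ω B = (m : ℝ≥0∞)}) = 1 := by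
    rw [measure_iUnion hd hm]
    simp_rw [h.poisson B hB hν]
    have := tsum_pow_mul_poissonMeasure (ν B).toNNReal (le_refl (1 : ℝ≥0∞))
    simpa using this
  exact (mem_ae_iff_prob_eq_one (MeasurableSet.iUnion hm)).2 h1

/-- For finite intensity this is the generating function at `e^{-x}`. For infinite intensity both
sides vanish, except at `x = 0`, where the convention `0 * ∞ = 0` makes both equal to `1`. -/
lemma lintegral_nexp_mul_apply (h : IsPoissonRandomMeasure P N ν) {B : Set E}
    (hB : MeasurableSet B) (x : ℝ≥0∞) :
    ∫⁻ ω, nexp (x * N ω B) ∂P = nexp ((1 - nexp x) * ν B) := by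
  by_cases hν : ν B = ∞
  · rcases eq_or_ne x 0 with rfl | hx
    · simp
    · have h0 : 1 - nexp x ≠ 0 := by
        rcases eq_or_ne x ∞ with rfl | hx'
        · simp
        · rw [one_sub_nexp_eq hx']
          have := ENNReal.toReal_pos hx hx'
          simp [this]
      rw [hν, ENNReal.mul_top h0, nexp_top]
      refine (lintegral_congr_ae ?_).trans lintegral_zero
      filter_upwards [h.infinite B hB hν] with ω hω
      simp [hω, ENNReal.mul_top hx]
  · have hm : ∀ m : ℕ, MeasurableSet {ω | N ω B = (m : ℝ≥0∞)} := fun m =>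
      h.measurable B hB (measurableSet_singleton _)
    have hd : Pairwise (Function.onFun Disjoint fun m : ℕ => {ω | N ω B = (m : ℝ≥0∞)}) := by
      intro i j hij
      refine Set.disjoint_left.2 fun ω (h1 : _ = _) (h2 : _ = _) => hij ?_
      exact_mod_cast h1.symm.trans h2
    rw [← Measure.restrict_eq_self_of_ae_mem (h.ae_exists_eq_natCast hB hν),
      lintegral_iUnion hm hd]
    have : ∀ m : ℕ, ∫⁻ ω in {ω | N ω B = (m : ℝ≥0∞)}, nexp (x * N ω B) ∂P =
        nexp x ^ m * poissonMeasure (ν B).toNNReal {m} := by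
      intro m
      rw [setLIntegral_congr_fun (g := fun _ => nexp x ^ m) (hm m), setLIntegral_const, h.poisson B hB hν]
      intro ω (hω : _ = _)
      simp only [hω]
      rw [mul_comm, nexp_natCast_mul]
    simp_rw [this]
    rw [tsum_pow_mul_poissonMeasure _ (nexp_le_one x), ENNReal.coe_toNNReal hν]

lemma measurable_measure (h : IsPoissonRandomMeasure P N ν) : Measurable N :=
  Measure.measurable_of_measurable_coe N h.measurable

lemma measurable_lintegral (h : IsPoissonRandomMeasure P N ν) {f : E → ℝ≥0∞} (hf : Measurable f) :
    Measurable fun ω => ∫⁻ x, f x ∂N ω :=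
  (Measure.measurable_lintegral hf).comp h.measurable_measure

/-- The level sets of `f` are disjoint, so their counts are independent and the expectation of the
product of exponentials factors. The values are enumerated by `Fin` to match the form of the
independence axiom. -/
lemma lintegral_nexp_simpleFunc (h : IsPoissonRandomMeasure P N ν) (f : SimpleFunc E ℝ≥0∞) :
    ∫⁻ ω, nexp (∫⁻ x, f x ∂N ω) ∂P = nexp (∫⁻ x, (1 - nexp (f x)) ∂ν) := by
  let e := f.range.equivFin
  have hN : ∀ ω, ∫⁻ x, f x ∂N ω =
      ∑ i : Fin f.range.card, (e.symm i : ℝ≥0∞) * N ω (f ⁻¹' {(e.symm i : ℝ≥0∞)}) := by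
    intro ω
    rw [SimpleFunc.lintegral_eq_lintegral, SimpleFunc.lintegral, ← Finset.sum_coe_sort]
    exact (Equiv.sum_comp e.symm (fun x : f.range => (x : ℝ≥0∞) * N ω (f ⁻¹' {(x : ℝ≥0∞)}))).symm
  have hν : ∫⁻ x, (1 - nexp (f x)) ∂ν =
      ∑ i : Fin f.range.card, (1 - nexp (e.symm i : ℝ≥0∞)) * ν (f ⁻¹' {(e.symm i : ℝ≥0∞)}) := by
    have h1 : ∫⁻ x, (1 - nexp (f x)) ∂ν = (f.map fun y => 1 - nexp y).lintegral ν := by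
      rw [← SimpleFunc.lintegral_eq_lintegral]; rfl
    rw [h1, SimpleFunc.map_lintegral, ← Finset.sum_coe_sort]
    exact (Equiv.sum_comp e.symm
      (fun x : f.range => (1 - nexp (x : ℝ≥0∞)) * ν (f ⁻¹' {(x : ℝ≥0∞)}))).symm
  have hB : ∀ i : Fin f.range.card, MeasurableSet (f ⁻¹' {(e.symm i : ℝ≥0∞)}) := fun i =>
    f.measurableSet_preimage _
  have hind : iIndepFun (fun (i : Fin f.range.card) ω => N ω (f ⁻¹' {(e.symm i : ℝ≥0∞)})) P := by
    refine h.indep _ _ hB fun i i' hii => ?_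
    refine Disjoint.preimage f (Set.disjoint_singleton.2 fun he => hii ?_)
    exact e.symm.injective (Subtype.ext he)
  have hind' := hind.comp (fun i y => nexp ((e.symm i : ℝ≥0∞) * y))
    (fun i => measurable_nexp.comp (measurable_const.mul measurable_id))
  simp_rw [hN, hν, nexp_sum]
  have := lintegral_prod_eq_prod_lintegral_of_indepFun Finset.univ _ hind'
    (fun i => measurable_nexp.comp (measurable_const.mul (h.measurable _ (hB i))))
  simp only [Function.comp_apply] at this
  rw [this]
  exact Finset.prod_congr rfl fun i _ => h.lintegral_nexp_mul_apply (hB i) _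

/-- The Laplace functional of a Poisson random measure. -/
theorem lintegral_nexp_lintegral (h : IsPoissonRandomMeasure P N ν) {f : E → ℝ≥0∞}
    (hf : Measurable f) :
    ∫⁻ ω, nexp (∫⁻ x, f x ∂N ω) ∂P = nexp (∫⁻ x, (1 - nexp (f x)) ∂ν) := by
  -- Increasing simple approximations: both `f` and `1 - e^{-f}` are monotone limits, and the outer
  -- expectation passes to the limit because the exponentials are at most `1`.
  have hmono : ∀ x, Monotone fun m => SimpleFunc.eapprox f m x := fun x i j hij =>
    SimpleFunc.monotone_eapprox f hij x
  have htend : ∀ x, Tendsto (fun m => SimpleFunc.eapprox f m x) atTop (𝓝 (f x)) := fun x => by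
    rw [← SimpleFunc.iSup_eapprox_apply hf x]
    exact tendsto_atTop_iSup (hmono x)
  have hN : ∀ ω, Tendsto (fun m => ∫⁻ x, SimpleFunc.eapprox f m x ∂N ω) atTop
      (𝓝 (∫⁻ x, f x ∂N ω)) := fun ω =>
    lintegral_tendsto_of_tendsto_of_monotone (fun m => (SimpleFunc.measurable _).aemeasurable)
      (Eventually.of_forall hmono) (Eventually.of_forall htend)
  have hν : Tendsto (fun m => ∫⁻ x, (1 - nexp (SimpleFunc.eapprox f m x)) ∂ν) atTop
      (𝓝 (∫⁻ x, (1 - nexp (f x)) ∂ν)) := by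
    refine lintegral_tendsto_of_tendsto_of_monotone
      (fun m => (measurable_const.sub (measurable_nexp.comp (SimpleFunc.measurable _))).aemeasurable)
      (Eventually.of_forall fun x i j hij => tsub_le_tsub_left (nexp_antitone (hmono x hij)) 1)
      (Eventually.of_forall fun x => ?_)
    exact ENNReal.Tendsto.sub tendsto_const_nhds ((continuous_nexp.tendsto _).comp (htend x))
      (Or.inl ENNReal.one_ne_top)
  have h1 : Tendsto (fun m => ∫⁻ ω, nexp (∫⁻ x, SimpleFunc.eapprox f m x ∂N ω) ∂P) atTop
      (𝓝 (∫⁻ ω, nexp (∫⁻ x, f x ∂N ω) ∂P)) := by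
    refine tendsto_lintegral_of_dominated_convergence (fun _ => 1)
      (fun m => measurable_nexp.comp (h.measurable_lintegral (SimpleFunc.measurable _)))
      (fun m => Eventually.of_forall fun ω => nexp_le_one _) (by simp)
      (Eventually.of_forall fun ω => (continuous_nexp.tendsto _).comp (hN ω))
  have h2 := (continuous_nexp.tendsto _).comp hν
  refine tendsto_nhds_unique h1 (h2.congr fun m => ?_)
  exact (h.lintegral_nexp_simpleFunc _).symm

/-- Compares the Laplace functional at `f` and at `f + ε 1_A`, divided by `ε`. Letting `ε → 0`
differentiates it in the direction `1_A`. -/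
lemma lintegral_nexp_mul_one_sub_nexp_div (h : IsPoissonRandomMeasure P N ν) {f : E → ℝ≥0∞}
    (hf : Measurable f) {A : Set E} (hA : MeasurableSet A) (m : ℕ) :
    ∫⁻ ω, nexp (∫⁻ x, f x ∂N ω) * ((1 - nexp (invSucc m * N ω A)) / invSucc m) ∂P =
      nexp (∫⁻ x, (1 - nexp (f x)) ∂ν) *
        ((1 - nexp ((1 - nexp (invSucc m)) * ∫⁻ x in A, nexp (f x) ∂ν)) / invSucc m) := by
  have h1 : ∀ ω, nexp (∫⁻ x, f x ∂N ω) * nexp (invSucc m * N ω A) =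
      nexp (∫⁻ x, (f x + A.indicator (fun _ => invSucc m) x) ∂N ω) := by
    intro ω
    rw [lintegral_add_left hf, lintegral_indicator_const hA, nexp_add]
  have h2 : ∫⁻ x, (1 - nexp (f x + A.indicator (fun _ => invSucc m) x)) ∂ν =
      ∫⁻ x, (1 - nexp (f x)) ∂ν + (1 - nexp (invSucc m)) * ∫⁻ x in A, nexp (f x) ∂ν := by
    simp_rw [one_sub_nexp_add]
    rw [lintegral_add_left (by fun_prop), ← lintegral_indicator hA,
      ← lintegral_const_mul]
    · congr 1
      refine lintegral_congr fun x => ?_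
      by_cases hx : x ∈ A <;> simp [hx]
    · exact Measurable.indicator (by fun_prop) hA
  have h3 : ∫⁻ ω, nexp (∫⁻ x, f x ∂N ω) * nexp (invSucc m * N ω A) ∂P =
      nexp (∫⁻ x, (1 - nexp (f x)) ∂ν) *
        nexp ((1 - nexp (invSucc m)) * ∫⁻ x in A, nexp (f x) ∂ν) := by
    simp_rw [h1]
    rw [h.lintegral_nexp_lintegral (f := fun x => f x + A.indicator (fun _ => invSucc m) x)
      (hf.add (measurable_const.indicator hA)), h2, nexp_add]
  have hmf : Measurable fun ω => nexp (∫⁻ x, f x ∂N ω) :=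
    measurable_nexp.comp (h.measurable_lintegral hf)
  have hmA : Measurable fun ω => nexp (invSucc m * N ω A) :=
    measurable_nexp.comp (measurable_const.mul (h.measurable A hA))
  simp_rw [div_eq_mul_inv, ← mul_assoc]
  rw [lintegral_mul_const _ (by fun_prop)]
  congr 1
  simp_rw [ENNReal.mul_sub (fun _ _ => nexp_ne_top _), mul_one]
  rw [lintegral_sub (g := fun ω => nexp (∫⁻ x, f x ∂N ω) * nexp (invSucc m * N ω A))
    (hmf.mul hmA), h3, h.lintegral_nexp_lintegral hf]
  · rw [h3]
    exact ENNReal.mul_ne_top (nexp_ne_top _) (nexp_ne_top _)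
  · exact Eventually.of_forall fun ω => mul_le_of_le_one_right zero_le (nexp_le_one _)

/-- Fatou applied to the difference quotients at `f = 0`. The inequality is enough: it makes `N A`
integrable, and hence a dominating function for the exact computation that follows. -/
lemma lintegral_apply_le (h : IsPoissonRandomMeasure P N ν) {A : Set E} (hA : MeasurableSet A)
    (hν : ν A ≠ ∞) : ∫⁻ ω, N ω A ∂P ≤ ν A := by
  have hlim : ∀ᵐ ω ∂P, Tendsto (fun m => (1 - nexp (invSucc m * N ω A)) / invSucc m) atTop
      (𝓝 (N ω A)) := by
    filter_upwards [h.ae_exists_eq_natCast hA hν] with ω hω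
    obtain ⟨m, hm : N ω A = m⟩ := Set.mem_iUnion.1 hω
    exact tendsto_one_sub_nexp_div (by simp [hm])
  have hmeas : ∀ m, Measurable fun ω => (1 - nexp (invSucc m * N ω A)) / invSucc m := fun m =>
    (measurable_const.sub
      (measurable_nexp.comp (measurable_const.mul (h.measurable A hA)))).div_const _
  calc ∫⁻ ω, N ω A ∂P
      = ∫⁻ ω, liminf (fun m => (1 - nexp (invSucc m * N ω A)) / invSucc m) atTop ∂P :=
        lintegral_congr_ae (hlim.mono fun ω hω => hω.liminf_eq.symm)
    _ ≤ liminf (fun m => ∫⁻ ω, (1 - nexp (invSucc m * N ω A)) / invSucc m ∂P) atTop :=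
        lintegral_liminf_le hmeas
    _ = ν A := by
        refine Tendsto.liminf_eq ?_
        have := fun m => h.lintegral_nexp_mul_one_sub_nexp_div (measurable_const (a := (0 : ℝ≥0∞))) hA m
        simp only [lintegral_const, zero_mul, nexp_zero, one_mul, tsub_self,
          MeasurableSet.univ, Measure.restrict_apply, univ_inter] at this
        simp_rw [this]
        exact tendsto_one_sub_nexp_one_sub_div hν

lemma lintegral_apply_mul_nexp_of_ne_top (h : IsPoissonRandomMeasure P N ν) {f : E → ℝ≥0∞}
    (hf : Measurable f) {A : Set E} (hA : MeasurableSet A) (hν : ν A ≠ ∞) :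
    ∫⁻ ω, nexp (∫⁻ x, f x ∂N ω) * N ω A ∂P =
      nexp (∫⁻ x, (1 - nexp (f x)) ∂ν) * ∫⁻ x in A, nexp (f x) ∂ν := by
  have hmf : Measurable fun ω => nexp (∫⁻ x, f x ∂N ω) :=
    measurable_nexp.comp (h.measurable_lintegral hf)
  have hK : ∫⁻ x in A, nexp (f x) ∂ν ≠ ∞ := by
    refine ((lintegral_mono fun x => nexp_le_one (f x)).trans_lt ?_).ne
    simpa using hν.lt_top
  have h1 : Tendsto (fun m => ∫⁻ ω, nexp (∫⁻ x, f x ∂N ω) *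
      ((1 - nexp (invSucc m * N ω A)) / invSucc m) ∂P) atTop
      (𝓝 (∫⁻ ω, nexp (∫⁻ x, f x ∂N ω) * N ω A ∂P)) := by
    refine tendsto_lintegral_of_dominated_convergence (fun ω => N ω A)
      (fun m => hmf.mul ((measurable_const.sub
      (measurable_nexp.comp (measurable_const.mul (h.measurable A hA)))).div_const _))
      (fun m => Eventually.of_forall fun ω => ?_)
      ((h.lintegral_apply_le hA hν).trans_lt hν.lt_top).ne ?_
    · refine (mul_le_of_le_one_left zero_le (nexp_le_one _)).trans ?_
      refine ENNReal.div_le_of_le_mul' ?_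
      exact one_sub_nexp_le _
    · filter_upwards [h.ae_exists_eq_natCast hA hν] with ω hω
      obtain ⟨m, hm : N ω A = m⟩ := Set.mem_iUnion.1 hω
      exact ENNReal.Tendsto.const_mul (tendsto_one_sub_nexp_div (by simp [hm]))
        (Or.inr (nexp_ne_top _))
  have h2 := ENNReal.Tendsto.const_mul (a := nexp (∫⁻ x, (1 - nexp (f x)) ∂ν))
    (tendsto_one_sub_nexp_one_sub_div hK) (Or.inr (nexp_ne_top _))
  refine tendsto_nhds_unique h1 (h2.congr fun m => ?_)
  exact (h.lintegral_nexp_mul_one_sub_nexp_div hf hA m).symm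

/-- The Mecke formula for exponential functionals. -/
theorem lintegral_nexp_mul_lintegral [SigmaFinite ν] (h : IsPoissonRandomMeasure P N ν)
    {f G : E → ℝ≥0∞} (hf : Measurable f) (hG : Measurable G) :
    ∫⁻ ω, nexp (∫⁻ x, f x ∂N ω) * ∫⁻ x, G x ∂N ω ∂P =
      nexp (∫⁻ x, (1 - nexp (f x)) ∂ν) * ∫⁻ x, G x * nexp (f x) ∂ν := by
  have hmf : Measurable fun ω => nexp (∫⁻ x, f x ∂N ω) :=
    measurable_nexp.comp (h.measurable_lintegral hf)
  -- For fixed `f` both sides are measures in `A`. They agree on sets of finite intensity, hence on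
  -- all sets by exhaustion, and integrating `G` against them gives the formula.
  have hmeas : (P.withDensity fun ω => nexp (∫⁻ x, f x ∂N ω)).bind N =
      nexp (∫⁻ x, (1 - nexp (f x)) ∂ν) • ν.withDensity fun x => nexp (f x) := by
    have hfin : ∀ A, MeasurableSet A → ν A ≠ ∞ →
        (P.withDensity fun ω => nexp (∫⁻ x, f x ∂N ω)).bind N A =
        (nexp (∫⁻ x, (1 - nexp (f x)) ∂ν) • ν.withDensity fun x => nexp (f x)) A := by
      intro A hA hν
      rw [Measure.bind_apply hA h.measurable_measure.aemeasurable,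
        lintegral_withDensity_eq_lintegral_mul _ hmf (h.measurable A hA), Measure.smul_apply,
        withDensity_apply _ hA, smul_eq_mul]
      exact h.lintegral_apply_mul_nexp_of_ne_top hf hA hν
    ext A hA
    have hU : A = ⋃ m, A ∩ spanningSets ν m := by
      rw [← inter_iUnion, iUnion_spanningSets, inter_univ]
    have hmono : Monotone fun m => A ∩ spanningSets ν m := fun i j hij =>
      inter_subset_inter_right _ (monotone_spanningSets ν hij)
    rw [hU, hmono.measure_iUnion, hmono.measure_iUnion]
    refine iSup_congr fun m => hfin _ (hA.inter (measurableSet_spanningSets ν m)) ?_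
    exact ((measure_mono inter_subset_right).trans_lt (measure_spanningSets_lt_top ν m)).ne
  have h1 := Measure.lintegral_bind (m := P.withDensity fun ω => nexp (∫⁻ x, f x ∂N ω))
    (μ := N) (f := G) h.measurable_measure.aemeasurable hG.aemeasurable
  rw [hmeas, lintegral_smul_measure, lintegral_withDensity_eq_lintegral_mul _ (f := fun x => nexp (f x)) (by fun_prop) hG,
    lintegral_withDensity_eq_lintegral_mul _ hmf (h.measurable_lintegral hG)] at h1
  simp only [Pi.mul_apply, smul_eq_mul] at h1
  rw [← h1]
  simp_rw [mul_comm (G _)]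

lemma lintegral_lintegral [SigmaFinite ν] (h : IsPoissonRandomMeasure P N ν)
    {G : E → ℝ≥0∞} (hG : Measurable G) : ∫⁻ ω, ∫⁻ x, G x ∂N ω ∂P = ∫⁻ x, G x ∂ν := by
  simpa using h.lintegral_nexp_mul_lintegral (measurable_const (a := (0 : ℝ≥0∞))) hG

/-- As `ε → 0`, the expectation of `e^{-εF}` tends to the probability that `F` is finite. By the
Laplace functional and dominated convergence, with bound `1 - e^{-f}`, the same limit is `1`. -/
lemma ae_lintegral_ne_top (h : IsPoissonRandomMeasure P N ν) {f : E → ℝ≥0∞} (hf : Measurable f)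
    (hf' : ∀ x, f x ≠ ∞) (hfin : ∫⁻ x, (1 - nexp (f x)) ∂ν ≠ ∞) :
    ∀ᵐ ω ∂P, ∫⁻ x, f x ∂N ω ≠ ∞ := by
  have hF := h.measurable_lintegral hf
  have h1 : Tendsto (fun m => ∫⁻ ω, nexp (invSucc m * ∫⁻ x, f x ∂N ω) ∂P) atTop
      (𝓝 (∫⁻ ω, {ω | ∫⁻ x, f x ∂N ω ≠ ∞}.indicator 1 ω ∂P)) := by
    refine tendsto_lintegral_of_dominated_convergence (fun _ => 1)
      (fun m => measurable_nexp.comp (measurable_const.mul hF))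
      (fun m => Eventually.of_forall fun ω => nexp_le_one _) (by simp)
      (Eventually.of_forall fun ω => ?_)
    by_cases hω : ∫⁻ x, f x ∂N ω = ∞
    · simp only [hω, ENNReal.mul_top (invSucc_ne_zero _), nexp_top]
      rw [indicator_of_notMem (by simpa using hω)]
      exact tendsto_const_nhds
    · rw [indicator_of_mem (by simpa using hω)]
      exact tendsto_nexp_invSucc_mul hω
  have h2 : Tendsto (fun m => ∫⁻ ω, nexp (invSucc m * ∫⁻ x, f x ∂N ω) ∂P) atTop (𝓝 1) := by
    have h3 : ∀ m, ∫⁻ ω, nexp (invSucc m * ∫⁻ x, f x ∂N ω) ∂P =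
        nexp (∫⁻ x, (1 - nexp (invSucc m * f x)) ∂ν) := by
      intro m
      rw [← h.lintegral_nexp_lintegral (f := fun x => invSucc m * f x) (measurable_const.mul hf)]
      simp_rw [lintegral_const_mul _ hf]
    simp_rw [h3]
    have h4 : Tendsto (fun m => ∫⁻ x, (1 - nexp (invSucc m * f x)) ∂ν) atTop
        (𝓝 (∫⁻ x, 0 ∂ν)) := by
      refine tendsto_lintegral_of_dominated_convergence (fun x => 1 - nexp (f x))
        (fun m => measurable_const.sub (measurable_nexp.comp (measurable_const.mul hf)))
        (fun m => Eventually.of_forall fun x => ?_) hfin (Eventually.of_forall fun x => ?_)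
      · exact tsub_le_tsub_left (nexp_antitone (mul_le_of_le_one_left zero_le (invSucc_le_one m))) 1
      · have := ENNReal.Tendsto.sub tendsto_const_nhds (tendsto_nexp_invSucc_mul (hf' x))
          (Or.inl ENNReal.one_ne_top)
        rwa [tsub_self] at this
    rw [lintegral_zero] at h4
    simpa [Function.comp_def] using (continuous_nexp.tendsto _).comp h4
  have h5 := tendsto_nhds_unique h1 h2
  have hms : MeasurableSet {ω | ∫⁻ x, f x ∂N ω ≠ ∞} :=
    hF (measurableSet_singleton _).compl
  rw [lintegral_indicator_one hms] at h5
  exact (mem_ae_iff_prob_eq_one hms).2 h5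

/-- The second moment measure of a Poisson random measure. -/
lemma lintegral_apply_mul_apply [SigmaFinite ν] (h : IsPoissonRandomMeasure P N ν) {A B : Set E}
    (hA : MeasurableSet A) (hB : MeasurableSet B) (hνA : ν A ≠ ∞) (hνB : ν B ≠ ∞) :
    ∫⁻ ω, N ω A * N ω B ∂P = ν (A ∩ B) + ν A * ν B := by
  have hmA := h.measurable A hA
  have hmB := h.measurable B hB
  have hνAB : ν (A ∩ B) ≠ ∞ := ((measure_mono inter_subset_left).trans_lt hνA.lt_top).ne
  have hEA : ∫⁻ ω, N ω A ∂P = ν A := by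
    simpa [hA] using h.lintegral_lintegral (measurable_const (a := (1 : ℝ≥0∞)).indicator hA)
  -- The Mecke formula with `f = ε 1_B`. Since subtraction on `[0, ∞]` is truncated, each difference
  -- is written as a sum equal to the finite number `ν A` and then cancelled.
  have hval : ∀ m, ∫⁻ ω, N ω A * ((1 - nexp (invSucc m * N ω B)) / invSucc m) ∂P =
      ν A * ((1 - nexp ((1 - nexp (invSucc m)) * ν B)) / invSucc m) +
        nexp ((1 - nexp (invSucc m)) * ν B) *
          ((1 - nexp (invSucc m * 1)) / invSucc m * ν (A ∩ B)) := by
    intro m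
    have h1 := h.lintegral_apply_mul_nexp_of_ne_top
      (measurable_const (a := invSucc m) |>.indicator hB) hA hνA
    have h2 : ∫⁻ x, (1 - nexp (B.indicator (fun _ => invSucc m) x)) ∂ν =
        (1 - nexp (invSucc m)) * ν B := by
      rw [← lintegral_indicator_const hB]
      refine lintegral_congr fun x => ?_
      by_cases hx : x ∈ B <;> simp [hx]
    have h3 : ∫⁻ x in A, nexp (B.indicator (fun _ => invSucc m) x) ∂ν +
        (1 - nexp (invSucc m)) * ν (A ∩ B) = ν A := by
      have h4 : (1 - nexp (invSucc m)) * ν (A ∩ B) =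
          ∫⁻ x in A, B.indicator (fun _ => 1 - nexp (invSucc m)) x ∂ν := by
        rw [lintegral_indicator_const hB, Measure.restrict_apply hB, inter_comm]
      rw [h4, ← lintegral_add_right _ (measurable_const.indicator hB)]
      have : ∀ x, nexp (B.indicator (fun _ => invSucc m) x) +
          B.indicator (fun _ => 1 - nexp (invSucc m)) x = 1 := by
        intro x
        by_cases hx : x ∈ B
        · simp [hx, add_tsub_cancel_of_le (nexp_le_one _)]
        · simp [hx]
      simp [this]
    simp_rw [h2, lintegral_indicator_const hB] at h1
    set Λ := nexp ((1 - nexp (invSucc m)) * ν B) with hΛ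
    set K := ∫⁻ x in A, nexp (B.indicator (fun _ => invSucc m) x) ∂ν
    have h5 : ∫⁻ ω, nexp (invSucc m * N ω B) * N ω A ∂P +
        ∫⁻ ω, (1 - nexp (invSucc m * N ω B)) * N ω A ∂P = ν A := by
      rw [← lintegral_add_left (by fun_prop), ← hEA]
      refine lintegral_congr fun ω => ?_
      rw [← add_mul, add_tsub_cancel_of_le (nexp_le_one _), one_mul]
    have h6 : Λ * K + (ν A * (1 - Λ) + Λ * ((1 - nexp (invSucc m)) * ν (A ∩ B))) = ν A := by
      calc Λ * K + (ν A * (1 - Λ) + Λ * ((1 - nexp (invSucc m)) * ν (A ∩ B)))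
          = Λ * (K + (1 - nexp (invSucc m)) * ν (A ∩ B)) + ν A * (1 - Λ) := by ring
        _ = ν A * (Λ + (1 - Λ)) := by rw [h3]; ring
        _ = ν A := by rw [add_tsub_cancel_of_le (nexp_le_one _), mul_one]
    have h7 : ∫⁻ ω, (1 - nexp (invSucc m * N ω B)) * N ω A ∂P =
        ν A * (1 - Λ) + Λ * ((1 - nexp (invSucc m)) * ν (A ∩ B)) := by
      rw [h1] at h5
      refine (ENNReal.add_right_inj ?_).1 (h5.trans h6.symm)
      refine ne_top_of_le_ne_top hνA ?_
      rw [← h6]; exact le_self_add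
    have h8 : ∀ ω, N ω A * ((1 - nexp (invSucc m * N ω B)) / invSucc m) =
        (1 - nexp (invSucc m * N ω B)) * N ω A * (invSucc m)⁻¹ := fun ω => by
      rw [div_eq_mul_inv]; ring
    simp_rw [h8]
    rw [lintegral_mul_const _ (by fun_prop), h7, mul_one]
    simp_rw [div_eq_mul_inv]
    ring
  have hlimval : Tendsto (fun m => ∫⁻ ω, N ω A * ((1 - nexp (invSucc m * N ω B)) / invSucc m) ∂P)
      atTop (𝓝 (ν (A ∩ B) + ν A * ν B)) := by
    simp_rw [hval]
    rw [add_comm]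
    refine Tendsto.add ?_ ?_
    · exact ENNReal.Tendsto.const_mul (tendsto_one_sub_nexp_one_sub_div hνB) (Or.inr hνA)
    · have h1 : Tendsto (fun m => (1 - nexp (invSucc m)) * ν B) atTop (𝓝 0) := by
        have := ENNReal.Tendsto.sub tendsto_const_nhds
          (tendsto_nexp_invSucc_mul ENNReal.one_ne_top) (Or.inl ENNReal.one_ne_top)
        simpa using ENNReal.Tendsto.mul_const this (Or.inr hνB)
      have h2 := (continuous_nexp.tendsto _).comp h1
      have h3 := ENNReal.Tendsto.mul_const (b := ν (A ∩ B))
        (tendsto_one_sub_nexp_div ENNReal.one_ne_top) (Or.inr hνAB)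
      have h4 := ENNReal.Tendsto.mul h2 (Or.inr (by simpa using hνAB)) h3 (Or.inr (by simp))
      simpa using h4
  have hfin : ∀ᵐ ω ∂P, N ω A ≠ ∞ ∧ N ω B ≠ ∞ := by
    filter_upwards [h.ae_exists_eq_natCast hA hνA, h.ae_exists_eq_natCast hB hνB] with ω h1 h2
    obtain ⟨m, hm : N ω A = m⟩ := Set.mem_iUnion.1 h1
    obtain ⟨m', hm' : N ω B = m'⟩ := Set.mem_iUnion.1 h2
    simp [hm, hm']
  have hlim : ∀ᵐ ω ∂P, Tendsto (fun m => N ω A * ((1 - nexp (invSucc m * N ω B)) / invSucc m))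
      atTop (𝓝 (N ω A * N ω B)) := by
    filter_upwards [hfin] with ω hω
    exact ENNReal.Tendsto.const_mul (tendsto_one_sub_nexp_div hω.2) (Or.inr hω.1)
  have hmeas : ∀ m, Measurable fun ω => N ω A * ((1 - nexp (invSucc m * N ω B)) / invSucc m) :=
    fun m => by fun_prop
  -- Fatou first provides the integrability of `N A * N B`, which then dominates the quotients and
  -- upgrades the inequality to an equality.
  have hle : ∫⁻ ω, N ω A * N ω B ∂P ≤ ν (A ∩ B) + ν A * ν B := by
    calc ∫⁻ ω, N ω A * N ω B ∂P
        = ∫⁻ ω, liminf (fun m => N ω A * ((1 - nexp (invSucc m * N ω B)) / invSucc m)) atTop ∂P :=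
          lintegral_congr_ae (hlim.mono fun ω hω => hω.liminf_eq.symm)
      _ ≤ liminf (fun m => ∫⁻ ω, N ω A * ((1 - nexp (invSucc m * N ω B)) / invSucc m) ∂P) atTop :=
          lintegral_liminf_le hmeas
      _ = ν (A ∩ B) + ν A * ν B := hlimval.liminf_eq
  refine tendsto_nhds_unique (tendsto_lintegral_of_dominated_convergence _ hmeas
    (fun m => Eventually.of_forall fun ω => ?_) (ne_top_of_le_ne_top ?_ hle) hlim) hlimval
  · exact mul_le_mul_right (ENNReal.div_le_of_le_mul' (one_sub_nexp_le _)) _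
  · exact ENNReal.add_ne_top.2 ⟨hνAB, ENNReal.mul_ne_top hνA hνB⟩

end IsPoissonRandomMeasure

end PoissonRandomMeasure

/-! ### Integrals against the Lévy intensity. -/

section Levy

variable {S : Type*} [MeasurableSpace S] {θ : ℝ} {ρ : ℝ → ℝ} {G₀ : Measure S}

lemma lintegral_levyIntensity_mul [SFinite G₀] (hθ : 0 < θ) (hρ : IsJumpDensity ρ) {g : ℝ → ℝ≥0∞}
    (hg : Measurable g) {h : S → ℝ≥0∞} (hh : Measurable h) :
    ∫⁻ p, g p.1 * h p.2 ∂levyIntensity θ ρ G₀ =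
      ENNReal.ofReal θ * (∫⁻ s in Ioi (0 : ℝ), ENNReal.ofReal (ρ s) * g s) * ∫⁻ x, h x ∂G₀ := by
  have hρm := hρ.measurable
  rw [levyIntensity, lintegral_prod_mul hg.aemeasurable hh.aemeasurable,
    lintegral_withDensity_eq_lintegral_mul _ (by fun_prop) hg,
    ← lintegral_const_mul (μ := volume.restrict (Ioi (0 : ℝ))) _ (by fun_prop)]
  congr 1
  refine lintegral_congr fun s => ?_
  rw [Pi.mul_apply, ENNReal.ofReal_mul hθ.le, mul_assoc]

instance [SigmaFinite G₀] : SigmaFinite (levyIntensity θ ρ G₀) := by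
  have : SigmaFinite ((volume.restrict (Ioi (0 : ℝ))).withDensity
      fun s => ENNReal.ofReal (θ * ρ s)) := SigmaFinite.withDensity_ofReal _
  unfold levyIntensity
  infer_instance

lemma IsJumpDensity.ofReal_psi (hρ : IsJumpDensity ρ) {u : ℝ} (hu : 0 < u) :
    ∫⁻ s in Ioi (0 : ℝ), ENNReal.ofReal (ρ s) * (1 - nexp (ENNReal.ofReal u * ENNReal.ofReal s)) =
      ENNReal.ofReal (psi ρ u) := by
  have hpos : ∀ s ∈ Ioi (0 : ℝ), 0 ≤ (1 - Real.exp (-(u * s))) * ρ s := fun s hs => by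
    refine mul_nonneg (sub_nonneg.2 (Real.exp_le_one_iff.2 ?_)) (hρ.nonneg s hs)
    have : 0 < u * s := mul_pos hu hs
    linarith
  rw [psi, ofReal_integral_eq_lintegral_ofReal (hρ.integrable u hu)
    ((ae_restrict_iff' measurableSet_Ioi).2 (Eventually.of_forall hpos))]
  refine setLIntegral_congr_fun measurableSet_Ioi fun s hs => ?_
  have hs' : (0 : ℝ) < s := hs
  rw [← ENNReal.ofReal_mul hu.le, nexp_ofReal (mul_pos hu hs').le, ← ENNReal.ofReal_one,
    ← ENNReal.ofReal_sub _ (Real.exp_pos _).le, ← ENNReal.ofReal_mul (hρ.nonneg s hs), mul_comm]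

/-- The mass that the atom `p = (s, x)` gives to the set `D`. -/
def atomMass (D : Set S) (p : ℝ × S) : ℝ≥0∞ := ENNReal.ofReal p.1 * D.indicator 1 p.2

lemma measurable_atomMass {D : Set S} (hD : MeasurableSet D) : Measurable (atomMass D) :=
  (ENNReal.measurable_ofReal.comp measurable_fst).mul
    ((measurable_one.indicator hD).comp measurable_snd)

lemma atomMass_ne_top (D : Set S) (p : ℝ × S) : atomMass D p ≠ ∞ := by
  unfold atomMass
  by_cases h : p.2 ∈ D <;> simp [h]

lemma lintegral_one_sub_nexp_atomMass [IsProbabilityMeasure G₀] (hθ : 0 < θ)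
    (hρ : IsJumpDensity ρ) {D : Set S} (hD : MeasurableSet D) {u : ℝ} (hu : 0 < u) :
    ∫⁻ p, (1 - nexp (ENNReal.ofReal u * atomMass D p)) ∂levyIntensity θ ρ G₀ =
      ENNReal.ofReal (θ * psi ρ u) * G₀ D := by
  have h1 : ∀ p : ℝ × S, 1 - nexp (ENNReal.ofReal u * atomMass D p) =
      (1 - nexp (ENNReal.ofReal u * ENNReal.ofReal p.1)) * D.indicator 1 p.2 := by
    intro p
    by_cases h : p.2 ∈ D <;> simp [h, atomMass]
  simp_rw [h1]
  rw [lintegral_levyIntensity_mul (g := fun s => 1 - nexp (ENNReal.ofReal u * ENNReal.ofReal s))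
    (h := D.indicator 1) hθ hρ (by fun_prop) (measurable_one.indicator hD),
    hρ.ofReal_psi hu, lintegral_indicator_one hD, ENNReal.ofReal_mul hθ.le]

/-- With `x = us/2`, write `e^{-us} = e^{-x} e^{-x}`: one factor bounds `x^m` by `m!`, the other
gives `x e^{-x} ≤ 1 - e^{-x}`. Thus the integrand of `ψ(u/2)` dominates that of `κ(u, m+1)`. One
power of `s` has to be spent on this, since `ρ` itself is not integrable. -/
lemma pow_mul_exp_neg_le {u s : ℝ} (hu : 0 < u) (hs : 0 < s) (m : ℕ) :
    Real.exp (-(u * s)) * s ^ (m + 1) ≤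
      m.factorial * (2 / u) ^ (m + 1) * (1 - Real.exp (-(u / 2 * s))) := by
  have hx : 0 < u / 2 * s := by positivity
  set x := u / 2 * s with hxdef
  have hs' : s = 2 / u * x := by rw [hxdef]; field_simp
  have h1 : x ^ m * Real.exp (-x) ≤ m.factorial := by
    have := Real.pow_div_factorial_le_exp x hx.le m
    rw [div_le_iff₀ (by positivity)] at this
    rw [Real.exp_neg, ← div_eq_mul_inv, div_le_iff₀ (Real.exp_pos x), mul_comm]
    exact this
  have h2 : x * Real.exp (-x) ≤ 1 - Real.exp (-x) := by
    have h3 := Real.add_one_le_exp x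
    have h4 : Real.exp x * Real.exp (-x) = 1 := by rw [← Real.exp_add]; simp
    nlinarith [Real.exp_pos (-x)]
  calc Real.exp (-(u * s)) * s ^ (m + 1)
      = (2 / u) ^ (m + 1) * ((x ^ m * Real.exp (-x)) * (x * Real.exp (-x))) := by
        have : Real.exp (-(u * s)) = Real.exp (-x) * Real.exp (-x) := by
          rw [← Real.exp_add, hxdef]; congr 1; ring
        rw [this, hs', mul_pow]; ring
    _ ≤ (2 / u) ^ (m + 1) * (m.factorial * (1 - Real.exp (-x))) := by
        gcongr
    _ = _ := by ring

lemma IsJumpDensity.integrableOn_kappa (hρ : IsJumpDensity ρ) {u : ℝ} (hu : 0 < u) {m : ℕ}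
    (hm : 1 ≤ m) :
    IntegrableOn (fun s => Real.exp (-(u * s)) * s ^ m * ρ s) (Ioi 0) := by
  obtain ⟨m, rfl⟩ := Nat.exists_eq_add_of_le' hm
  have hρm := hρ.measurable
  refine Integrable.mono' ((hρ.integrable (u / 2) (by positivity)).const_mul
    (m.factorial * (2 / u) ^ (m + 1))) (by fun_prop) ?_
  refine (ae_restrict_iff' measurableSet_Ioi).2 (Eventually.of_forall fun s hs => ?_)
  have hs' : (0 : ℝ) < s := hs
  have h0 := hρ.nonneg s hs'
  rw [Real.norm_of_nonneg (by positivity), ← mul_assoc]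
  exact mul_le_mul_of_nonneg_right (pow_mul_exp_neg_le hu hs' m) h0

lemma IsJumpDensity.kappa_nonneg (hρ : IsJumpDensity ρ) (u : ℝ) (m : ℕ) : 0 ≤ kappa ρ u m := by
  refine setIntegral_nonneg measurableSet_Ioi fun s (hs : 0 < s) => ?_
  have h0 := hρ.nonneg s hs
  positivity

lemma IsJumpDensity.ofReal_kappa (hρ : IsJumpDensity ρ) {u : ℝ} (hu : 0 < u) {m : ℕ}
    (hm : 1 ≤ m) :
    ∫⁻ s in Ioi (0 : ℝ), ENNReal.ofReal (ρ s) *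
      (ENNReal.ofReal s ^ m * nexp (ENNReal.ofReal u * ENNReal.ofReal s)) =
      ENNReal.ofReal (kappa ρ u m) := by
  have hpos : ∀ s ∈ Ioi (0 : ℝ), 0 ≤ Real.exp (-(u * s)) * s ^ m * ρ s := fun s (hs : 0 < s) => by
    have h0 := hρ.nonneg s hs
    positivity
  rw [kappa, ofReal_integral_eq_lintegral_ofReal (hρ.integrableOn_kappa hu hm)
    ((ae_restrict_iff' measurableSet_Ioi).2 (Eventually.of_forall hpos))]
  refine setLIntegral_congr_fun measurableSet_Ioi fun s hs => ?_
  have hs' : (0 : ℝ) < s := hs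
  rw [← ENNReal.ofReal_mul hu.le, nexp_ofReal (mul_pos hu hs').le, ← ENNReal.ofReal_pow hs'.le,
    ← ENNReal.ofReal_mul (by positivity), ← ENNReal.ofReal_mul (hρ.nonneg s hs)]
  congr 1; ring

lemma IsJumpDensity.psi_nonneg (hρ : IsJumpDensity ρ) {u : ℝ} (hu : 0 < u) : 0 ≤ psi ρ u := by
  refine setIntegral_nonneg measurableSet_Ioi fun s (hs : 0 < s) => ?_
  refine mul_nonneg (sub_nonneg.2 (Real.exp_le_one_iff.2 ?_)) (hρ.nonneg s hs)
  have : 0 < u * s := mul_pos hu hs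
  linarith

lemma levyIntensity_preimage_snd_singleton [IsProbabilityMeasure G₀] [NullSingletonClass G₀]
    (x : S) : levyIntensity θ ρ G₀ (Prod.snd ⁻¹' {x}) = 0 := by
  rw [← univ_prod, levyIntensity, Measure.prod_prod, measure_singleton, mul_zero]

end Levy

/-! ### Pairs of distinct points, and distinctness of the locations. -/

section Atoms

variable {Ω E : Type*} [MeasurableSpace Ω] [MeasurableSpace E] {P : Measure Ω}
  [IsProbabilityMeasure P] {ν : Measure E} [SigmaFinite ν] {ξ : ℕ → Ω → E}

/-- The joint law of the pairs of points with distinct indices. -/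
def pairMeasure (P : Measure Ω) (ξ : ℕ → Ω → E) : Measure (E × E) :=
  Measure.sum fun p : ℕ × ℕ => if p.1 = p.2 then 0 else P.map fun ω => (ξ p.1 ω, ξ p.2 ω)

/-- Expand `E[N(A) N(B)]` over pairs of indices. The diagonal contributes `E[N(A ∩ B)] = ν(A ∩ B)`,
exactly the extra term of the second moment formula, and this finite term cancels. -/
lemma pairMeasure_prod (hξ : ∀ k, Measurable (ξ k))
    (h : IsPoissonRandomMeasure P (fun ω => Measure.sum fun k => Measure.dirac (ξ k ω)) ν)
    {A B : Set E} (hA : MeasurableSet A) (hB : MeasurableSet B) (hνA : ν A ≠ ∞) (hνB : ν B ≠ ∞) :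
    pairMeasure P ξ (A ×ˢ B) = ν A * ν B := by
  have hν : ν (A ∩ B) ≠ ∞ := ((measure_mono inter_subset_left).trans_lt hνA.lt_top).ne
  have hN : ∀ ω (D : Set E), MeasurableSet D →
      (Measure.sum fun k => Measure.dirac (ξ k ω)) D = ∑' k, D.indicator 1 (ξ k ω) := by
    intro ω D hD
    rw [Measure.sum_apply _ hD]
    simp_rw [Measure.dirac_apply' _ hD]
  have h1 := h.lintegral_apply_mul_apply hA hB hνA hνB
  have hmi : ∀ D : Set E, MeasurableSet D → ∀ k, Measurable fun ω =>
      D.indicator (1 : E → ℝ≥0∞) (ξ k ω) := fun D hD k =>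
    (measurable_one.indicator hD).comp (hξ k)
  have hP : ∀ p : ℕ × ℕ, (if p.1 = p.2 then 0 else P.map fun ω => (ξ p.1 ω, ξ p.2 ω)) (A ×ˢ B) =
      ∫⁻ ω, (if p.1 = p.2 then 0 else A.indicator 1 (ξ p.1 ω) * B.indicator 1 (ξ p.2 ω)) ∂P := by
    intro p
    by_cases hp : p.1 = p.2
    · simp [hp]
    · simp only [hp, if_false]
      rw [Measure.map_apply ((hξ _).prodMk (hξ _)) (hA.prod hB), ← lintegral_indicator_one
        (((hξ _).prodMk (hξ _)) (hA.prod hB))]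
      refine lintegral_congr fun ω => ?_
      by_cases ha : ξ p.1 ω ∈ A <;> by_cases hb : ξ p.2 ω ∈ B <;> simp [ha, hb, indicator]
  have h2 : pairMeasure P ξ (A ×ˢ B) + ν (A ∩ B) = ν A * ν B + ν (A ∩ B) := by
    have hE : ∫⁻ ω, (Measure.sum fun k => Measure.dirac (ξ k ω)) (A ∩ B) ∂P = ν (A ∩ B) := by
      simpa [hA.inter hB] using h.lintegral_lintegral
        ((measurable_const (a := (1 : ℝ≥0∞))).indicator (hA.inter hB))
    rw [add_comm (ν A * ν B), ← h1]
    nth_rewrite 1 [← hE]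
    rw [pairMeasure, Measure.sum_apply _ (hA.prod hB)]
    simp_rw [hP, hN _ _ (hA.inter hB), hN _ _ hA, hN _ _ hB]
    rw [← lintegral_tsum, ← lintegral_add_right]
    · refine lintegral_congr fun ω => ?_
      have hd : ∑' k, (A ∩ B).indicator (1 : E → ℝ≥0∞) (ξ k ω) = ∑' p : ℕ × ℕ,
          if p.1 = p.2 then A.indicator 1 (ξ p.1 ω) * B.indicator 1 (ξ p.2 ω) else 0 := by
        rw [ENNReal.tsum_prod']
        refine tsum_congr fun k => ?_
        rw [tsum_eq_single k (fun k' hk' => by simp [hk'.symm])]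
        by_cases ha : ξ k ω ∈ A <;> by_cases hb : ξ k ω ∈ B <;> simp [ha, hb]
      rw [hd, ← ENNReal.tsum_add, ← ENNReal.tsum_mul_right, ENNReal.tsum_prod']
      refine tsum_congr fun k => ?_
      rw [← ENNReal.tsum_mul_left]
      refine tsum_congr fun k' => ?_
      by_cases hk : k = k' <;> simp [hk]
    · exact Measurable.tsum fun k => hmi _ (hA.inter hB) k
    · intro p
      by_cases hp : p.1 = p.2
      · simp [hp]
      · simp only [hp, if_false]
        exact ((hmi A hA _).mul (hmi B hB _)).aemeasurable
  exact (ENNReal.add_left_inj hν).1 h2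

/-- The points of a Poisson random measure avoid the null sets of the product of its intensity
with itself. -/
lemma ae_pair_notMem (hξ : ∀ k, Measurable (ξ k))
    (h : IsPoissonRandomMeasure P (fun ω => Measure.sum fun k => Measure.dirac (ξ k ω)) ν)
    {Δ : Set (E × E)} (hΔ : MeasurableSet Δ) (hν : ν.prod ν Δ = 0) {k k' : ℕ} (hk : k ≠ k') :
    ∀ᵐ ω ∂P, (ξ k ω, ξ k' ω) ∉ Δ := by
  -- On squares of sets of finite intensity, the values on rectangles identify the pair measure with
  -- the product measure.
  have hm : ∀ m, ∀ᵐ ω ∂P, ¬ ((ξ k ω, ξ k' ω) ∈ Δ ∩ (spanningSets ν m ×ˢ spanningSets ν m)) := by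
    intro m
    have hF := measurableSet_spanningSets ν m
    have hprod : (ν.restrict (spanningSets ν m)).prod (ν.restrict (spanningSets ν m)) =
        (pairMeasure P ξ).restrict (spanningSets ν m ×ˢ spanningSets ν m) := by
      refine Measure.prod_eq fun s t hs ht => ?_
      rw [Measure.restrict_apply (hs.prod ht), prod_inter_prod, Measure.restrict_apply hs,
        Measure.restrict_apply ht]
      refine pairMeasure_prod hξ h (hs.inter hF) (ht.inter hF) ?_ ?_ <;>
      exact ((measure_mono inter_subset_right).trans_lt (measure_spanningSets_lt_top ν m)).ne
    have h0 : (pairMeasure P ξ) (Δ ∩ (spanningSets ν m ×ˢ spanningSets ν m)) = 0 := by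
      rw [← Measure.restrict_apply hΔ, ← hprod, Measure.prod_restrict]
      exact nonpos_iff_eq_zero.1 ((Measure.restrict_apply_le _ _).trans hν.le)
    have hmeas := hΔ.inter (hF.prod hF)
    rw [pairMeasure, Measure.sum_apply _ hmeas, ENNReal.tsum_eq_zero] at h0
    have h1 := h0 (k, k')
    simp only [hk, if_false] at h1
    rw [Measure.map_apply ((hξ _).prodMk (hξ _)) hmeas] at h1
    exact measure_eq_zero_iff_ae_notMem.1 h1
  filter_upwards [ae_all_iff.2 hm] with ω hω hmem
  have hu : ∀ x : E, ∃ m, x ∈ spanningSets ν m := fun x => by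
    have : x ∈ ⋃ m, spanningSets ν m := by rw [iUnion_spanningSets]; trivial
    exact mem_iUnion.1 this
  obtain ⟨m, h1⟩ := hu (ξ k ω)
  obtain ⟨m', h2⟩ := hu (ξ k' ω)
  exact hω (max m m') ⟨hmem, monotone_spanningSets ν (le_max_left _ _) h1,
    monotone_spanningSets ν (le_max_right _ _) h2⟩

end Atoms

namespace IsCRM

variable {Ω S : Type*} [MeasurableSpace Ω] [MeasurableSpace S] {P : Measure Ω}
  [IsProbabilityMeasure P] {G₀ : Measure S} [IsProbabilityMeasure G₀]
  {θ : ℝ} {ρ : ℝ → ℝ} {jump : ℕ → Ω → ℝ} {loc : ℕ → Ω → S}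

/-- The pairs of points with equal locations form a null set for the product intensity: each section
is a line `ℝ × {x}`, and `G₀` has no atoms. -/
lemma ae_injective_loc [StandardBorelSpace S] [NullSingletonClass G₀]
    (h : IsCRM P θ ρ G₀ jump loc) : ∀ᵐ ω ∂P, Function.Injective fun k => loc k ω := by
  have hξ : ∀ k, Measurable fun ω => (jump k ω, loc k ω) := fun k =>
    (h.measurable_jump k).prodMk (h.measurable_loc k)
  have hΔ : MeasurableSet {q : (ℝ × S) × (ℝ × S) | q.1.2 = q.2.2} :=
    measurableSet_eq_fun (by fun_prop) (by fun_prop)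
  have hν : (levyIntensity θ ρ G₀).prod (levyIntensity θ ρ G₀)
      {q : (ℝ × S) × (ℝ × S) | q.1.2 = q.2.2} = 0 := by
    rw [Measure.measure_prod_null hΔ]
    refine Eventually.of_forall fun p => ?_
    have : Prod.mk p ⁻¹' {q : (ℝ × S) × (ℝ × S) | q.1.2 = q.2.2} = Prod.snd ⁻¹' {p.2} := by
      ext q; simp [eq_comm]
    simp only [this]
    exact levyIntensity_preimage_snd_singleton p.2
  have hall : ∀ k k', ∀ᵐ ω ∂P, k ≠ k' → loc k ω ≠ loc k' ω := fun k k' => by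
    by_cases hk : k = k'
    · exact Eventually.of_forall fun ω hne => absurd hk hne
    · filter_upwards [ae_pair_notMem hξ h.poisson hΔ hν hk] with ω hω _
      exact hω
  filter_upwards [ae_all_iff.2 fun k => ae_all_iff.2 (hall k)] with ω hω k k' hkk
  by_contra hne
  exact hω k k' hne hkk

end IsCRM

/-! ### The mass of a fixed set: Laplace transform, tilted moments, removal of one atom. -/

section TotalMass

variable {S : Type*} [MeasurableSpace S]

/-- The total mass of the set `D`, for the atoms `p k`. -/
def totalMass (D : Set S) (p : ℕ → ℝ × S) : ℝ≥0∞ := ∑' k, atomMass D (p k)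

/-- The mass of the set `D` without the atom of index `k`. -/
def restMass (D : Set S) (k : ℕ) (p : ℕ → ℝ × S) : ℝ≥0∞ :=
  ∑' k', if k' = k then 0 else atomMass D (p k')

lemma atomMass_add_restMass (D : Set S) (k : ℕ) (p : ℕ → ℝ × S) :
    atomMass D (p k) + restMass D k p = totalMass D p := by
  rw [totalMass, ENNReal.tsum_eq_add_tsum_ite (f := fun k => atomMass D (p k)) k, restMass]
  congr!

lemma measurable_totalMass {D : Set S} (hD : MeasurableSet D) : Measurable (totalMass D) :=
  Measurable.tsum fun k => (measurable_atomMass hD).comp (measurable_pi_apply k)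

lemma measurable_restMass {D : Set S} (hD : MeasurableSet D) (k : ℕ) :
    Measurable (restMass D k) := by
  refine Measurable.tsum fun k' => ?_
  by_cases hk : k' = k
  · simp [hk]
  · simpa [hk, Function.comp_def] using (measurable_atomMass hD).comp (measurable_pi_apply k')

end TotalMass

namespace IsCRM

variable {Ω S : Type*} [MeasurableSpace Ω] [MeasurableSpace S] {P : Measure Ω}
  [IsProbabilityMeasure P] {G₀ : Measure S} [IsProbabilityMeasure G₀]
  {θ : ℝ} {ρ : ℝ → ℝ} {jump : ℕ → Ω → ℝ} {loc : ℕ → Ω → S}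

lemma measurable_atoms (h : IsCRM P θ ρ G₀ jump loc) :
    Measurable fun ω k => (jump k ω, loc k ω) :=
  measurable_pi_lambda _ fun k => (h.measurable_jump k).prodMk (h.measurable_loc k)

lemma lintegral_atoms {f : ℝ × S → ℝ≥0∞} (hf : Measurable f) (ω : Ω) :
    ∫⁻ x, f x ∂(Measure.sum fun k => Measure.dirac (jump k ω, loc k ω)) =
      ∑' k, f (jump k ω, loc k ω) := by
  rw [lintegral_sum_measure]
  simp_rw [lintegral_dirac' _ hf]

lemma lintegral_nexp_totalMass (h : IsCRM P θ ρ G₀ jump loc) (hθ : 0 < θ) (hρ : IsJumpDensity ρ)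
    {D : Set S} (hD : MeasurableSet D) {u : ℝ} (hu : 0 < u) :
    ∫⁻ ω, nexp (ENNReal.ofReal u * totalMass D fun k => (jump k ω, loc k ω)) ∂P =
      ENNReal.ofReal (Real.exp (-(θ * (G₀ D).toReal * psi ρ u))) := by
  have hm := measurable_atomMass hD
  have h1 := h.poisson.lintegral_nexp_lintegral
    (f := fun p => ENNReal.ofReal u * atomMass D p) (by fun_prop)
  have hψ := hρ.psi_nonneg hu
  rw [lintegral_one_sub_nexp_atomMass hθ hρ hD hu, ← ENNReal.ofReal_toReal (measure_ne_top G₀ D),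
    ← ENNReal.ofReal_mul (by positivity), nexp_ofReal (by positivity)] at h1
  rw [show θ * (G₀ D).toReal * psi ρ u = θ * psi ρ u * (G₀ D).toReal by ring, ← h1]
  refine lintegral_congr fun ω => ?_
  rw [lintegral_atoms (f := fun p => ENNReal.ofReal u * atomMass D p) (by fun_prop),
    ENNReal.tsum_mul_left, totalMass]

lemma ae_totalMass_ne_top (h : IsCRM P θ ρ G₀ jump loc) (hθ : 0 < θ) (hρ : IsJumpDensity ρ)
    {D : Set S} (hD : MeasurableSet D) :
    ∀ᵐ ω ∂P, totalMass D (fun k => (jump k ω, loc k ω)) ≠ ∞ := by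
  have hm := measurable_atomMass hD
  have h1 := lintegral_one_sub_nexp_atomMass (G₀ := G₀) hθ hρ hD one_pos
  simp only [ENNReal.ofReal_one, one_mul] at h1
  have h2 := h.poisson.ae_lintegral_ne_top hm (atomMass_ne_top D)
    (by rw [h1]; exact ENNReal.mul_ne_top ENNReal.ofReal_ne_top (measure_ne_top G₀ D))
  filter_upwards [h2] with ω hω
  rwa [lintegral_atoms hm] at hω

/-- Since `ρ` has infinite mass, infinitely many atoms fall in `D`, and every jump is positive. -/
lemma ae_totalMass_ne_zero (h : IsCRM P θ ρ G₀ jump loc) (hθ : 0 < θ) (hρ : IsJumpDensity ρ)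
    {D : Set S} (hD : MeasurableSet D) (hD0 : G₀ D ≠ 0) :
    ∀ᵐ ω ∂P, totalMass D (fun k => (jump k ω, loc k ω)) ≠ 0 := by
  have hν : levyIntensity θ ρ G₀ (univ ×ˢ D) = ∞ := by
    have h1 := lintegral_levyIntensity_mul (G₀ := G₀) hθ hρ (measurable_one)
      (measurable_one.indicator hD)
    simp only [Pi.one_apply, one_mul, mul_one, hρ.infinite, lintegral_indicator_one hD] at h1
    rw [ENNReal.mul_top (by simpa using hθ), ENNReal.top_mul hD0] at h1
    rw [← h1, ← lintegral_indicator_one (MeasurableSet.univ.prod hD)]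
    refine lintegral_congr fun p => ?_
    by_cases hp : p.2 ∈ D <;> simp [hp, indicator]
  filter_upwards [h.poisson.infinite _ (MeasurableSet.univ.prod hD) hν] with ω hω h0
  rw [Measure.sum_apply _ (MeasurableSet.univ.prod hD)] at hω
  have h2 : ∀ k, Measure.dirac (jump k ω, loc k ω) (univ ×ˢ D) = 0 := by
    intro k
    have h3 := ENNReal.tsum_eq_zero.1 h0 k
    rw [Measure.dirac_apply' _ (MeasurableSet.univ.prod hD)]
    by_cases hk : loc k ω ∈ D
    · simp [atomMass, hk] at h3
      exact absurd h3 (not_le.2 (h.jump_pos k ω))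
    · simp [hk]
  simp [h2] at hω

/-- The Mecke formula for the Laplace transform of the mass of a set without one of its atoms. -/
lemma tsum_lintegral_nexp_restMass (h : IsCRM P θ ρ G₀ jump loc) (hθ : 0 < θ)
    (hρ : IsJumpDensity ρ) {D : Set S} (hD : MeasurableSet D) {u v : ℝ} (hu : 0 < u) (hv : 0 < v)
    {m : ℕ} (hm : 1 ≤ m) :
    ∑' k, ∫⁻ ω, D.indicator 1 (loc k ω) * (ENNReal.ofReal (jump k ω) ^ m *
        nexp (ENNReal.ofReal u * ENNReal.ofReal (jump k ω))) *
        nexp (ENNReal.ofReal v * restMass D k fun k => (jump k ω, loc k ω)) ∂P =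
      ENNReal.ofReal (θ * (G₀ D).toReal * kappa ρ u m *
        Real.exp (-(θ * (G₀ D).toReal * psi ρ v))) := by
  have hma := measurable_atomMass hD
  have hDi : Measurable (D.indicator (1 : S → ℝ≥0∞)) := measurable_one.indicator hD
  set g : ℝ → ℝ≥0∞ := fun s => ENNReal.ofReal s ^ m * nexp (ENNReal.ofReal u * ENNReal.ofReal s)
    with hg
  have hgm : Measurable g := by fun_prop
  -- The inverse exponential removes the atom itself from `e^{-vT}`, leaving the exponential of the
  -- remaining mass; on the intensity side it cancels against `e^{-f}`. The rate `v` is kept apart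
  -- from `u` so that one can later differentiate in `v` alone.
  set G : ℝ × S → ℝ≥0∞ := fun p =>
    g p.1 * (nexp (ENNReal.ofReal v * ENNReal.ofReal p.1))⁻¹ * D.indicator 1 p.2 with hG
  have hGm : Measurable G := by fun_prop
  have h1 := h.poisson.lintegral_nexp_mul_lintegral
    (f := fun p => ENNReal.ofReal v * atomMass D p) (by fun_prop) hGm
  have hcancel : ∀ s : ℝ, (nexp (ENNReal.ofReal v * ENNReal.ofReal s))⁻¹ *
      nexp (ENNReal.ofReal v * ENNReal.ofReal s) = 1 := fun s =>
    ENNReal.inv_mul_cancel (nexp_ne_zero (ENNReal.mul_ne_top ENNReal.ofReal_ne_top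
      ENNReal.ofReal_ne_top)) (nexp_ne_top _)
  have h2 : ∫⁻ p, G p * nexp (ENNReal.ofReal v * atomMass D p) ∂levyIntensity θ ρ G₀ =
      ENNReal.ofReal θ * ENNReal.ofReal (kappa ρ u m) * G₀ D := by
    rw [← lintegral_indicator_one hD, ← hρ.ofReal_kappa hu hm,
      ← lintegral_levyIntensity_mul hθ hρ hgm hDi]
    refine lintegral_congr fun p => ?_
    by_cases hp : p.2 ∈ D
    · simp only [hG, atomMass, indicator_of_mem hp, Pi.one_apply, mul_one]
      rw [mul_assoc, hcancel, mul_one]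
    · simp [hG, hp]
  have hκ := hρ.kappa_nonneg u m
  have hψ := hρ.psi_nonneg hv
  rw [lintegral_one_sub_nexp_atomMass hθ hρ hD hv, h2,
    ← ENNReal.ofReal_toReal (measure_ne_top G₀ D),
    ← ENNReal.ofReal_mul (by positivity), ← ENNReal.ofReal_mul (by positivity),
    ← ENNReal.ofReal_mul (by positivity), nexp_ofReal (by positivity),
    ← ENNReal.ofReal_mul (by positivity)] at h1
  rw [show θ * (G₀ D).toReal * kappa ρ u m * Real.exp (-(θ * (G₀ D).toReal * psi ρ v)) =
    Real.exp (-(θ * psi ρ v * (G₀ D).toReal)) * (θ * kappa ρ u m * (G₀ D).toReal) by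
      rw [show θ * psi ρ v * (G₀ D).toReal = θ * (G₀ D).toReal * psi ρ v by ring]; ring, ← h1]
  have hat := h.measurable_atoms
  have hjm := h.measurable_jump
  have hlm := h.measurable_loc
  have hrm := fun k => (measurable_restMass hD k).comp hat
  simp only [Function.comp_def] at hrm
  rw [← lintegral_tsum fun k => by fun_prop]
  refine lintegral_congr fun ω => ?_
  rw [lintegral_atoms hGm, lintegral_atoms (f := fun p => ENNReal.ofReal v * atomMass D p)
    (by fun_prop), ENNReal.tsum_mul_left, ← ENNReal.tsum_mul_left]
  refine tsum_congr fun k => ?_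
  have h3 := atomMass_add_restMass D k fun k => (jump k ω, loc k ω)
  rw [totalMass] at h3
  rw [← h3, mul_add, nexp_add]
  by_cases hk : loc k ω ∈ D
  · simp only [hG, atomMass, indicator_of_mem hk, Pi.one_apply, mul_one, one_mul]
    rw [← one_mul (g (jump k ω) * _), ← hcancel (jump k ω)]
    ring
  · simp [hG, hk]

end IsCRM

/-- The moments of an exponentially tilted measure are the derivatives of its Laplace
transform. -/
lemma lintegral_pow_mul_nexp {Q : Measure ℝ≥0∞} (hQ : ∀ᵐ x ∂Q, x ≠ ∞) {F : ℝ → ℝ}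
    (hF0 : ∀ v, 0 < v → 0 ≤ F v)
    (hF : ∀ v, 0 < v → ∫⁻ x, nexp (ENNReal.ofReal v * x) ∂Q = ENNReal.ofReal (F v))
    {u : ℝ} (hu : 0 < u) (m : ℕ) :
    ∫⁻ x, x ^ m * nexp (ENNReal.ofReal u * x) ∂Q =
      ENNReal.ofReal ((-1) ^ m * iteratedDeriv m F u) := by
  -- With this sign the Laplace transform is the moment generating function of `Y` on `(0, ∞)`,
  -- which lies in the interior of the domain of integrability; there the derivatives are moments.
  set Y : ℝ≥0∞ → ℝ := fun x => -x.toReal with hY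
  have hYm : Measurable Y := ENNReal.measurable_toReal.neg
  have hnexp : ∀ v, 0 < v → ∀ x : ℝ≥0∞, x ≠ ∞ →
      nexp (ENNReal.ofReal v * x) = ENNReal.ofReal (Real.exp (v * Y x)) := by
    intro v hv x hx
    rw [nexp_eq_ofReal (ENNReal.mul_ne_top ENNReal.ofReal_ne_top hx), ENNReal.toReal_mul,
      ENNReal.toReal_ofReal hv.le, hY]
    congr 2; ring
  have hlap : ∀ v, 0 < v → ∫⁻ x, ENNReal.ofReal (Real.exp (v * Y x)) ∂Q = ENNReal.ofReal (F v) := by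
    intro v hv
    rw [← hF v hv]
    exact lintegral_congr_ae (hQ.mono fun x hx => (hnexp v hv x hx).symm)
  have hint : Ioi 0 ⊆ integrableExpSet Y Q := by
    intro v hv
    refine ⟨(by fun_prop), ?_⟩
    rw [hasFiniteIntegral_iff_ofReal (Eventually.of_forall fun x => (Real.exp_pos _).le),
      hlap v hv]
    exact ENNReal.ofReal_lt_top
  have hmem : u ∈ interior (integrableExpSet Y Q) :=
    interior_mono hint (by rw [interior_Ioi]; exact hu)
  have hmgf : F =ᶠ[𝓝 u] mgf Y Q := by
    filter_upwards [Ioi_mem_nhds hu] with v hv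
    rw [mgf, integral_eq_lintegral_of_nonneg_ae
      (Eventually.of_forall fun x => (Real.exp_pos _).le) (by fun_prop), hlap v hv,
      ENNReal.toReal_ofReal (hF0 v hv)]
  rw [hmgf.iteratedDeriv_eq, iteratedDeriv_mgf hmem, ← integral_const_mul,
    ofReal_integral_eq_lintegral_ofReal]
  · refine lintegral_congr_ae (hQ.mono fun x hx => ?_)
    simp only
    rw [hnexp u hu x hx, ← mul_assoc, ← mul_pow, hY, neg_mul_neg, one_mul,
      ENNReal.ofReal_mul (by positivity), ENNReal.ofReal_pow ENNReal.toReal_nonneg,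
      ENNReal.ofReal_toReal hx]
  · exact (integrable_pow_mul_exp_of_mem_interior_integrableExpSet hmem m).const_mul _
  · refine Eventually.of_forall fun x => ?_
    simp only [Pi.zero_apply]
    rw [← mul_assoc, ← mul_pow, hY, neg_mul_neg, one_mul]
    positivity

namespace IsCRM

variable {Ω S : Type*} [MeasurableSpace Ω] [MeasurableSpace S] {P : Measure Ω}
  [IsProbabilityMeasure P] {G₀ : Measure S} [IsProbabilityMeasure G₀]
  {θ : ℝ} {ρ : ℝ → ℝ} {jump : ℕ → Ω → ℝ} {loc : ℕ → Ω → S}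

/-- The exponentially tilted moments of the mass of a set are the values of `phi`. -/
lemma lintegral_totalMass_pow (h : IsCRM P θ ρ G₀ jump loc) (hθ : 0 < θ) (hρ : IsJumpDensity ρ)
    {D : Set S} (hD : MeasurableSet D) {u : ℝ} (hu : 0 < u) (m : ℕ) :
    ∫⁻ ω, (totalMass D fun k => (jump k ω, loc k ω)) ^ m *
        nexp (ENNReal.ofReal u * totalMass D fun k => (jump k ω, loc k ω)) ∂P =
      ENNReal.ofReal (phi (θ * (G₀ D).toReal) ρ m u) := by
  have hT : Measurable fun ω => totalMass D fun k => (jump k ω, loc k ω) :=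
    (measurable_totalMass hD).comp h.measurable_atoms
  have h1 := lintegral_pow_mul_nexp (Q := P.map fun ω => totalMass D fun k => (jump k ω, loc k ω))
    ((ae_map_iff hT.aemeasurable (measurableSet_singleton _).compl).2
      (h.ae_totalMass_ne_top hθ hρ hD))
    (F := fun v => Real.exp (-(θ * (G₀ D).toReal * psi ρ v))) (fun v _ => (Real.exp_pos _).le)
    (fun v hv => by
      rw [lintegral_map (by fun_prop) hT]
      exact h.lintegral_nexp_totalMass hθ hρ hD hv) hu m
  rwa [lintegral_map (by fun_prop) hT] at h1

/-- It is a tilted moment of a variable that is almost surely positive and finite. This makes the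
conditioning event have positive probability. -/
lemma phi_pos (h : IsCRM P θ ρ G₀ jump loc) (hθ : 0 < θ) (hρ : IsJumpDensity ρ)
    {D : Set S} (hD : MeasurableSet D) (hD0 : G₀ D ≠ 0) {u : ℝ} (hu : 0 < u) (m : ℕ) :
    0 < phi (θ * (G₀ D).toReal) ρ m u := by
  have hT : Measurable fun ω => totalMass D fun k => (jump k ω, loc k ω) :=
    (measurable_totalMass hD).comp h.measurable_atoms
  rw [← ENNReal.ofReal_pos, ← h.lintegral_totalMass_pow hθ hρ hD hu m, pos_iff_ne_zero]
  intro h0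
  rw [lintegral_eq_zero_iff (by fun_prop)] at h0
  have hfalse : ∀ᵐ ω ∂P, False := by
    filter_upwards [h0, h.ae_totalMass_ne_top hθ hρ hD, h.ae_totalMass_ne_zero hθ hρ hD hD0]
      with ω h1 h2 h3
    exact mul_ne_zero (pow_ne_zero m h3)
      (nexp_ne_zero (ENNReal.mul_ne_top ENNReal.ofReal_ne_top h2)) h1
  exact absurd hfalse (by simp [IsProbabilityMeasure.ne_zero P])

/-- The Mecke formula for the exponentially tilted moments of the mass of a set without one of
its atoms. -/
lemma tsum_lintegral_restMass_pow (h : IsCRM P θ ρ G₀ jump loc) (hθ : 0 < θ)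
    (hρ : IsJumpDensity ρ) {D : Set S} (hD : MeasurableSet D) {u : ℝ} (hu : 0 < u)
    {m : ℕ} (hm : 1 ≤ m) (q : ℕ) :
    ∑' k, ∫⁻ ω, D.indicator 1 (loc k ω) * (ENNReal.ofReal (jump k ω) ^ m *
        nexp (ENNReal.ofReal u * ENNReal.ofReal (jump k ω))) *
        ((restMass D k fun k => (jump k ω, loc k ω)) ^ q *
        nexp (ENNReal.ofReal u * restMass D k fun k => (jump k ω, loc k ω))) ∂P =
      ENNReal.ofReal (θ * (G₀ D).toReal * kappa ρ u m * phi (θ * (G₀ D).toReal) ρ q u) := by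
  have hjm := h.measurable_jump
  have hlm := h.measurable_loc
  have hDi : Measurable (D.indicator (1 : S → ℝ≥0∞)) := measurable_one.indicator hD
  have hrm : ∀ k, Measurable fun ω => restMass D k fun k => (jump k ω, loc k ω) := fun k =>
    (measurable_restMass hD k).comp h.measurable_atoms
  set w : ℕ → Ω → ℝ≥0∞ := fun k ω => D.indicator 1 (loc k ω) * (ENNReal.ofReal (jump k ω) ^ m *
        nexp (ENNReal.ofReal u * ENNReal.ofReal (jump k ω))) with hw
  have hwm : ∀ k, Measurable (w k) := fun k => by fun_prop
  -- Sum over `k` of the laws of the remaining mass, each weighted by the factor of the removed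
  -- atom. Its Laplace transform is a constant times `e^{-tψ}`, so the whole sum can be
  -- differentiated at once.
  set Q : Measure ℝ≥0∞ := Measure.sum fun k =>
    (P.withDensity (w k)).map fun ω => restMass D k fun k => (jump k ω, loc k ω) with hQ
  have hQint : ∀ f : ℝ≥0∞ → ℝ≥0∞, Measurable f → ∫⁻ x, f x ∂Q =
      ∑' k, ∫⁻ ω, w k ω * f (restMass D k fun k => (jump k ω, loc k ω)) ∂P := by
    intro f hf
    rw [hQ, lintegral_sum_measure]
    refine tsum_congr fun k => ?_
    have hfr : Measurable fun ω => f (restMass D k fun k => (jump k ω, loc k ω)) := hf.comp (hrm k)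
    rw [lintegral_map hf (hrm k), lintegral_withDensity_eq_lintegral_mul _ (hwm k) hfr]
    rfl
  have hQtop : ∀ᵐ x ∂Q, x ≠ ∞ := by
    rw [hQ]
    refine (Measure.ae_sum_iff' (measurableSet_singleton _).compl).2 ?_
    intro k
    rw [ae_map_iff (hrm k).aemeasurable (measurableSet_singleton _).compl]
    refine (withDensity_absolutelyContinuous _ _).ae_le ?_
    filter_upwards [h.ae_totalMass_ne_top hθ hρ hD] with ω hω
    rw [← atomMass_add_restMass D k] at hω
    exact (ENNReal.add_ne_top.1 hω).2
  have h1 := lintegral_pow_mul_nexp hQtop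
    (F := fun v => θ * (G₀ D).toReal * kappa ρ u m *
      Real.exp (-(θ * (G₀ D).toReal * psi ρ v)))
    (fun v _ => by have := hρ.kappa_nonneg u m; positivity)
    (fun v hv => by
      rw [hQint _ (by fun_prop)]
      exact h.tsum_lintegral_nexp_restMass hθ hρ hD hu hv hm) hu q
  rw [hQint _ (by fun_prop)] at h1
  rw [h1, iteratedDeriv_const_mul_field, phi]
  congr 1; ring

end IsCRM

/-! ### Products of Poisson laws and events on finitely many coordinates. -/

section PoissonSums

/-- The Poisson weights `e^{-x} x^m / m!`. -/
def poissonWeight (x : ℝ≥0∞) (m : ℕ) : ℝ≥0∞ := nexp x * x ^ m / (m.factorial : ℝ≥0∞)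

lemma poissonMeasure_singleton_eq (q : ℝ≥0) (m : ℕ) :
    poissonMeasure q {m} = poissonWeight q m := by
  have hq : (q : ℝ≥0∞) = ENNReal.ofReal q := (ENNReal.ofReal_coe_nnreal).symm
  rw [poissonMeasure_singleton, poissonWeight, hq, nexp_ofReal q.coe_nonneg,
    ← ENNReal.ofReal_pow q.coe_nonneg, ← ENNReal.ofReal_mul (Real.exp_pos _).le,
    ← ENNReal.ofReal_natCast, ENNReal.ofReal_div_of_pos (by positivity)]

@[fun_prop]
lemma measurable_poissonWeight (m : ℕ) : Measurable fun x => poissonWeight x m := by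
  unfold poissonWeight
  fun_prop

lemma tendsto_poissonWeight {x : ℝ≥0∞} (hx : x ≠ ∞) (m : ℕ) :
    Tendsto (fun y => poissonWeight y m) (𝓝 x) (𝓝 (poissonWeight x m)) := by
  refine ENNReal.Tendsto.div_const ?_ (Or.inr (by positivity))
  exact ENNReal.Tendsto.mul (continuous_nexp.tendsto x) (Or.inr (ENNReal.pow_ne_top hx))
    ((ENNReal.continuous_pow m).tendsto x) (Or.inr (nexp_ne_top x))

lemma poissonWeight_le_one (x : ℝ≥0∞) (m : ℕ) : poissonWeight x m ≤ 1 := by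
  rcases eq_or_ne x ∞ with rfl | hx
  · simp [poissonWeight]
  · lift x to ℝ≥0 using hx
    rw [← poissonMeasure_singleton_eq]
    exact prob_le_one

variable {ι : Type*}

/-- The law of independent Poisson variables with rates `q i`. -/
abbrev poissonProduct (q : ι → ℝ≥0) : Measure (ι → ℕ) :=
  Measure.infinitePi fun i => poissonMeasure (q i)

lemma iIndepFun_poissonProduct (q : ι → ℝ≥0) :
    iIndepFun (fun i (a : ι → ℕ) => a i) (poissonProduct q) :=
  iIndepFun_infinitePi (X := fun _ => id) fun _ => measurable_id

lemma hasLaw_sum_poissonProduct (q : ι → ℝ≥0) (F : Finset ι) :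
    HasLaw (∑ i ∈ F, fun a : ι → ℕ => a i) (poissonMeasure (∑ i ∈ F, q i)) (poissonProduct q) := by
  classical
  induction F using Finset.induction_on with
  | empty =>
    simp only [Finset.sum_empty]
    have h0 : poissonMeasure 0 = Measure.dirac 0 := by
      refine Measure.ext_of_singleton fun m => ?_
      rw [poissonMeasure_singleton_eq, poissonWeight]
      rcases m with _ | m <;> simp
    rw [h0]
    refine ⟨measurable_const.aemeasurable, ?_⟩
    exact (Measure.map_const _ _).trans (by simp)
  | insert i F hi ih =>
    rw [Finset.sum_insert hi, Finset.sum_insert hi]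
    refine IndepFun.hasLaw_add_poissonMeasure ?_ ?_ ih
    · exact ((iIndepFun_poissonProduct q).indepFun_finsetSum_of_notMem
        (fun i => measurable_pi_apply i) hi).symm
    · exact (measurePreserving_eval_infinitePi (fun i => poissonMeasure (q i)) i).hasLaw

/-- Extension by zero of a finite family of levels. -/
def extendZero (F : Finset ι) (b : F → ℕ) (i : ι) : ℕ :=
  open Classical in if h : i ∈ F then b ⟨i, h⟩ else 0

lemma extendZero_apply {F : Finset ι} (b : F → ℕ) {i : ι} (hi : i ∈ F) :
    extendZero F b i = b ⟨i, hi⟩ := by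
  simp [extendZero, hi]

/-- The set `A` only depends on the coordinates in `F`. -/
def DependsOnFinset (F : Finset ι) (A : Set (ι → ℕ)) : Prop :=
  ∀ a a' : ι → ℕ, (∀ i ∈ F, a i = a' i) → (a ∈ A ↔ a' ∈ A)

lemma DependsOnFinset.mono {F F' : Finset ι} (hF : F ⊆ F') {A : Set (ι → ℕ)}
    (h : DependsOnFinset F A) : DependsOnFinset F' A :=
  fun a a' haa => h a a' fun i hi => haa i (hF hi)

/-- Such a set is pulled back from the countable discrete space `F → ℕ`; this gives both its
measurability and the independence of disjoint blocks of coordinates. -/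
lemma DependsOnFinset.preimage_restrict {F : Finset ι} {A : Set (ι → ℕ)}
    (h : DependsOnFinset F A) :
    (fun (a : ι → ℕ) (i : F) => a i) ⁻¹' {b | extendZero F b ∈ A} = A := by
  ext a
  exact h _ _ fun i hi => extendZero_apply _ hi

lemma measurableSet_finset_pi (F : Finset ι) (B : Set (F → ℕ)) : MeasurableSet B :=
  B.to_countable.measurableSet

lemma DependsOnFinset.measurableSet {F : Finset ι} {A : Set (ι → ℕ)}
    (h : DependsOnFinset F A) : MeasurableSet A := by
  rw [← h.preimage_restrict]
  exact measurable_pi_lambda _ (fun i => measurable_pi_apply _) (measurableSet_finset_pi F _)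

lemma poissonProduct_inter (q : ι → ℝ≥0) {F F' : Finset ι} (hF : Disjoint F F')
    {A A' : Set (ι → ℕ)} (hA : DependsOnFinset F A) (hA' : DependsOnFinset F' A') :
    poissonProduct q (A ∩ A') = poissonProduct q A * poissonProduct q A' := by
  have h := (iIndepFun_poissonProduct q).indepFun_finset F F' hF fun i => measurable_pi_apply i
  rw [← hA.preimage_restrict, ← hA'.preimage_restrict]
  exact h.measure_inter_preimage_eq_mul _ _ (measurableSet_finset_pi F _)
    (measurableSet_finset_pi F' _)

lemma dependsOnFinset_sum (F : Finset ι) (x : ℕ) :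
    DependsOnFinset F {a : ι → ℕ | ∑ i ∈ F, a i = x} := fun a a' h => by
  simp only [mem_ofPred_eq, Finset.sum_congr rfl h]

lemma DependsOnFinset.inter {F : Finset ι} {A A' : Set (ι → ℕ)} (hA : DependsOnFinset F A)
    (hA' : DependsOnFinset F A') : DependsOnFinset F (A ∩ A') := fun a a' h =>
  and_congr (hA a a' h) (hA' a a' h)

lemma poissonProduct_sum (q : ι → ℝ≥0) (F : Finset ι) (x : ℕ) :
    poissonProduct q {a | ∑ i ∈ F, a i = x} = poissonWeight (∑ i ∈ F, (q i : ℝ≥0∞)) x := by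
  have h := hasLaw_sum_poissonProduct q F
  have h1 := h.map_eq
  have h2 : (∑ i ∈ F, (q i : ℝ≥0∞)) = ((∑ i ∈ F, q i : ℝ≥0) : ℝ≥0∞) := by push_cast; rfl
  rw [h2, ← poissonMeasure_singleton_eq, ← h1,
    Measure.map_apply_of_aemeasurable h.aemeasurable (measurableSet_singleton _)]
  congr 1
  ext a
  simp

end PoissonSums

/-! ### Levels of finitely many traits in the old samples and in the new one. -/

section Levels

variable {n : ℕ}

/-- The indices of the levels of the traits `k ∈ I` in the first `n` samples. -/
def oldIdx (n : ℕ) (I : Finset ℕ) : Finset (Fin (n + 1) × ℕ) :=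
  (Finset.univ.map Fin.castSuccEmb) ×ˢ I

/-- The indices of the levels of the traits `k ∈ I` in the last sample. -/
def newIdx (n : ℕ) (I : Finset ℕ) : Finset (Fin (n + 1) × ℕ) := {Fin.last n} ×ˢ I

/-- The total level of the trait `k` in the first `n` samples. -/
def oldLevel (a : Fin (n + 1) × ℕ → ℕ) (k : ℕ) : ℕ := ∑ i : Fin n, a (i.castSucc, k)

/-- The level of the trait `k` in the last sample. -/
def newLevel (a : Fin (n + 1) × ℕ → ℕ) (k : ℕ) : ℕ := a (Fin.last n, k)

lemma sum_oldIdx {M : Type*} [AddCommMonoid M] (f : Fin (n + 1) × ℕ → M) (I : Finset ℕ) :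
    ∑ p ∈ oldIdx n I, f p = ∑ k ∈ I, ∑ i : Fin n, f (i.castSucc, k) := by
  rw [oldIdx, Finset.sum_product_right]
  simp

lemma sum_newIdx {M : Type*} [AddCommMonoid M] (f : Fin (n + 1) × ℕ → M) (I : Finset ℕ) :
    ∑ p ∈ newIdx n I, f p = ∑ k ∈ I, f (Fin.last n, k) := by
  rw [newIdx, Finset.sum_product_right]
  simp

lemma disjoint_oldIdx_newIdx (I I' : Finset ℕ) : Disjoint (oldIdx n I) (newIdx n I') := by
  rw [Finset.disjoint_left]
  rintro ⟨i, k⟩ h1 h2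
  simp only [oldIdx, newIdx, Finset.mem_product, Finset.mem_map, Finset.mem_univ, true_and,
    Finset.mem_singleton] at h1 h2
  obtain ⟨⟨i', hi'⟩, _⟩ := h1
  exact (Fin.castSucc_lt_last i').ne (hi'.trans h2.1)

/-- The rates of the levels of atoms of masses `s k`. -/
def rate (r : ℝ) (s : ℕ → ℝ) (p : Fin (n + 1) × ℕ) : ℝ≥0 := (r * s p.2).toNNReal

/-- The levels of the traits `k ∈ I` add up to `x` in the first `n` samples and to `y` in the
last one. -/
def blockEvent (n : ℕ) (I : Finset ℕ) (x y : ℕ) : Set (Fin (n + 1) × ℕ → ℕ) :=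
  {a | ∑ k ∈ I, oldLevel a k = x ∧ ∑ k ∈ I, newLevel a k = y}

lemma blockEvent_eq (I : Finset ℕ) (x y : ℕ) :
    blockEvent n I x y = {a | ∑ p ∈ oldIdx n I, a p = x} ∩ {a | ∑ p ∈ newIdx n I, a p = y} := by
  ext a
  simp only [blockEvent, oldLevel, newLevel, mem_ofPred_eq, mem_inter_iff, sum_oldIdx, sum_newIdx]

lemma dependsOnFinset_blockEvent (I : Finset ℕ) (x y : ℕ) :
    DependsOnFinset (Finset.univ ×ˢ I) (blockEvent n I x y) := by
  rw [blockEvent_eq]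
  exact ((dependsOnFinset_sum _ x).mono
    (Finset.product_subset_product_left (Finset.subset_univ _))).inter
    ((dependsOnFinset_sum _ y).mono
    (Finset.product_subset_product_left (Finset.subset_univ _)))

/-- Old and new levels occupy disjoint blocks of coordinates, and rates of independent Poisson
variables add: each trait counts `n` times in the old block and once in the new one. -/
lemma poissonProduct_blockEvent {r : ℝ} (hr : 0 ≤ r) (s : ℕ → ℝ) (I : Finset ℕ) (x y : ℕ) :
    poissonProduct (rate r s) (blockEvent n I x y) =
      poissonWeight (n * ENNReal.ofReal r * ∑ k ∈ I, ENNReal.ofReal (s k)) x *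
        poissonWeight (ENNReal.ofReal r * ∑ k ∈ I, ENNReal.ofReal (s k)) y := by
  have hrate : ∀ p : Fin (n + 1) × ℕ,
      (rate r s p : ℝ≥0∞) = ENNReal.ofReal r * ENNReal.ofReal (s p.2) := fun p => by
    rw [← ENNReal.ofReal_mul hr]; rfl
  rw [blockEvent_eq, poissonProduct_inter _ (disjoint_oldIdx_newIdx I I) (dependsOnFinset_sum _ x)
    (dependsOnFinset_sum _ y), poissonProduct_sum, poissonProduct_sum, sum_oldIdx, sum_newIdx]
  simp_rw [hrate]
  simp only [Finset.sum_const, Finset.card_univ, Fintype.card_fin, nsmul_eq_mul]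
  rw [Finset.mul_sum, Finset.mul_sum]
  simp_rw [mul_assoc]

lemma poissonProduct_blockEvent_inter {r : ℝ} (s : ℕ → ℝ) {I I' : Finset ℕ}
    (hI : Disjoint I I') (x y x' y' : ℕ) :
    poissonProduct (rate r s) (blockEvent n I x y ∩ blockEvent n I' x' y') =
      poissonProduct (rate r s) (blockEvent n I x y) *
        poissonProduct (rate r s) (blockEvent n I' x' y') :=
  poissonProduct_inter _ (Finset.disjoint_product.2 (Or.inr hI)) (dependsOnFinset_blockEvent I x y)
    (dependsOnFinset_blockEvent I' x' y')

end Levels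

/-- If the total is `c`, the partial sums are integers at most `c` and eventually above `c - 1`; if
not, convergence keeps them away from `c`. This reduces events on infinitely many traits to finitely
many. -/
lemma eventually_sum_eq_iff (g : ℕ → ℕ) (c : ℕ) :
    ∀ᶠ K in atTop, (∑ k ∈ Finset.range K, g k = c ↔ ∑' k, (g k : ℝ≥0∞) = c) := by
  have ht : Tendsto (fun K => ((∑ k ∈ Finset.range K, g k : ℕ) : ℝ≥0∞)) atTop
      (𝓝 (∑' k, (g k : ℝ≥0∞))) := by
    simpa using ENNReal.tendsto_nat_tsum fun k => (g k : ℝ≥0∞)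
  by_cases hc : ∑' k, (g k : ℝ≥0∞) = c
  · simp only [hc, iff_true]
    have hle : ∀ K, ∑ k ∈ Finset.range K, g k ≤ c := fun K => by
      have := ENNReal.sum_le_tsum (f := fun k => (g k : ℝ≥0∞)) (Finset.range K)
      rw [hc] at this
      exact_mod_cast this
    rcases Nat.eq_zero_or_pos c with rfl | hpos
    · exact Eventually.of_forall fun K => Nat.le_zero.1 (hle K)
    · rw [hc] at ht
      have hlt : ((c - 1 : ℕ) : ℝ≥0∞) < c := by exact_mod_cast Nat.sub_lt hpos one_pos
      filter_upwards [ht.eventually_const_lt hlt] with K hK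
      have h1 : c - 1 < ∑ k ∈ Finset.range K, g k := by exact_mod_cast hK
      have h2 := hle K
      omega
  · filter_upwards [ht.eventually_ne hc] with K hK
    simp only [hc, iff_false]
    intro h
    exact hK (by rw [h])

/-! ### Conditional law of the levels given the atoms, and passage to all traits of a set. -/

namespace IsIBPSample

variable {Ω S : Type*} [MeasurableSpace Ω] [MeasurableSpace S] {P : Measure Ω}
  {n : ℕ} {r : ℝ} {jump : ℕ → Ω → ℝ} {loc : ℕ → Ω → S} {lev : Fin (n + 1) → ℕ → Ω → ℕ}

/-- Events of finitely many levels and of all atoms: given the atoms, the levels are independent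
Poisson variables. -/
lemma measure_levels_mem
    (h : IsIBPSample P (fun s => poissonMeasure (r * s).toNNReal) jump loc lev)
    (hξ : Measurable fun ω k => (jump k ω, loc k ω)) (F : Finset (Fin (n + 1) × ℕ))
    (G : (ℕ → ℝ × S) → Set (Fin (n + 1) × ℕ → ℕ)) (hG : ∀ p, DependsOnFinset F (G p))
    (hGm : ∀ a, MeasurableSet {p | a ∈ G p}) :
    P {ω | (fun p => lev p.1 p.2 ω) ∈ G fun k => (jump k ω, loc k ω)} =
      ∫⁻ ω, poissonProduct (rate r fun k => jump k ω) (G fun k => (jump k ω, loc k ω)) ∂P := by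
  have hcyl : ∀ b : F → ℕ, DependsOnFinset F {a : Fin (n + 1) × ℕ → ℕ | ∀ p ∈ F, a p = extendZero F b p} := by
    intro b a a' haa
    exact forall₂_congr fun p hp => by rw [haa p hp]
  have hdisj : ∀ b b' : F → ℕ, b ≠ b' →
      Disjoint {a : Fin (n + 1) × ℕ → ℕ | ∀ p ∈ F, a p = extendZero F b p} {a : Fin (n + 1) × ℕ → ℕ | ∀ p ∈ F, a p = extendZero F b' p} := by
    intro b b' hbb
    refine Set.disjoint_left.2 fun a h1 h2 => hbb ?_
    ext p
    rw [← extendZero_apply b p.2, ← extendZero_apply b' p.2, ← h1 p p.2, ← h2 p p.2]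
  have hcover : ∀ a : Fin (n + 1) × ℕ → ℕ, ∃ b : F → ℕ, ∀ p ∈ F, a p = extendZero F b p := fun a =>
    ⟨fun p => a p, fun p hp => (extendZero_apply (fun p : F => a p) hp).symm⟩
  -- Partition according to the countably many values `b` of the levels in `F`. On each piece the
  -- event constrains only the atoms, and the conditional law applies.
  have hL : {ω | (fun p => lev p.1 p.2 ω) ∈ G fun k => (jump k ω, loc k ω)} =
      ⋃ b : F → ℕ, {ω | (fun k => (jump k ω, loc k ω)) ∈ {p | extendZero F b ∈ G p} ∧
        ∀ p ∈ F, lev p.1 p.2 ω = extendZero F b p} := by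
    ext ω
    simp only [mem_ofPred_eq, mem_iUnion]
    constructor
    · intro hω
      obtain ⟨b, hb⟩ := hcover fun p => lev p.1 p.2 ω
      exact ⟨b, (hG _ _ _ hb).1 hω, hb⟩
    · rintro ⟨b, hω, hb⟩
      exact (hG _ _ _ hb).2 hω
  have hmE : ∀ b : F → ℕ, MeasurableSet {ω | (fun k => (jump k ω, loc k ω)) ∈
      {p | extendZero F b ∈ G p}} := fun b => hξ (hGm _)
  have hm : ∀ b : F → ℕ, MeasurableSet {ω | (fun k => (jump k ω, loc k ω)) ∈
      {p | extendZero F b ∈ G p} ∧ ∀ p ∈ F, lev p.1 p.2 ω = extendZero F b p} := by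
    intro b
    have hF : MeasurableSet {ω | ∀ p ∈ F, lev p.1 p.2 ω = extendZero F b p} := by
      have : {ω | ∀ p ∈ F, lev p.1 p.2 ω = extendZero F b p} =
          ⋂ p ∈ F, {ω | lev p.1 p.2 ω = extendZero F b p} := by ext; simp
      rw [this]
      exact Finset.measurableSet_biInter F fun p _ =>
        h.measurable_lev p.1 p.2 (measurableSet_singleton _)
    exact (hmE b).inter hF
  have hlaw : ∀ b : F → ℕ, P {ω | (fun k => (jump k ω, loc k ω)) ∈ {p | extendZero F b ∈ G p} ∧
      ∀ p ∈ F, lev p.1 p.2 ω = extendZero F b p} =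
      ∫⁻ ω, {ω | (fun k => (jump k ω, loc k ω)) ∈ {p | extendZero F b ∈ G p}}.indicator
        (fun ω => ∏ p ∈ F, poissonMeasure (r * jump p.2 ω).toNNReal {extendZero F b p}) ω ∂P := by
    intro b
    rw [lintegral_indicator (hmE b)]
    exact h.cond_law F (extendZero F b) _ (hGm (extendZero F b))
  rw [hL, measure_iUnion (fun b b' hbb => ?_) hm]
  · rw [tsum_congr hlaw, ← lintegral_tsum]
    · refine lintegral_congr fun ω => ?_
      have hU : G (fun k => (jump k ω, loc k ω)) = ⋃ b : F → ℕ,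
          (G (fun k => (jump k ω, loc k ω)) ∩ {a : Fin (n + 1) × ℕ → ℕ | ∀ p ∈ F, a p = extendZero F b p}) := by
        rw [← inter_iUnion, eq_comm, inter_eq_left]
        intro a _
        exact mem_iUnion.2 (hcover a)
      rw [hU, measure_iUnion]
      · refine tsum_congr fun b => ?_
        by_cases hb : extendZero F b ∈ G fun k => (jump k ω, loc k ω)
        · have h1 : G (fun k => (jump k ω, loc k ω)) ∩ {a : Fin (n + 1) × ℕ → ℕ | ∀ p ∈ F, a p = extendZero F b p} =
              (F : Set (Fin (n + 1) × ℕ)).pi fun p => {extendZero F b p} := by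
            ext a
            simp only [mem_inter_iff, mem_ofPred_eq, Set.mem_pi, SetLike.mem_coe, mem_singleton_iff]
            exact ⟨fun h => h.2, fun ha => ⟨(hG _ _ _ ha).2 hb, ha⟩⟩
          rw [indicator_of_mem (by exact hb), h1, poissonProduct,
            Measure.infinitePi_pi _ fun p _ => measurableSet_singleton _]
          rfl
        · have h1 : G (fun k => (jump k ω, loc k ω)) ∩ {a : Fin (n + 1) × ℕ → ℕ | ∀ p ∈ F, a p = extendZero F b p} =
              ∅ := by
            ext a
            simp only [mem_inter_iff, mem_ofPred_eq, mem_empty_iff_false, iff_false, not_and]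
            exact fun h2 ha => hb ((hG _ _ _ ha).1 h2)
          rw [indicator_of_notMem (by exact hb), h1, measure_empty]
      · exact fun b b' hbb => (hdisj b b' hbb).mono inter_subset_right inter_subset_right
      · exact fun b => ((hG _).inter (hcyl b)).measurableSet
    · intro b
      refine Measurable.aemeasurable (Measurable.indicator ?_ (hmE b))
      refine Finset.measurable_prod F fun p _ => ?_
      have hj : Measurable (jump p.2) := measurable_fst.comp ((measurable_pi_iff.1 hξ) p.2)
      simp_rw [poissonMeasure_singleton_eq]
      fun_prop
  · refine Set.disjoint_left.2 fun ω h1 h2 => ?_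
    have h3 : (fun p : Fin (n + 1) × ℕ => lev p.1 p.2 ω) ∈
        {a : Fin (n + 1) × ℕ → ℕ | ∀ p ∈ F, a p = extendZero F b p} := h1.2
    exact Set.disjoint_left.1 (hdisj b b' hbb) h3 h2.2

end IsIBPSample

section Bucket

variable {Ω S : Type*} [MeasurableSpace Ω] [MeasurableSpace S] {n : ℕ}
  {loc : ℕ → Ω → S} {lev : Fin (n + 1) → ℕ → Ω → ℕ}

open Classical in
/-- The traits `k < K` of the set `D`. -/
def traitsIn (D : Set S) (K : ℕ) (p : ℕ → ℝ × S) : Finset ℕ :=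
  (Finset.range K).filter fun k => (p k).2 ∈ D

lemma X_apply {D : Set S} (hD : MeasurableSet D) (i : Fin (n + 1)) (ω : Ω) :
    X loc lev i ω D = ∑' k, (lev i k ω : ℝ≥0∞) * D.indicator 1 (loc k ω) := by
  rw [X, sample, Measure.sum_apply _ hD]
  refine tsum_congr fun k => ?_
  rw [Measure.smul_apply, Measure.dirac_apply' _ hD, smul_eq_mul]

open Classical in
lemma X_last_apply {D : Set S} (hD : MeasurableSet D) (ω : Ω) :
    X loc lev (Fin.last n) ω D =
      ∑' k, ((if loc k ω ∈ D then newLevel (fun p => lev p.1 p.2 ω) k else 0 : ℕ) : ℝ≥0∞) := by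
  rw [X_apply hD]
  refine tsum_congr fun k => ?_
  by_cases hk : loc k ω ∈ D <;> simp [hk, newLevel]

open Classical in
lemma totalLevel_apply {D : Set S} (hD : MeasurableSet D) (ω : Ω) :
    totalLevel loc lev D ω =
      ∑' k, ((if loc k ω ∈ D then oldLevel (fun p => lev p.1 p.2 ω) k else 0 : ℕ) : ℝ≥0∞) := by
  simp_rw [totalLevel, X_apply hD]
  rw [← Summable.tsum_finsetSum fun i _ => ENNReal.summable]
  refine tsum_congr fun k => ?_
  by_cases hk : loc k ω ∈ D <;> simp [hk, oldLevel]

lemma measurable_X (hloc : ∀ k, Measurable (loc k)) (hlev : ∀ i k, Measurable (lev i k))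
    {D : Set S} (hD : MeasurableSet D) (i : Fin (n + 1)) :
    Measurable fun ω => X loc lev i ω D := by
  simp_rw [X_apply hD]
  refine Measurable.tsum fun k => Measurable.mul ?_ ((measurable_one.indicator hD).comp (hloc k))
  exact measurable_from_top.comp (hlev i k)

lemma measurable_totalLevel (hloc : ∀ k, Measurable (loc k)) (hlev : ∀ i k, Measurable (lev i k))
    {D : Set S} (hD : MeasurableSet D) : Measurable (totalLevel loc lev D) :=
  Finset.measurable_fun_sum _ fun _ _ => measurable_X hloc hlev hD _

lemma eventually_blockEvent_iff {D : Set S} (hD : MeasurableSet D) (jump : ℕ → Ω → ℝ) (c b : ℕ)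
    (ω : Ω) :
    ∀ᶠ K in atTop, ((fun p => lev p.1 p.2 ω) ∈
        blockEvent n (traitsIn D K fun k => (jump k ω, loc k ω)) c b ↔
      totalLevel loc lev D ω = c ∧ X loc lev (Fin.last n) ω D = b) := by
  classical
  rw [totalLevel_apply hD, X_last_apply hD]
  filter_upwards [eventually_sum_eq_iff
    (fun k => if loc k ω ∈ D then oldLevel (fun p => lev p.1 p.2 ω) k else 0) c,
    eventually_sum_eq_iff
    (fun k => if loc k ω ∈ D then newLevel (fun p => lev p.1 p.2 ω) k else 0) b] with K h1 h2
  rw [← h1, ← h2]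
  simp only [blockEvent, mem_ofPred_eq, traitsIn, Finset.sum_filter]

lemma tendsto_sum_traitsIn (D : Set S) (p : ℕ → ℝ × S) :
    Tendsto (fun K => ∑ k ∈ traitsIn D K p, ENNReal.ofReal (p k).1) atTop
      (𝓝 (totalMass D p)) := by
  refine (ENNReal.tendsto_nat_tsum _).congr fun K => ?_
  rw [traitsIn, Finset.sum_filter]
  refine Finset.sum_congr rfl fun k _ => ?_
  by_cases hk : (p k).2 ∈ D <;> simp [hk, atomMass]

lemma tendsto_sum_traitsIn_erase (D : Set S) (k : ℕ) (p : ℕ → ℝ × S) :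
    Tendsto (fun K => ∑ k' ∈ (traitsIn D K p).erase k, ENNReal.ofReal (p k').1) atTop
      (𝓝 (restMass D k p)) := by
  classical
  refine (ENNReal.tendsto_nat_tsum _).congr fun K => ?_
  rw [traitsIn, ← Finset.filter_ne', Finset.filter_filter, Finset.sum_filter]
  refine Finset.sum_congr rfl fun k' _ => ?_
  by_cases hk : (p k').2 ∈ D <;> by_cases hkk : k' = k <;> simp [hk, hkk, atomMass]

lemma dependsOnFinset_blockEvent_traitsIn (D : Set S) (K c b : ℕ) (p : ℕ → ℝ × S) :
    DependsOnFinset (Finset.univ ×ˢ Finset.range K) (blockEvent n (traitsIn D K p) c b) := by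
  classical
  exact (dependsOnFinset_blockEvent _ c b).mono
    (Finset.product_subset_product_right (Finset.filter_subset _ _))

lemma measurableSet_mem_blockEvent {D : Set S} (hD : MeasurableSet D) (K c b : ℕ)
    (a : Fin (n + 1) × ℕ → ℕ) :
    MeasurableSet {p : ℕ → ℝ × S | a ∈ blockEvent n (traitsIn D K p) c b} := by
  classical
  have hm : ∀ g : ℕ → ℕ, Measurable fun p : ℕ → ℝ × S => ∑ k ∈ traitsIn D K p, g k := by
    intro g
    simp_rw [traitsIn, Finset.sum_filter]
    refine Finset.measurable_fun_sum _ fun k _ => ?_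
    exact Measurable.ite ((measurable_snd.comp (measurable_pi_apply k)) hD)
      measurable_const measurable_const
  exact (hm _ (measurableSet_singleton c)).inter (hm _ (measurableSet_singleton b))

/-- The trait `k` is in `D`, has frequency level `l` in the first `n` samples and level `a` in the
last one. -/
def traitEvent (D : Set S) (k l a : ℕ) (loc : ℕ → Ω → S) (lev : Fin (n + 1) → ℕ → Ω → ℕ) :
    Set Ω :=
  {ω | loc k ω ∈ D ∧ (fun p => lev p.1 p.2 ω) ∈ blockEvent n {k} l a}

/-- The set `D` has total level `c` in the first `n` samples and `b` in the last one. -/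
def countEvent (D : Set S) (c b : ℕ) (loc : ℕ → Ω → S) (lev : Fin (n + 1) → ℕ → Ω → ℕ) :
    Set Ω :=
  {ω | totalLevel loc lev D ω = c ∧ X loc lev (Fin.last n) ω D = b}

lemma measurableSet_levels_mem (hlev : ∀ i k, Measurable (lev i k))
    {F : Finset (Fin (n + 1) × ℕ)} {A : Set (Fin (n + 1) × ℕ → ℕ)} (hA : DependsOnFinset F A) :
    MeasurableSet {ω | (fun p => lev p.1 p.2 ω) ∈ A} := by
  have h : Measurable fun ω (p : Fin (n + 1) × ℕ) => lev p.1 p.2 ω :=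
    measurable_pi_lambda _ fun p => hlev p.1 p.2
  exact h hA.measurableSet

lemma measurableSet_traitEvent (hloc : ∀ k, Measurable (loc k))
    (hlev : ∀ i k, Measurable (lev i k)) {D : Set S} (hD : MeasurableSet D) (k l a : ℕ) :
    MeasurableSet (traitEvent D k l a loc lev) :=
  (hloc k hD).inter (measurableSet_levels_mem hlev (dependsOnFinset_blockEvent _ _ _))

lemma measurableSet_countEvent (hloc : ∀ k, Measurable (loc k))
    (hlev : ∀ i k, Measurable (lev i k)) {D : Set S} (hD : MeasurableSet D) (c b : ℕ) :
    MeasurableSet (countEvent D c b loc lev) :=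
  (measurable_totalLevel hloc hlev hD (measurableSet_singleton _)).inter
    (measurable_X hloc hlev hD _ (measurableSet_singleton _))

end Bucket

namespace IsIBPSample

variable {Ω S : Type*} [MeasurableSpace Ω] [MeasurableSpace S] {P : Measure Ω}
  [IsProbabilityMeasure P]
  {n : ℕ} {r : ℝ} {jump : ℕ → Ω → ℝ} {loc : ℕ → Ω → S} {lev : Fin (n + 1) → ℕ → Ω → ℕ}

lemma measurable_levels_mem
    (h : IsIBPSample P (fun s => poissonMeasure (r * s).toNNReal) jump loc lev)
    (hξ : Measurable fun ω k => (jump k ω, loc k ω)) (F : Finset (Fin (n + 1) × ℕ))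
    (G : (ℕ → ℝ × S) → Set (Fin (n + 1) × ℕ → ℕ)) (hG : ∀ p, DependsOnFinset F (G p))
    (hGm : ∀ a, MeasurableSet {p | a ∈ G p}) :
    MeasurableSet {ω | (fun p => lev p.1 p.2 ω) ∈ G fun k => (jump k ω, loc k ω)} := by
  have : {ω | (fun p => lev p.1 p.2 ω) ∈ G fun k => (jump k ω, loc k ω)} =
      ⋃ b : F → ℕ, {ω | (fun p : F => lev p.1.1 p.1.2 ω) = b} ∩
        {ω | (fun k => (jump k ω, loc k ω)) ∈ {p | extendZero F b ∈ G p}} := by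
    ext ω
    simp only [mem_iUnion, mem_inter_iff, mem_ofPred_eq]
    constructor
    · intro hω
      exact ⟨_, rfl, (hG _ _ _ fun p hp => by rw [extendZero_apply _ hp]).1 hω⟩
    · rintro ⟨b, rfl, hω⟩
      exact (hG _ _ _ fun p hp => by rw [extendZero_apply _ hp]).2 hω
  rw [this]
  refine MeasurableSet.iUnion fun b => MeasurableSet.inter ?_ (hξ (hGm _))
  exact (measurable_pi_lambda _ fun p : F => h.measurable_lev p.1.1 p.1.2)
    (measurableSet_singleton b)

/-- Restrict to the traits of index below `K`, where the Poisson computation is exact, and let `K →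
∞` on both sides by bounded convergence. Finiteness of the mass gives the continuity of the weights
at the limit. -/
lemma measure_countEvent
    (h : IsIBPSample P (fun s => poissonMeasure (r * s).toNNReal) jump loc lev) (hr : 0 ≤ r)
    (hjump : ∀ k, Measurable (jump k)) (hloc : ∀ k, Measurable (loc k))
    {D : Set S} (hD : MeasurableSet D)
    (hT : ∀ᵐ ω ∂P, totalMass D (fun k => (jump k ω, loc k ω)) ≠ ∞) (c b : ℕ) :
    P (countEvent D c b loc lev) =
      ∫⁻ ω, poissonWeight (n * ENNReal.ofReal r * totalMass D fun k => (jump k ω, loc k ω)) c *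
        poissonWeight (ENNReal.ofReal r * totalMass D fun k => (jump k ω, loc k ω)) b ∂P := by
  have hξ : Measurable fun ω k => (jump k ω, loc k ω) :=
    measurable_pi_lambda _ fun k => (hjump k).prodMk (hloc k)
  set G : ℕ → (ℕ → ℝ × S) → Set (Fin (n + 1) × ℕ → ℕ) := fun K p =>
    blockEvent n (traitsIn D K p) c b with hG
  have hGd := fun K => dependsOnFinset_blockEvent_traitsIn (n := n) D K c b
  have hGm := fun K => measurableSet_mem_blockEvent (n := n) hD K c b
  have h1 : Tendsto (fun K => P {ω | (fun p => lev p.1 p.2 ω) ∈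
      G K fun k => (jump k ω, loc k ω)}) atTop (𝓝 (P (countEvent D c b loc lev))) := by
    refine tendsto_measure_of_ae_tendsto_indicator_of_isFiniteMeasure _
      (measurableSet_countEvent hloc h.measurable_lev hD c b)
      (fun K => h.measurable_levels_mem hξ _ (G K) (hGd K) (hGm K)) (Eventually.of_forall fun ω => ?_)
    exact eventually_blockEvent_iff hD jump c b ω
  have h2 : ∀ K, P {ω | (fun p => lev p.1 p.2 ω) ∈ G K fun k => (jump k ω, loc k ω)} =
      ∫⁻ ω, poissonWeight (n * ENNReal.ofReal r *
          ∑ k ∈ traitsIn D K (fun k => (jump k ω, loc k ω)), ENNReal.ofReal (jump k ω)) c *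
        poissonWeight (ENNReal.ofReal r *
          ∑ k ∈ traitsIn D K (fun k => (jump k ω, loc k ω)), ENNReal.ofReal (jump k ω)) b ∂P := by
    intro K
    rw [h.measure_levels_mem hξ _ (G K) (hGd K) (hGm K)]
    exact lintegral_congr fun ω => poissonProduct_blockEvent hr _ _ c b
  simp_rw [h2] at h1
  refine tendsto_nhds_unique h1 (tendsto_lintegral_of_dominated_convergence (fun _ => 1)
    (fun K => ?_) (fun K => Eventually.of_forall fun ω => ?_) (by simp) ?_)
  · have : Measurable fun ω => ∑ k ∈ traitsIn D K (fun k => (jump k ω, loc k ω)),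
        ENNReal.ofReal (jump k ω) := by
      classical
      simp_rw [traitsIn, Finset.sum_filter]
      exact Finset.measurable_fun_sum _ fun k _ => Measurable.ite (hloc k hD)
        (ENNReal.measurable_ofReal.comp (hjump k)) measurable_const
    fun_prop
  · exact mul_le_one' (poissonWeight_le_one _ _) (poissonWeight_le_one _ _)
  · filter_upwards [hT] with ω hω
    have h3 := tendsto_sum_traitsIn D fun k => (jump k ω, loc k ω)
    have hc : (n : ℝ≥0∞) * ENNReal.ofReal r ≠ ∞ :=
      ENNReal.mul_ne_top (ENNReal.natCast_ne_top n) ENNReal.ofReal_ne_top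
    refine ENNReal.Tendsto.mul ((tendsto_poissonWeight (ENNReal.mul_ne_top hc hω) c).comp
      (ENNReal.Tendsto.const_mul h3 (Or.inr hc)))
      (Or.inr (ne_top_of_le_ne_top ENNReal.one_ne_top (poissonWeight_le_one _ _)))
      ((tendsto_poissonWeight (ENNReal.mul_ne_top ENNReal.ofReal_ne_top hω) b).comp
      (ENNReal.Tendsto.const_mul h3 (Or.inr ENNReal.ofReal_ne_top)))
      (Or.inr (ne_top_of_le_ne_top ENNReal.one_ne_top (poissonWeight_le_one _ _)))

/-- The bounds `l ≤ c` and `a ≤ b` make the truncated subtractions genuine. The two events on the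
right involve disjoint sets of traits, hence are independent. -/
lemma blockEvent_singleton_inter {n : ℕ} {I : Finset ℕ} {k : ℕ} (hk : k ∈ I) {c b l a : ℕ}
    (hl : l ≤ c) (ha : a ≤ b) :
    blockEvent n {k} l a ∩ blockEvent n I c b =
      blockEvent n {k} l a ∩ blockEvent n (I.erase k) (c - l) (b - a) := by
  ext x
  simp only [blockEvent, mem_inter_iff, mem_ofPred_eq, Finset.sum_singleton]
  rw [← Finset.add_sum_erase _ _ hk, ← Finset.add_sum_erase _ _ hk]
  omega

lemma measure_traitEvent_inter_countEvent
    (h : IsIBPSample P (fun s => poissonMeasure (r * s).toNNReal) jump loc lev) (hr : 0 ≤ r)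
    (hjump : ∀ k, Measurable (jump k)) (hloc : ∀ k, Measurable (loc k))
    {D : Set S} (hD : MeasurableSet D)
    (hT : ∀ᵐ ω ∂P, totalMass D (fun k => (jump k ω, loc k ω)) ≠ ∞) {c b l a : ℕ}
    (hl : l ≤ c) (ha : a ≤ b) (k : ℕ) :
    P (traitEvent D k l a loc lev ∩ countEvent D c b loc lev) =
      ∫⁻ ω, D.indicator 1 (loc k ω) *
        (poissonWeight (n * ENNReal.ofReal r * ENNReal.ofReal (jump k ω)) l *
        poissonWeight (ENNReal.ofReal r * ENNReal.ofReal (jump k ω)) a *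
        (poissonWeight (n * ENNReal.ofReal r *
          restMass D k fun k => (jump k ω, loc k ω)) (c - l) *
        poissonWeight (ENNReal.ofReal r *
          restMass D k fun k => (jump k ω, loc k ω)) (b - a))) ∂P := by
  have hξ : Measurable fun ω k => (jump k ω, loc k ω) :=
    measurable_pi_lambda _ fun k => (hjump k).prodMk (hloc k)
  set G : ℕ → (ℕ → ℝ × S) → Set (Fin (n + 1) × ℕ → ℕ) := fun K p =>
    {x | (p k).2 ∈ D ∧ x ∈ blockEvent n {k} l a ∩ blockEvent n (traitsIn D K p) c b} with hG
  -- The index `k` is inserted because the event involves its levels even when `k ≥ K`. The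
  -- factorization itself is needed only for `k < K`.
  set F : ℕ → Finset (Fin (n + 1) × ℕ) := fun K => Finset.univ ×ˢ (insert k (Finset.range K))
    with hF
  have hGd : ∀ K p, DependsOnFinset (F K) (G K p) := by
    intro K p x x' hx
    refine and_congr Iff.rfl ?_
    refine DependsOnFinset.inter ((dependsOnFinset_blockEvent {k} l a).mono
      (Finset.product_subset_product_right ?_))
      ((dependsOnFinset_blockEvent_traitsIn D K c b p).mono
      (Finset.product_subset_product_right ?_)) x x' hx
    · simp
    · exact Finset.subset_insert _ _
  have hGm : ∀ K x, MeasurableSet {p | x ∈ G K p} := by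
    intro K x
    refine MeasurableSet.inter ((measurable_snd.comp (measurable_pi_apply k)) hD)
      (MeasurableSet.inter (MeasurableSet.const _) (measurableSet_mem_blockEvent hD K c b x))
  have h1 : Tendsto (fun K => P {ω | (fun p => lev p.1 p.2 ω) ∈
      G K fun k => (jump k ω, loc k ω)}) atTop
      (𝓝 (P (traitEvent D k l a loc lev ∩ countEvent D c b loc lev))) := by
    refine tendsto_measure_of_ae_tendsto_indicator_of_isFiniteMeasure _
      ((measurableSet_traitEvent hloc h.measurable_lev hD k l a).inter
        (measurableSet_countEvent hloc h.measurable_lev hD c b))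
      (fun K => h.measurable_levels_mem hξ _ (G K) (hGd K) (hGm K)) (Eventually.of_forall fun ω => ?_)
    filter_upwards [eventually_blockEvent_iff (n := n) (lev := lev) (loc := loc) hD jump c b ω]
      with K hK
    simp only [hG, traitEvent, countEvent, mem_inter_iff, mem_ofPred_eq, hK, and_assoc]
  have h2 : ∀ K, k < K → P {ω | (fun p => lev p.1 p.2 ω) ∈ G K fun k => (jump k ω, loc k ω)} =
      ∫⁻ ω, D.indicator 1 (loc k ω) *
        (poissonWeight (n * ENNReal.ofReal r * ENNReal.ofReal (jump k ω)) l *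
        poissonWeight (ENNReal.ofReal r * ENNReal.ofReal (jump k ω)) a *
        (poissonWeight (n * ENNReal.ofReal r *
          ∑ k' ∈ (traitsIn D K (fun k => (jump k ω, loc k ω))).erase k,
            ENNReal.ofReal (jump k' ω)) (c - l) *
        poissonWeight (ENNReal.ofReal r *
          ∑ k' ∈ (traitsIn D K (fun k => (jump k ω, loc k ω))).erase k,
            ENNReal.ofReal (jump k' ω)) (b - a))) ∂P := by
    intro K hK
    rw [h.measure_levels_mem hξ _ (G K) (hGd K) (hGm K)]
    refine lintegral_congr fun ω => ?_
    by_cases hk : loc k ω ∈ D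
    · have hkI : k ∈ traitsIn D K fun k => (jump k ω, loc k ω) := by
        simp [traitsIn, hK, hk]
      have hGk : G K (fun k => (jump k ω, loc k ω)) = blockEvent n {k} l a ∩
          blockEvent n ((traitsIn D K fun k => (jump k ω, loc k ω)).erase k) (c - l) (b - a) := by
        rw [← blockEvent_singleton_inter hkI hl ha]
        ext x
        simp [hG, hk]
      rw [hGk, poissonProduct_blockEvent_inter _ (by simp), poissonProduct_blockEvent hr,
        poissonProduct_blockEvent hr, Finset.sum_singleton, indicator_of_mem hk, Pi.one_apply,
        one_mul]
    · have hGk : G K (fun k => (jump k ω, loc k ω)) = ∅ := by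
        ext x
        simp [hG, hk]
      rw [hGk, measure_empty, indicator_of_notMem hk, zero_mul]
  have h1' := h1.congr' ((eventually_gt_atTop k).mono h2)
  have hDi : Measurable (D.indicator (1 : S → ℝ≥0∞)) := measurable_one.indicator hD
  refine tendsto_nhds_unique h1' (tendsto_lintegral_of_dominated_convergence (fun _ => 1)
    (fun K => ?_) (fun K => Eventually.of_forall fun ω => ?_) (by simp) ?_)
  · have : Measurable fun ω => ∑ k' ∈ (traitsIn D K (fun k => (jump k ω, loc k ω))).erase k,
        ENNReal.ofReal (jump k' ω) := by
      classical
      simp_rw [traitsIn, ← Finset.filter_ne', Finset.filter_filter, Finset.sum_filter]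
      refine Finset.measurable_fun_sum _ fun k' _ => Measurable.ite ?_
        (ENNReal.measurable_ofReal.comp (hjump k')) measurable_const
      exact (hloc k' hD).inter (MeasurableSet.const _)
    fun_prop
  · refine mul_le_one' (indicator_le (fun _ _ => le_rfl) _) (mul_le_one' (mul_le_one' ?_ ?_)
      (mul_le_one' ?_ ?_)) <;> exact poissonWeight_le_one _ _
  · filter_upwards [hT] with ω hω
    rw [← atomMass_add_restMass D k] at hω
    have hω' := (ENNReal.add_ne_top.1 hω).2
    have h3 := tendsto_sum_traitsIn_erase D k fun k => (jump k ω, loc k ω)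
    have hc : (n : ℝ≥0∞) * ENNReal.ofReal r ≠ ∞ :=
      ENNReal.mul_ne_top (ENNReal.natCast_ne_top n) ENNReal.ofReal_ne_top
    have hw : ∀ x m, poissonWeight x m ≠ ∞ := fun x m =>
      ne_top_of_le_ne_top ENNReal.one_ne_top (poissonWeight_le_one _ _)
    refine ENNReal.Tendsto.const_mul (ENNReal.Tendsto.const_mul ?_
      (Or.inr (ENNReal.mul_ne_top (hw _ _) (hw _ _)))) (Or.inr ?_)
    · exact ENNReal.Tendsto.mul ((tendsto_poissonWeight (ENNReal.mul_ne_top hc hω') _).comp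
        (ENNReal.Tendsto.const_mul h3 (Or.inr hc))) (Or.inr (hw _ _))
        ((tendsto_poissonWeight (ENNReal.mul_ne_top ENNReal.ofReal_ne_top hω') _).comp
        (ENNReal.Tendsto.const_mul h3 (Or.inr ENNReal.ofReal_ne_top))) (Or.inr (hw _ _))
    · exact ne_top_of_le_ne_top ENNReal.one_ne_top (indicator_le (fun _ _ => le_rfl) _)

end IsIBPSample

/-- The factor `(n r)^c r^b / (c! b!)` of the joint Poisson weight of the levels `c` and `b`. -/
def levelFactor (n : ℕ) (r : ℝ) (c b : ℕ) : ℝ :=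
  (n * r) ^ c * r ^ b / (c.factorial * b.factorial)

lemma levelFactor_pos {n : ℕ} (hn : 1 ≤ n) {r : ℝ} (hr : 0 < r) (c b : ℕ) :
    0 < levelFactor n r c b := by
  have : (0 : ℝ) < n := by exact_mod_cast hn
  unfold levelFactor
  positivity

lemma levelFactor_mul_div {n : ℕ} (hn : 1 ≤ n) {r : ℝ} (hr : 0 < r) {c b l a : ℕ} (hl : l ≤ c)
    (ha : a ≤ b) :
    levelFactor n r l a * levelFactor n r (c - l) (b - a) / levelFactor n r c b =
      c.choose l * b.choose a := by
  have hn' : (0 : ℝ) < n := by exact_mod_cast hn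
  rw [Nat.cast_choose ℝ hl, Nat.cast_choose ℝ ha]
  unfold levelFactor
  have h1 : ((n : ℝ) * r) ^ c = (n * r) ^ l * (n * r) ^ (c - l) := by
    rw [← pow_add, Nat.add_sub_cancel' hl]
  have h2 : r ^ b = r ^ a * r ^ (b - a) := by rw [← pow_add, Nat.add_sub_cancel' ha]
  rw [h1, h2]
  have f1 := Nat.cast_ne_zero (R := ℝ).2 (Nat.factorial_ne_zero c)
  have f2 := Nat.cast_ne_zero (R := ℝ).2 (Nat.factorial_ne_zero b)
  have f3 := Nat.cast_ne_zero (R := ℝ).2 (Nat.factorial_ne_zero l)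
  have f4 := Nat.cast_ne_zero (R := ℝ).2 (Nat.factorial_ne_zero a)
  have f5 := Nat.cast_ne_zero (R := ℝ).2 (Nat.factorial_ne_zero (c - l))
  have f6 := Nat.cast_ne_zero (R := ℝ).2 (Nat.factorial_ne_zero (b - a))
  field_simp

/-- The exponents `n r x` and `r x` merge into `(n+1) r x`. This is why only the argument `(n+1) r`
and the sum `c + b` enter `phi`. -/
lemma poissonWeight_mul_poissonWeight (n : ℕ) {r : ℝ} (hr : 0 ≤ r) (x : ℝ≥0∞) (c b : ℕ) :
    poissonWeight (n * ENNReal.ofReal r * x) c * poissonWeight (ENNReal.ofReal r * x) b =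
      ENNReal.ofReal (levelFactor n r c b) *
        (x ^ (c + b) * nexp (ENNReal.ofReal ((n + 1) * r) * x)) := by
  have h1 : ENNReal.ofReal ((n + 1) * r) * x = n * ENNReal.ofReal r * x + ENNReal.ofReal r * x := by
    rw [ENNReal.ofReal_mul (by positivity), ENNReal.ofReal_add (by positivity) zero_le_one,
      ENNReal.ofReal_natCast, ENNReal.ofReal_one]
    ring
  have h2 : ENNReal.ofReal (levelFactor n r c b) =
      (n * ENNReal.ofReal r) ^ c * ENNReal.ofReal r ^ b *
        ((c.factorial : ℝ≥0∞)⁻¹ * (b.factorial : ℝ≥0∞)⁻¹) := by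
    rw [levelFactor, ENNReal.ofReal_div_of_pos (by positivity), ENNReal.ofReal_mul (by positivity),
      ENNReal.ofReal_pow (by positivity), ENNReal.ofReal_pow hr, ENNReal.ofReal_mul (by positivity),
      ENNReal.ofReal_mul (by positivity), ENNReal.ofReal_natCast, ENNReal.ofReal_natCast,
      ENNReal.ofReal_natCast, div_eq_mul_inv, ENNReal.mul_inv (by simp) (by simp)]
  rw [h1, h2, nexp_add, poissonWeight, poissonWeight, mul_pow, mul_pow (ENNReal.ofReal r), pow_add,
    div_eq_mul_inv, div_eq_mul_inv]
  ring

/-! ### The two probabilities for a fixed bucket. -/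

section FixedBucket

variable {Ω S : Type*} [MeasurableSpace Ω] [MeasurableSpace S] {P : Measure Ω}
  [IsProbabilityMeasure P] {G₀ : Measure S} [IsProbabilityMeasure G₀]
  {n : ℕ} {θ r : ℝ} {ρ : ℝ → ℝ} {jump : ℕ → Ω → ℝ} {loc : ℕ → Ω → S}
  {lev : Fin (n + 1) → ℕ → Ω → ℕ}

lemma measure_countEvent_eq (hcrm : IsCRM P θ ρ G₀ jump loc)
    (hibp : IsIBPSample P (fun s => poissonMeasure (r * s).toNNReal) jump loc lev)
    (hθ : 0 < θ) (hr : 0 < r) (hρ : IsJumpDensity ρ) {D : Set S} (hD : MeasurableSet D)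
    (c b : ℕ) :
    P (countEvent D c b loc lev) = ENNReal.ofReal (levelFactor n r c b *
      phi (θ * (G₀ D).toReal) ρ (c + b) ((n + 1) * r)) := by
  have hT : Measurable fun ω => totalMass D fun k => (jump k ω, loc k ω) :=
    (measurable_totalMass hD).comp hcrm.measurable_atoms
  have hf : 0 ≤ levelFactor n r c b := by unfold levelFactor; positivity
  rw [hibp.measure_countEvent hr.le hcrm.measurable_jump hcrm.measurable_loc hD
    (hcrm.ae_totalMass_ne_top hθ hρ hD), ENNReal.ofReal_mul hf,
    ← hcrm.lintegral_totalMass_pow hθ hρ hD (by positivity), ← lintegral_const_mul _ (by fun_prop)]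
  exact lintegral_congr fun ω => poissonWeight_mul_poissonWeight n hr.le _ c b

/-- The weights of the atom `k` merge into `s^(l+a) e^{-us}`, and those of the rest likewise into a
tilted power; the Mecke formula then evaluates the sum over `k`. -/
lemma tsum_measure_traitEvent_inter_countEvent (hcrm : IsCRM P θ ρ G₀ jump loc)
    (hibp : IsIBPSample P (fun s => poissonMeasure (r * s).toNNReal) jump loc lev)
    (hθ : 0 < θ) (hr : 0 < r) (hρ : IsJumpDensity ρ) {D : Set S} (hD : MeasurableSet D)
    {c b l a : ℕ} (hl : l ≤ c) (ha : a ≤ b) (hla : 1 ≤ l + a) :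
    ∑' k, P (traitEvent D k l a loc lev ∩ countEvent D c b loc lev) =
      ENNReal.ofReal (levelFactor n r l a * levelFactor n r (c - l) (b - a) *
        (θ * (G₀ D).toReal * kappa ρ ((n + 1) * r) (l + a) *
          phi (θ * (G₀ D).toReal) ρ ((c - l) + (b - a)) ((n + 1) * r))) := by
  have hf : ∀ c b, 0 ≤ levelFactor n r c b := fun c b => by unfold levelFactor; positivity
  have hjm := hcrm.measurable_jump
  have hlm := hcrm.measurable_loc
  have hDi : Measurable (D.indicator (1 : S → ℝ≥0∞)) := measurable_one.indicator hD
  have hrm : ∀ k, Measurable fun ω => restMass D k fun k => (jump k ω, loc k ω) := fun k =>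
    (measurable_restMass hD k).comp hcrm.measurable_atoms
  rw [ENNReal.ofReal_mul (mul_nonneg (hf _ _) (hf _ _)), ENNReal.ofReal_mul (hf _ _),
    ← hcrm.tsum_lintegral_restMass_pow hθ hρ hD (by positivity) hla, ← ENNReal.tsum_mul_left]
  refine tsum_congr fun k => ?_
  rw [hibp.measure_traitEvent_inter_countEvent hr.le hjm hlm hD
    (hcrm.ae_totalMass_ne_top hθ hρ hD) hl ha, ← lintegral_const_mul _ (by fun_prop)]
  refine lintegral_congr fun ω => ?_
  rw [poissonWeight_mul_poissonWeight n hr.le, poissonWeight_mul_poissonWeight n hr.le]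
  ring

end FixedBucket

/-! ### Averaging over the random hash function. -/

section RandomBucket

variable {Ω Θ S : Type*} [MeasurableSpace Ω] [MeasurableSpace Θ] [MeasurableSpace S]
  {P : Measure Ω} [IsProbabilityMeasure P] {G₀ : Measure S} [IsProbabilityMeasure G₀]
  {n J : ℕ} {θ r : ℝ} {ρ : ℝ → ℝ} {jump : ℕ → Ω → ℝ} {loc : ℕ → Ω → S}
  {lev : Fin (n + 1) → ℕ → Ω → ℕ} {H : Θ → S → Fin J} {seed : Ω → Θ}

/-- Independence makes the joint law a product, and Tonelli lets the seed be frozen. -/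
lemma measure_mem_of_indepFun {Z : Type*} [MeasurableSpace Z] {ζ : Ω → Z} (hs : Measurable seed)
    (hζ : Measurable ζ) (h : IndepFun seed ζ P) {A : Set (Θ × Z)} (hA : MeasurableSet A) :
    P {ω | (seed ω, ζ ω) ∈ A} = ∫⁻ ϑ, P {ω | (ϑ, ζ ω) ∈ A} ∂P.map seed := by
  have h1 := (indepFun_iff_map_prod_eq_prod_map_map hs.aemeasurable hζ.aemeasurable).1 h
  have h2 : P {ω | (seed ω, ζ ω) ∈ A} = (P.map fun ω => (seed ω, ζ ω)) A := by
    rw [Measure.map_apply (hs.prodMk hζ) hA]; rfl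
  have : SFinite (P.map ζ) := inferInstance
  rw [h2, h1, Measure.prod_apply hA]
  refine lintegral_congr fun ϑ => ?_
  rw [Measure.map_apply hζ (measurable_prodMk_left hA)]
  rfl

lemma measurable_measure_mem {Z : Type*} [MeasurableSpace Z] {ζ : Ω → Z} (hζ : Measurable ζ)
    {A : Set (Θ × Z)} (hA : MeasurableSet A) :
    Measurable fun ϑ => P {ω | (ϑ, ζ ω) ∈ A} := by
  have h1 : ∀ ϑ, P {ω | (ϑ, ζ ω) ∈ A} = (P.map ζ) (Prod.mk ϑ ⁻¹' A) := fun ϑ => by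
    rw [Measure.map_apply hζ (measurable_prodMk_left hA)]; rfl
  simp_rw [h1]
  exact measurable_measure_prodMk_left hA

/-- The atoms and the levels of all samples. -/
abbrev Config (S : Type*) (n : ℕ) : Type _ := (ℕ → ℝ × S) × (Fin (n + 1) → ℕ → ℕ)

open Classical in
/-- The hash functions and configurations such that the bucket `j` has counts `c` and `b`. -/
def countSet (n : ℕ) (H : Θ → S → Fin J) (j : Fin J) (c b : ℕ) : Set (Θ × Config S n) :=
  {q | ∑' k, ((if (q.2.1 k).2 ∈ H q.1 ⁻¹' {j} then oldLevel (fun p => q.2.2 p.1 p.2) k else 0 : ℕ) :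
      ℝ≥0∞) = c ∧
    ∑' k, ((if (q.2.1 k).2 ∈ H q.1 ⁻¹' {j} then newLevel (fun p => q.2.2 p.1 p.2) k else 0 : ℕ) :
      ℝ≥0∞) = b}

/-- The hash functions and configurations such that the trait `k` is in the bucket `j`, with
levels `l` and `a`. -/
def traitSet (n : ℕ) (H : Θ → S → Fin J) (j : Fin J) (k l a : ℕ) : Set (Θ × Config S n) :=
  {q | H q.1 (q.2.1 k).2 = j ∧ oldLevel (fun p => q.2.2 p.1 p.2) k = l ∧
    newLevel (fun p => q.2.2 p.1 p.2) k = a}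


lemma measurable_hash_loc (hH : Measurable fun p : Θ × S => H p.1 p.2) (k : ℕ) :
    Measurable fun q : Θ × Config S n => H q.1 (q.2.1 k).2 :=
  hH.comp (measurable_fst.prodMk (measurable_snd.comp
    ((measurable_pi_apply k).comp (measurable_fst.comp measurable_snd))))

lemma measurable_level (i : Fin (n + 1)) (k : ℕ) :
    Measurable fun q : Θ × Config S n => q.2.2 i k :=
  (measurable_pi_apply k).comp
    ((measurable_pi_apply i).comp (measurable_snd.comp measurable_snd))

lemma measurable_oldLevel (k : ℕ) :
    Measurable fun q : Θ × Config S n => oldLevel (fun p => q.2.2 p.1 p.2) k :=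
  Finset.measurable_fun_sum _ fun i _ => measurable_level i.castSucc k

lemma measurable_newLevel (k : ℕ) :
    Measurable fun q : Θ × Config S n => newLevel (fun p => q.2.2 p.1 p.2) k :=
  measurable_level (Fin.last n) k

lemma measurableSet_countSet (hH : Measurable fun p : Θ × S => H p.1 p.2) (j : Fin J) (c b : ℕ) :
    MeasurableSet (countSet n H j c b) := by
  classical
  have hm : ∀ g : ℕ → Θ × Config S n → ℕ, (∀ k, Measurable (g k)) → Measurable
      fun q : Θ × Config S n => ∑' k, ((if (q.2.1 k).2 ∈ H q.1 ⁻¹' {j} then g k q else 0 : ℕ) : ℝ≥0∞) := by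
    intro g hg
    refine Measurable.tsum fun k => measurable_from_top.comp ?_
    exact Measurable.ite (measurable_hash_loc hH k (measurableSet_singleton j)) (hg k)
      measurable_const
  exact ((hm _ measurable_oldLevel) (measurableSet_singleton _)).inter
    ((hm _ measurable_newLevel) (measurableSet_singleton _))

lemma measurableSet_traitSet (hH : Measurable fun p : Θ × S => H p.1 p.2) (j : Fin J)
    (k l a : ℕ) : MeasurableSet (traitSet n H j k l a) :=
  (measurable_hash_loc hH k (measurableSet_singleton j)).inter
    ((measurable_oldLevel k (measurableSet_singleton l)).inter
      (measurable_newLevel k (measurableSet_singleton a)))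

/-- The configuration of the process. -/
def config (jump : ℕ → Ω → ℝ) (loc : ℕ → Ω → S) (lev : Fin (n + 1) → ℕ → Ω → ℕ) (ω : Ω) :
    Config S n :=
  (fun k => (jump k ω, loc k ω), fun i k => lev i k ω)

lemma mem_countSet_iff (hH : Measurable fun p : Θ × S => H p.1 p.2) (j : Fin J) (c b : ℕ) (ϑ : Θ)
    (ω : Ω) : (ϑ, config jump loc lev ω) ∈ countSet n H j c b ↔
      ω ∈ countEvent (H ϑ ⁻¹' {j}) c b loc lev := by
  have hD : MeasurableSet (H ϑ ⁻¹' {j}) :=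
    (hH.comp measurable_prodMk_left) (measurableSet_singleton j)
  simp only [countEvent, mem_ofPred_eq]
  rw [totalLevel_apply hD, X_last_apply hD]
  rfl

lemma mem_traitSet_iff (j : Fin J) (k l a : ℕ) (ϑ : Θ) (ω : Ω) :
    (ϑ, config jump loc lev ω) ∈ traitSet n H j k l a ↔
      ω ∈ traitEvent (H ϑ ⁻¹' {j}) k l a loc lev := by
  simp [traitSet, traitEvent, blockEvent, config]

/-- The general formula of the posterior weights. -/
theorem posterior_eq [StandardBorelSpace S] [NullSingletonClass G₀] (hn : 1 ≤ n)
    (hcrm : IsCRM P θ ρ G₀ jump loc)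
    (hibp : IsIBPSample P (fun s => poissonMeasure (r * s).toNNReal) jump loc lev)
    (hhash : IsUniformHash P G₀ jump loc lev H seed)
    (hθ : 0 < θ) (hr : 0 < r) (hρ : IsJumpDensity ρ)
    (j : Fin J) {c b l a : ℕ} (hl : l ≤ c) (ha : a ≤ b) (hla : 1 ≤ l + a) :
    posterior P loc lev H seed j c b l a =
        ENNReal.ofReal (θ / J * c.choose l * b.choose a *
          (phi (θ / J) ρ ((c - l) + (b - a)) ((n + 1) * r) /
            phi (θ / J) ρ (c + b) ((n + 1) * r)) *
          kappa ρ ((n + 1) * r) (l + a)) := by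
  have hH := hhash.measurable_hash
  have hs := hhash.measurable_seed
  have hJ : 0 < J := j.pos
  have hζ : Measurable (config jump loc lev) :=
    hcrm.measurable_atoms.prodMk
      (measurable_pi_lambda _ fun i => measurable_pi_lambda _ fun k => hibp.measurable_lev i k)
  have hDm : ∀ ϑ, MeasurableSet (H ϑ ⁻¹' {j}) := fun ϑ =>
    (hH.comp measurable_prodMk_left) (measurableSet_singleton j)
  have hprob : IsProbabilityMeasure (P.map seed) := Measure.isProbabilityMeasure_map hs.aemeasurable
  have hunif : ∀ᵐ ϑ ∂P.map seed, G₀ (H ϑ ⁻¹' {j}) = (J : ℝ≥0∞)⁻¹ := by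
    have hm : Measurable fun ϑ => G₀ (H ϑ ⁻¹' {j}) :=
      measurable_measure_prodMk_left (hH (measurableSet_singleton j))
    refine (ae_map_iff hs.aemeasurable (hm (measurableSet_singleton _))).2 ?_
    filter_upwards [hhash.uniform] with ω hω
    exact hω j
  have htoReal : ∀ ϑ, G₀ (H ϑ ⁻¹' {j}) = (J : ℝ≥0∞)⁻¹ →
      θ * (G₀ (H ϑ ⁻¹' {j})).toReal = θ / J := by
    intro ϑ hϑ
    rw [hϑ, ENNReal.toReal_inv, ENNReal.toReal_natCast, div_eq_mul_inv]
  have hu : (0 : ℝ) < (n + 1) * r := by positivity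
  have hφ : ∀ m, 0 < phi (θ / J) ρ m ((n + 1) * r) := by
    intro m
    -- The claim does not involve the seed, so one seed whose bucket has measure `1 / J` is enough.
    obtain ⟨ϑ, hϑ⟩ := hunif.exists
    rw [← htoReal ϑ hϑ]
    refine hcrm.phi_pos hθ hρ (hDm ϑ) ?_ hu m
    rw [hϑ]
    simp
  have hE : {ω | C loc lev H seed j ω = (c : ℝ≥0∞) ∧ B loc lev H seed j ω = (b : ℝ≥0∞)} =
      {ω | (seed ω, config jump loc lev ω) ∈ countSet n H j c b} := by
    ext ω
    exact (mem_countSet_iff hH j c b (seed ω) ω).symm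
  have hEm : MeasurableSet {ω | (seed ω, config jump loc lev ω) ∈ countSet n H j c b} :=
    (hs.prodMk hζ) (measurableSet_countSet hH j c b)
  -- Almost surely the singleton `{loc k ω}` contains no other location, so its counts are the
  -- levels of the trait `k`. This is where nonatomicity of `G₀` enters.
  have hA : ∀ k, ({ω | H (seed ω) (loc k ω) = j ∧ freq loc lev (loc k ω) ω = (l : ℝ≥0∞) ∧
        X loc lev (Fin.last n) ω {loc k ω} = (a : ℝ≥0∞)} : Set Ω) =ᵐ[P]
      {ω | (seed ω, config jump loc lev ω) ∈ traitSet n H j k l a} := by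
    intro k
    rw [eventuallyEq_set]
    filter_upwards [hcrm.ae_injective_loc] with ω hω
    have hmem : ∀ k', loc k' ω ∈ ({loc k ω} : Set S) ↔ k' = k := fun k' =>
      ⟨fun h => hω h, fun h => by rw [h]; rfl⟩
    simp only [mem_ofPred_eq, traitSet, config, freq]
    rw [totalLevel_apply (measurableSet_singleton _), X_last_apply (measurableSet_singleton _)]
    simp only [hmem]
    rw [tsum_eq_single k (fun k' hk' => by simp [hk']), tsum_eq_single k (fun k' hk' => by simp [hk'])]
    simp
  have hPE : P {ω | (seed ω, config jump loc lev ω) ∈ countSet n H j c b} =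
      ENNReal.ofReal (levelFactor n r c b * phi (θ / J) ρ (c + b) ((n + 1) * r)) := by
    rw [measure_mem_of_indepFun hs hζ hhash.indep (measurableSet_countSet hH j c b)]
    rw [lintegral_congr_ae (g := fun _ => ENNReal.ofReal
      (levelFactor n r c b * phi (θ / J) ρ (c + b) ((n + 1) * r)))]
    · simp
    · filter_upwards [hunif] with ϑ hϑ
      simp_rw [mem_countSet_iff hH]
      rw [← htoReal ϑ hϑ]
      exact measure_countEvent_eq hcrm hibp hθ hr hρ (hDm ϑ) c b
  have hPA : ∑' k, P ({ω | (seed ω, config jump loc lev ω) ∈ countSet n H j c b} ∩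
        {ω | (seed ω, config jump loc lev ω) ∈ traitSet n H j k l a}) =
      ENNReal.ofReal (levelFactor n r l a * levelFactor n r (c - l) (b - a) *
        (θ / J * kappa ρ ((n + 1) * r) (l + a) *
          phi (θ / J) ρ ((c - l) + (b - a)) ((n + 1) * r))) := by
    have hint : ∀ k, P ({ω | (seed ω, config jump loc lev ω) ∈ countSet n H j c b} ∩
        {ω | (seed ω, config jump loc lev ω) ∈ traitSet n H j k l a}) =
        ∫⁻ ϑ, P {ω | (ϑ, config jump loc lev ω) ∈ countSet n H j c b ∩ traitSet n H j k l a}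
          ∂P.map seed := fun k =>
      measure_mem_of_indepFun hs hζ hhash.indep
        ((measurableSet_countSet hH j c b).inter (measurableSet_traitSet hH j k l a))
    simp_rw [hint]
    rw [← lintegral_tsum fun k => (measurable_measure_mem hζ
      ((measurableSet_countSet hH j c b).inter (measurableSet_traitSet hH j k l a))).aemeasurable]
    rw [lintegral_congr_ae (g := fun _ => ENNReal.ofReal
      (levelFactor n r l a * levelFactor n r (c - l) (b - a) *
        (θ / J * kappa ρ ((n + 1) * r) (l + a) *
          phi (θ / J) ρ ((c - l) + (b - a)) ((n + 1) * r))))]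
    · simp
    · filter_upwards [hunif] with ϑ hϑ
      rw [← htoReal ϑ hϑ,
        ← tsum_measure_traitEvent_inter_countEvent hcrm hibp hθ hr hρ (hDm ϑ) hl ha hla]
      refine tsum_congr fun k => ?_
      congr 1
      ext ω
      rw [mem_ofPred_eq, mem_inter_iff, mem_countSet_iff hH, mem_traitSet_iff, inter_comm,
        mem_inter_iff]
  have hcf := levelFactor_pos hn hr c b
  calc posterior P loc lev H seed j c b l a
      = ∑' k, (P {ω | (seed ω, config jump loc lev ω) ∈ countSet n H j c b})⁻¹ *
          P ({ω | (seed ω, config jump loc lev ω) ∈ countSet n H j c b} ∩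
          {ω | (seed ω, config jump loc lev ω) ∈ traitSet n H j k l a}) := by
        rw [posterior, hE]
        refine tsum_congr fun k => ?_
        rw [cond_apply hEm]
        congr 1
        exact measure_congr ((ae_eq_refl _).inter (hA k))
    _ = _ := by
        rw [ENNReal.tsum_mul_left, hPE, hPA, mul_comm, ← div_eq_mul_inv,
          ← ENNReal.ofReal_div_of_pos (mul_pos hcf (hφ _)), mul_div_mul_comm,
          levelFactor_mul_div hn hr hl ha]
        congr 1
        ring

end RandomBucket

/-! ### Tools for computing `psi`, `phi` and `kappa` explicitly. -/

section LaplaceExponent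

variable {ρ : ℝ → ℝ}

lemma ofReal_one_sub_exp_eq_lintegral {v s : ℝ} (hv : 0 < v) (hs : 0 < s) :
    1 - nexp (ENNReal.ofReal v * ENNReal.ofReal s) =
      ∫⁻ w in Ioc 0 v, ENNReal.ofReal (s * Real.exp (-(w * s))) := by
  have hd : ∀ w : ℝ, HasDerivAt (fun w => -Real.exp (-(w * s))) (s * Real.exp (-(w * s))) w := by
    intro w
    have h1 : HasDerivAt (fun w : ℝ => -(w * s)) (-(1 * s)) w :=
      ((hasDerivAt_id w).mul_const s).neg
    exact h1.exp.fun_neg.congr_deriv (by ring)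
  have hc : Continuous fun w : ℝ => s * Real.exp (-(w * s)) := by fun_prop
  have hi := intervalIntegral.integral_eq_sub_of_hasDerivAt (a := 0) (b := v)
    (fun w _ => hd w) (hc.intervalIntegrable _ _)
  rw [← ENNReal.ofReal_mul hv.le, nexp_ofReal (by positivity), ← ENNReal.ofReal_one,
    ← ENNReal.ofReal_sub _ (Real.exp_pos _).le, ← ofReal_integral_eq_lintegral_ofReal,
    ← intervalIntegral.integral_of_le hv.le, hi]
  · congr 1
    simp
    ring
  · exact (hc.intervalIntegrable 0 v).1
  · exact Eventually.of_forall fun w => by simp only [Pi.zero_apply]; positivity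

/-- The derivative of `psi` is `kappa` of order one. -/
lemma IsJumpDensity.psi_eq_sub (hρ : IsJumpDensity ρ) {f F : ℝ → ℝ}
    (hκ : ∀ w, 0 < w → kappa ρ w 1 = f w) (hF : ∀ w, 0 ≤ w → HasDerivAt F (f w) w)
    (hf : ContinuousOn f (Ici 0)) {v : ℝ} (hv : 0 < v) : psi ρ v = F v - F 0 := by
  have hρm := hρ.measurable
  have hfi : IntervalIntegrable f volume 0 v :=
    (hf.mono (by rw [uIcc_of_le hv.le]; exact Icc_subset_Ici_self)).intervalIntegrable
  have hFi := intervalIntegral.integral_eq_sub_of_hasDerivAt (a := 0) (b := v)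
    (fun w hw => hF w (by rw [uIcc_of_le hv.le] at hw; exact hw.1)) hfi
  have hf0 : ∀ w ∈ Ioc 0 v, 0 ≤ f w := fun w hw => by
    rw [← hκ w hw.1]; exact hρ.kappa_nonneg w 1
  have h0 : 0 ≤ F v - F 0 := by
    rw [← hFi, intervalIntegral.integral_of_le hv.le]
    exact setIntegral_nonneg measurableSet_Ioc hf0
  rw [← ENNReal.ofReal_eq_ofReal_iff (hρ.psi_nonneg hv) h0, ← hρ.ofReal_psi hv, ← hFi,
    intervalIntegral.integral_of_le hv.le, ofReal_integral_eq_lintegral_ofReal hfi.1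
      ((ae_restrict_iff' measurableSet_Ioc).2 (Eventually.of_forall hf0))]
  -- Write `1 - e^{-vs}` as the integral of `s e^{-ws}` over `w ∈ (0, v]` and swap by Tonelli; the
  -- inner integral over `s` is `κ(w, 1) = f w`.
  calc ∫⁻ s in Ioi (0 : ℝ), ENNReal.ofReal (ρ s) *
        (1 - nexp (ENNReal.ofReal v * ENNReal.ofReal s))
      = ∫⁻ s in Ioi (0 : ℝ), ∫⁻ w in Ioc 0 v,
          ENNReal.ofReal (ρ s) * ENNReal.ofReal (s * Real.exp (-(w * s))) := by
        refine setLIntegral_congr_fun measurableSet_Ioi fun s hs => ?_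
        rw [ofReal_one_sub_exp_eq_lintegral hv hs, lintegral_const_mul _ (by fun_prop)]
    _ = ∫⁻ w in Ioc 0 v, ∫⁻ s in Ioi (0 : ℝ),
          ENNReal.ofReal (ρ s) * ENNReal.ofReal (s * Real.exp (-(w * s))) := by
        rw [lintegral_lintegral_swap]
        exact Measurable.aemeasurable (by fun_prop)
    _ = ∫⁻ w in Ioc 0 v, ENNReal.ofReal (f w) := by
        refine setLIntegral_congr_fun measurableSet_Ioc fun w hw => ?_
        have hw0 : 0 < w := hw.1
        rw [← hκ w hw0, ← hρ.ofReal_kappa hw0 le_rfl]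
        refine setLIntegral_congr_fun measurableSet_Ioi fun s hs => ?_
        have hs' : (0 : ℝ) < s := hs
        rw [pow_one, ← ENNReal.ofReal_mul hw0.le, nexp_ofReal (by positivity),
          ENNReal.ofReal_mul hs'.le]

/-- Induction on `m`. Equality on the open half-line is equality near each of its points, so it
survives differentiation; the sign in the recursion for `g` absorbs `(-1)^m`. -/
lemma neg_one_pow_mul_iteratedDeriv {f : ℝ → ℝ} {g : ℕ → ℝ → ℝ}
    (h0 : ∀ v, 0 < v → f v = g 0 v)
    (h : ∀ m v, 0 < v → HasDerivAt (g m) (-(g (m + 1) v)) v) (m : ℕ) {u : ℝ} (hu : 0 < u) :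
    (-1) ^ m * iteratedDeriv m f u = g m u := by
  have key : ∀ m : ℕ, ∀ u : ℝ, 0 < u → iteratedDeriv m f u = (-1) ^ m * g m u := by
    intro m
    induction m with
    | zero => intro u hu; simp [h0 u hu]
    | succ m ih =>
      intro u hu
      have he : iteratedDeriv m f =ᶠ[𝓝 u] fun v => (-1) ^ m * g m v := by
        filter_upwards [Ioi_mem_nhds hu] with v hv
        exact ih v hv
      rw [iteratedDeriv_succ, he.deriv_eq, ((h m u hu).const_mul _).deriv]
      ring
  rw [key m u hu, ← mul_assoc, ← mul_pow]
  simp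

/-- A gamma integral covering both special cases; the Gamma process corresponds to `α = 0`. -/
lemma kappa_tempered {α τ k : ℝ} (hα : α < 1) (hτ : 0 < τ)
    (h : ∀ s, 0 < s → ρ s = k * s ^ (-α - 1) * Real.exp (-(τ * s))) {u : ℝ} (hu : 0 < u) {m : ℕ}
    (hm : 1 ≤ m) :
    kappa ρ u m = k * Real.Gamma (m - α) / (τ + u) ^ ((m : ℝ) - α) := by
  have hm' : (1 : ℝ) ≤ m := by exact_mod_cast hm
  have h1 := Real.integral_rpow_mul_exp_neg_mul_Ioi (a := m - α) (r := τ + u) (by linarith)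
    (by linarith)
  have h2 : kappa ρ u m =
      ∫ s in Ioi (0 : ℝ), k * (s ^ ((m : ℝ) - α - 1) * Real.exp (-((τ + u) * s))) := by
    refine setIntegral_congr_fun measurableSet_Ioi fun s hs => ?_
    have hs' : (0 : ℝ) < s := hs
    rw [h s hs', show (m : ℝ) - α - 1 = m + (-α - 1) by ring, Real.rpow_add hs', Real.rpow_natCast,
      show -((τ + u) * s) = -(u * s) + -(τ * s) by ring, Real.exp_add]
    ring
  rw [h2, integral_const_mul, h1, one_div, Real.inv_rpow (by linarith)]
  ring

end LaplaceExponent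

/-! ### The Gamma process. -/

section Gamma

variable {ρ : ℝ → ℝ}

lemma kappa_gamma (h : ∀ s, 0 < s → ρ s = s⁻¹ * Real.exp (-s)) {u : ℝ} (hu : 0 < u) {m : ℕ}
    (hm : 1 ≤ m) : kappa ρ u m = (m - 1).factorial / (1 + u) ^ m := by
  have h1 := kappa_tempered (ρ := ρ) (α := 0) (τ := 1) (k := 1) one_pos one_pos
    (fun s hs => by rw [h s hs]; simp [Real.rpow_neg_one]) hu hm
  obtain ⟨m, rfl⟩ := Nat.exists_eq_add_of_le' hm
  rw [h1]
  rw [sub_zero, one_mul, Nat.add_sub_cancel, Nat.cast_add_one, Real.Gamma_nat_eq_factorial]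
  congr 1
  exact_mod_cast Real.rpow_natCast (1 + u) (m + 1)

lemma psi_gamma (hρ : IsJumpDensity ρ) (h : ∀ s, 0 < s → ρ s = s⁻¹ * Real.exp (-s)) {u : ℝ}
    (hu : 0 < u) : psi ρ u = Real.log (1 + u) := by
  have h1 := hρ.psi_eq_sub (f := fun w => 1 / (1 + w)) (F := fun w => Real.log (1 + w))
    (fun w hw => by simpa using kappa_gamma h hw le_rfl)
    (fun w hw => by
      have : HasDerivAt (fun w : ℝ => 1 + w) 1 w := (hasDerivAt_id w).const_add 1
      exact this.log (by positivity))
    (ContinuousOn.div continuousOn_const (by fun_prop) fun w (hw : 0 ≤ w) => by positivity) hu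
  simpa using h1

/-- Here `e^{-tψ(u)} = (1+u)^{-t}`, and the differentiation of order `m + 1` brings out `t + m =
Γ(t+m+1) / Γ(t+m)`. -/
lemma phi_gamma (hρ : IsJumpDensity ρ) (h : ∀ s, 0 < s → ρ s = s⁻¹ * Real.exp (-s)) {t u : ℝ}
    (ht : 0 < t) (hu : 0 < u) (m : ℕ) :
    phi t ρ m u = Real.Gamma (t + m) / Real.Gamma t * (1 + u) ^ (-t - m) := by
  refine neg_one_pow_mul_iteratedDeriv
    (g := fun m v => Real.Gamma (t + m) / Real.Gamma t * (1 + v) ^ (-t - m)) ?_ ?_ m hu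
  · intro v hv
    have hv' : 0 < 1 + v := by positivity
    rw [psi_gamma hρ h hv]
    simp only [Nat.cast_zero, add_zero, sub_zero]
    rw [div_self (Real.Gamma_pos_of_pos ht).ne', one_mul, Real.rpow_def_of_pos hv']
    congr 1; ring
  · intro m v hv
    have hv' : 0 < 1 + v := by positivity
    have hd : HasDerivAt (fun v : ℝ => 1 + v) 1 v := (hasDerivAt_id v).const_add 1
    refine ((hd.rpow_const (p := -t - m) (Or.inl hv'.ne')).const_mul
      (Real.Gamma (t + m) / Real.Gamma t)).congr_deriv ?_
    push_cast
    rw [← add_assoc, Real.Gamma_add_one (by positivity), show -t - ((m : ℝ) + 1) = -t - m - 1 by ring]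
    ring

lemma phi_div_phi_mul_kappa_gamma (hρ : IsJumpDensity ρ)
    (h : ∀ s, 0 < s → ρ s = s⁻¹ * Real.exp (-s)) {t u : ℝ}
    (ht : 0 < t) (hu : 0 < u) {p q m : ℕ} (hm : 1 ≤ m) (hpq : p + m = q) :
    phi t ρ p u / phi t ρ q u * kappa ρ u m =
      (m - 1).factorial * (Real.Gamma (t + p) / Real.Gamma (t + q)) := by
  have hu' : 0 < 1 + u := by positivity
  rw [phi_gamma hρ h ht hu, phi_gamma hρ h ht hu, kappa_gamma h hu hm]
  have hG := Real.Gamma_pos_of_pos ht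
  have hq := Real.Gamma_pos_of_pos (show 0 < t + q by positivity)
  have h1 : (1 + u) ^ (-t - (p : ℝ)) = (1 + u) ^ (-t - (q : ℝ)) * (1 + u) ^ m := by
    rw [← Real.rpow_natCast, ← Real.rpow_add hu', ← hpq]
    congr 1; push_cast; ring
  have h2 := Real.rpow_pos_of_pos hu' (-t - (q : ℝ))
  rw [h1]
  field_simp

end Gamma

/-! ### The generalized Gamma process and the generalized factorial coefficients. -/

section GeneralizedGamma

lemma rising_succ (x : ℝ) (m : ℕ) : rising x (m + 1) = rising x m * (x + m) :=
  Finset.prod_range_succ _ _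

lemma Gamma_add_natCast {x : ℝ} (hx : 0 < x) (m : ℕ) :
    Real.Gamma (x + m) = Real.Gamma x * rising x m := by
  induction m with
  | zero => simp [rising]
  | succ m ih =>
    push_cast
    rw [← add_assoc, Real.Gamma_add_one (by positivity), ih, rising_succ]
    ring

lemma genFactCoeff_succ_zero (m : ℕ) (α : ℝ) :
    genFactCoeff (m + 1) 0 α = m * genFactCoeff m 0 α := by
  simp [genFactCoeff, rising_succ, mul_comm]

/-- The new factor of the rising factorial splits as `m - iα = (m - α(k+1)) + α(k+1-i)`, and `k+1-i`
lowers the binomial coefficient from `k+1` to `k`. -/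
lemma genFactCoeff_succ_succ (m k : ℕ) (α : ℝ) :
    genFactCoeff (m + 1) (k + 1) α =
      α * genFactCoeff m k α + (m - α * (k + 1)) * genFactCoeff m (k + 1) α := by
  have h1 : ∑ i ∈ Finset.range (k + 1 + 1),
        (-1) ^ i * ((k + 1).choose i : ℝ) * rising (-(i * α)) (m + 1) =
      (k + 1) * α * ∑ i ∈ Finset.range (k + 1), (-1) ^ i * (k.choose i : ℝ) * rising (-(i * α)) m +
      (m - α * (k + 1)) * ∑ i ∈ Finset.range (k + 1 + 1),
        (-1) ^ i * ((k + 1).choose i : ℝ) * rising (-(i * α)) m := by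
    have h2 : ∑ i ∈ Finset.range (k + 1), (-1) ^ i * (k.choose i : ℝ) * rising (-(i * α)) m =
        ∑ i ∈ Finset.range (k + 1 + 1), (-1) ^ i * (k.choose i : ℝ) * rising (-(i * α)) m := by
      rw [Finset.sum_range_succ _ (k + 1)]
      simp
    rw [h2, Finset.mul_sum, Finset.mul_sum, ← Finset.sum_add_distrib]
    refine Finset.sum_congr rfl fun i hi => ?_
    have hi' : i ≤ k + 1 := Nat.lt_succ_iff.1 (Finset.mem_range.1 hi)
    have h3 : (k.choose i : ℝ) * (k + 1) = (k + 1).choose i * (k + 1 - i) := by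
      have := Nat.choose_mul_succ_eq k i
      have h4 : ((k.choose i * (k + 1) : ℕ) : ℝ) = (((k + 1).choose i * (k + 1 - i) : ℕ) : ℝ) := by
        rw [this]
      push_cast [Nat.cast_sub hi'] at h4
      exact h4
    rw [rising_succ]
    linear_combination (-1) ^ i * α * rising (-(i * α)) m * (-h3)
  rw [genFactCoeff, h1, genFactCoeff, genFactCoeff, Nat.factorial_succ]
  have hk : ((k.factorial : ℕ) : ℝ) ≠ 0 := Nat.cast_ne_zero.2 (Nat.factorial_ne_zero k)
  push_cast
  field_simp

lemma genFactCoeff_zero_succ (k : ℕ) (α : ℝ) : genFactCoeff 0 (k + 1) α = 0 := by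
  have h := add_pow (-1 : ℝ) 1 (k + 1)
  simp only [neg_add_cancel, one_pow, mul_one] at h
  rw [zero_pow (Nat.succ_ne_zero k)] at h
  simp [genFactCoeff, rising, ← h]

lemma genFactCoeff_eq_zero {m k : ℕ} (h : m < k) (α : ℝ) : genFactCoeff m k α = 0 := by
  induction m generalizing k with
  | zero =>
    obtain ⟨k, rfl⟩ := Nat.exists_eq_add_of_lt h
    rw [zero_add]
    exact genFactCoeff_zero_succ k α
  | succ m ih =>
    obtain ⟨k, rfl⟩ : ∃ k', k = k' + 1 := ⟨k - 1, by omega⟩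
    rw [genFactCoeff_succ_succ, ih (by omega), ih (by omega)]
    ring

/-- The sum `∑ i ≤ m, t^i 𝒞(m, i; α) / x^(m - α i)`. -/
def genFactSum (t α : ℝ) (m : ℕ) (x : ℝ) : ℝ :=
  ∑ i ∈ Finset.range (m + 1), t ^ i * (genFactCoeff m i α / x ^ ((m : ℝ) - α * i))

/-- Exactly the relation that makes minus the derivative of `e^{-t x^α} S_m(x)` equal to `e^{-t x^α}
S_{m+1}(x)`, where `S_m` is the sum. Termwise it is the triangular recurrence of the coefficients.
-/
lemma hasDerivAt_genFactSum (t α : ℝ) (m : ℕ) {x : ℝ} (hx : 0 < x) :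
    HasDerivAt (genFactSum t α m)
      (t * α * x ^ (α - 1) * genFactSum t α m x - genFactSum t α (m + 1) x) x := by
  have hterm : ∀ i ∈ Finset.range (m + 1), HasDerivAt
      (fun y : ℝ => t ^ i * (genFactCoeff m i α / y ^ ((m : ℝ) - α * i)))
      (t ^ i * (genFactCoeff m i α * ((α * i - m) * x ^ (α * i - m - 1)))) x := by
    intro i _
    have h1 := (((hasDerivAt_id x).rpow_const (p := α * i - m) (Or.inl hx.ne')).const_mul
      (genFactCoeff m i α)).const_mul (t ^ i)
    simp only [id, one_mul] at h1
    refine h1.congr_of_eventuallyEq ?_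
    filter_upwards [Ioi_mem_nhds hx] with y (hy : 0 < y)
    rw [div_eq_mul_inv, ← Real.rpow_neg hy.le, neg_sub]
  have hsum := HasDerivAt.fun_sum hterm
  refine hsum.congr_deriv ?_
  have hdiv : ∀ m' i : ℕ, t ^ i * (genFactCoeff m' i α / x ^ ((m' : ℝ) - α * i)) =
      t ^ i * (genFactCoeff m' i α * x ^ (α * i - m')) := fun m' i => by
    rw [div_eq_mul_inv, ← Real.rpow_neg hx.le, neg_sub]
  simp_rw [genFactSum, hdiv]
  rw [Finset.sum_range_succ' _ (m + 1)]
  -- The term `i = m + 1` may be added because its coefficient lies above the diagonal and vanishes;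
  -- the sum can then be shifted by one to match the recurrence.
  have hlast : ∑ i ∈ Finset.range (m + 1),
        t ^ i * (genFactCoeff m i α * ((α * i - m) * x ^ (α * i - m - 1))) =
      ∑ i ∈ Finset.range (m + 1), t ^ (i + 1) * (genFactCoeff m (i + 1) α *
        ((α * (i + 1 : ℕ) - m) * x ^ (α * (i + 1 : ℕ) - m - 1))) +
      t ^ 0 * (genFactCoeff m 0 α * ((α * (0 : ℕ) - m) * x ^ (α * (0 : ℕ) - m - 1))) := by
    rw [← Finset.sum_range_succ' (fun i : ℕ =>
      t ^ i * (genFactCoeff m i α * ((α * i - m) * x ^ (α * i - m - 1)))) (m + 1),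
      Finset.sum_range_succ _ (m + 1), genFactCoeff_eq_zero (Nat.lt_succ_self m)]
    simp
  rw [hlast, Finset.mul_sum, genFactCoeff_succ_zero]
  have h0 : (x : ℝ) ^ (α * (0 : ℕ) - ((m + 1 : ℕ) : ℝ)) = x ^ (α * (0 : ℕ) - (m : ℝ) - 1) := by
    congr 1; push_cast; ring
  rw [h0]
  have hS : ∑ i ∈ Finset.range (m + 1), t ^ (i + 1) * (genFactCoeff (m + 1) (i + 1) α *
        x ^ (α * (i + 1 : ℕ) - ((m + 1 : ℕ) : ℝ))) =
      ∑ i ∈ Finset.range (m + 1), t * α * x ^ (α - 1) *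
        (t ^ i * (genFactCoeff m i α * x ^ (α * i - m))) -
      ∑ i ∈ Finset.range (m + 1), t ^ (i + 1) * (genFactCoeff m (i + 1) α *
        ((α * (i + 1 : ℕ) - m) * x ^ (α * (i + 1 : ℕ) - m - 1))) := by
    rw [← Finset.sum_sub_distrib]
    refine Finset.sum_congr rfl fun i _ => ?_
    have e1 : x ^ (α * (i + 1 : ℕ) - ((m + 1 : ℕ) : ℝ)) = x ^ (α - 1) * x ^ (α * i - m) := by
      rw [← Real.rpow_add hx]; congr 1; push_cast; ring
    have e2 : x ^ (α * (i + 1 : ℕ) - (m : ℝ) - 1) = x ^ (α - 1) * x ^ (α * i - m) := by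
      rw [← Real.rpow_add hx]; congr 1; push_cast; ring
    rw [e1, e2, genFactCoeff_succ_succ]
    push_cast
    ring
  rw [hS]
  push_cast
  ring

variable {ρ : ℝ → ℝ} {α τ : ℝ}

lemma kappa_generalizedGamma (hα1 : α < 1) (hτ : 0 < τ)
    (h : ∀ s, 0 < s → ρ s = α / Real.Gamma (1 - α) * s ^ (-α - 1) * Real.exp (-(τ * s)))
    {u : ℝ} (hu : 0 < u) {m : ℕ} (hm : 1 ≤ m) :
    kappa ρ u m = α * rising (1 - α) (m - 1) / (τ + u) ^ ((m : ℝ) - α) := by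
  rw [kappa_tempered hα1 hτ h hu hm]
  obtain ⟨m, rfl⟩ := Nat.exists_eq_add_of_le' hm
  have hG := Real.Gamma_pos_of_pos (sub_pos.2 hα1)
  have h1 : Real.Gamma (((m + 1 : ℕ) : ℝ) - α) = Real.Gamma (1 - α) * rising (1 - α) m := by
    rw [← Gamma_add_natCast (sub_pos.2 hα1)]
    congr 1; push_cast; ring
  rw [h1, Nat.add_sub_cancel]
  congr 1
  field_simp

lemma psi_generalizedGamma (hρ : IsJumpDensity ρ) (hα1 : α < 1) (hτ : 0 < τ)
    (h : ∀ s, 0 < s → ρ s = α / Real.Gamma (1 - α) * s ^ (-α - 1) * Real.exp (-(τ * s)))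
    {u : ℝ} (hu : 0 < u) : psi ρ u = (τ + u) ^ α - τ ^ α := by
  have hpos : ∀ w : ℝ, 0 ≤ w → 0 < τ + w := fun w hw => by positivity
  have h1 := hρ.psi_eq_sub (f := fun w => α * (τ + w) ^ (α - 1)) (F := fun w => (τ + w) ^ α)
    (fun w hw => by
      rw [kappa_generalizedGamma hα1 hτ h hw le_rfl]
      simp only [rising, Nat.sub_self, Finset.range_zero, Finset.prod_empty, mul_one, Nat.cast_one]
      rw [div_eq_mul_inv, ← Real.rpow_neg (hpos w hw.le).le, neg_sub])
    (fun w hw => by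
      have hd : HasDerivAt (fun w : ℝ => τ + w) 1 w := (hasDerivAt_id w).const_add τ
      simpa using hd.rpow_const (p := α) (Or.inl (hpos w hw).ne'))
    (fun w hw => ContinuousAt.continuousWithinAt (continuousAt_const.mul
      (ContinuousAt.rpow_const (by fun_prop) (Or.inl (hpos w hw).ne')))) hu
  simpa using h1

lemma phi_generalizedGamma (hρ : IsJumpDensity ρ) (hα1 : α < 1) (hτ : 0 < τ)
    (h : ∀ s, 0 < s → ρ s = α / Real.Gamma (1 - α) * s ^ (-α - 1) * Real.exp (-(τ * s)))
    (t : ℝ) {u : ℝ} (hu : 0 < u) (m : ℕ) :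
    phi t ρ m u = Real.exp (-(t * ((τ + u) ^ α - τ ^ α))) * genFactSum t α m (τ + u) := by
  refine neg_one_pow_mul_iteratedDeriv
    (g := fun m v => Real.exp (-(t * ((τ + v) ^ α - τ ^ α))) * genFactSum t α m (τ + v))
    ?_ ?_ m hu
  · intro v hv
    rw [psi_generalizedGamma hρ hα1 hτ h hv]
    simp [genFactSum, genFactCoeff, rising]
  · intro m v hv
    have hv' : 0 < τ + v := by positivity
    have hd : HasDerivAt (fun v : ℝ => τ + v) 1 v := (hasDerivAt_id v).const_add τ
    have h1 := (((hd.rpow_const (p := α) (Or.inl hv'.ne')).sub_const (τ ^ α)).const_mul t).neg.exp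
    have h2 := (hasDerivAt_genFactSum t α m hv').comp v hd
    refine (h1.mul h2).congr_deriv ?_
    simp only [Function.comp_apply, Pi.neg_apply]
    ring

lemma phi_div_phi_mul_kappa_generalizedGamma (hρ : IsJumpDensity ρ) (hα1 : α < 1)
    (hτ : 0 < τ)
    (h : ∀ s, 0 < s → ρ s = α / Real.Gamma (1 - α) * s ^ (-α - 1) * Real.exp (-(τ * s)))
    (t : ℝ) {u : ℝ} (hu : 0 < u) (p q : ℕ) {m : ℕ} (hm : 1 ≤ m) :
    phi t ρ p u / phi t ρ q u * kappa ρ u m =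
      α * rising (1 - α) (m - 1) / (τ + u) ^ ((m : ℝ) - α) *
        (genFactSum t α p (τ + u) / genFactSum t α q (τ + u)) := by
  rw [phi_generalizedGamma hρ hα1 hτ h t hu, phi_generalizedGamma hρ hα1 hτ h t hu,
    kappa_generalizedGamma hα1 hτ h hu hm, mul_div_mul_left _ _ (Real.exp_pos _).ne', mul_comm]

end GeneralizedGamma

end TraitSketch

end

theorem proposition2
    {Ω Θ S : Type*} [MeasurableSpace Ω] [MeasurableSpace Θ] [MeasurableSpace S]
    [StandardBorelSpace S]
    (P : Measure Ω) [IsProbabilityMeasure P]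
    (G₀ : Measure S) [IsProbabilityMeasure G₀] [NullSingletonClass G₀]
    (n J : ℕ) (hn : 1 ≤ n)
    (θ r : ℝ) (hθ : 0 < θ) (hr : 0 < r)
    (ρ : ℝ → ℝ) (hρ : TraitSketch.IsJumpDensity ρ)
    (jump : ℕ → Ω → ℝ) (loc : ℕ → Ω → S) (lev : Fin (n + 1) → ℕ → Ω → ℕ)
    (H : Θ → S → Fin J) (seed : Ω → Θ)
    (hcrm : TraitSketch.IsCRM P θ ρ G₀ jump loc)
    (hibp : TraitSketch.IsIBPSample P (fun s => poissonMeasure (r * s).toNNReal) jump loc lev)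
    (hhash : TraitSketch.IsUniformHash P G₀ jump loc lev H seed)
    (j : Fin J) (c b l a : ℕ) (hl : l ≤ c) (ha : a ≤ b) (hla : 1 ≤ l + a) :
    TraitSketch.posterior P loc lev H seed j c b l a =
        ENNReal.ofReal (θ / J * c.choose l * b.choose a *
          (TraitSketch.phi (θ / J) ρ ((c - l) + (b - a)) ((n + 1) * r) /
            TraitSketch.phi (θ / J) ρ (c + b) ((n + 1) * r)) *
          TraitSketch.kappa ρ ((n + 1) * r) (l + a)) ∧
    ((∀ s, 0 < s → ρ s = s⁻¹ * Real.exp (-s)) →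
      TraitSketch.posterior P loc lev H seed j c b l a =
        ENNReal.ofReal (θ / J * c.choose l * b.choose a * ((l + a - 1).factorial : ℝ) *
          (Real.Gamma (θ / J + ((c - l) + (b - a) : ℕ)) / Real.Gamma (θ / J + (c + b : ℕ))))) ∧
    (∀ α τ : ℝ, 0 < α → α < 1 → 0 < τ →
      (∀ s, 0 < s → ρ s =
        α / Real.Gamma (1 - α) * s ^ (-α - 1) * Real.exp (-(τ * s))) →
      TraitSketch.posterior P loc lev H seed j c b l a =
        ENNReal.ofReal (θ / J * c.choose l * b.choose a *
          (α * TraitSketch.rising (1 - α) (l + a - 1) /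
            (τ + (n + 1) * r) ^ (-α + (l : ℝ) + a)) *
          ((∑ i ∈ Finset.range ((c - l) + (b - a) + 1), (θ / J) ^ i *
              (TraitSketch.genFactCoeff ((c - l) + (b - a)) i α /
                (τ + (n + 1) * r) ^ ((((c - l) + (b - a) : ℕ) : ℝ) - α * i))) /
            (∑ i ∈ Finset.range (c + b + 1), (θ / J) ^ i *
              (TraitSketch.genFactCoeff (c + b) i α /
                (τ + (n + 1) * r) ^ (((c + b : ℕ) : ℝ) - α * i)))))) := by
  have hJ : (0 : ℝ) < J := by exact_mod_cast j.pos
  have ht : 0 < θ / J := div_pos hθ hJ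
  have hu : 0 < ((n : ℝ) + 1) * r := by positivity
  have hmain := TraitSketch.posterior_eq hn hcrm hibp hhash hθ hr hρ j hl ha hla
  refine ⟨hmain, fun h => ?_, fun α τ _ hα1 hτ h => ?_⟩
  · rw [hmain, mul_assoc, TraitSketch.phi_div_phi_mul_kappa_gamma hρ h ht hu hla (by omega),
      ← mul_assoc]
  · rw [hmain, mul_assoc,
      TraitSketch.phi_div_phi_mul_kappa_generalizedGamma hρ hα1 hτ h (θ / J) hu _ _ hla,
      ← mul_assoc]
    have he : -α + (l : ℝ) + a = ((l + a : ℕ) : ℝ) - α := by push_cast; ring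
    rw [he]
    rfl
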